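/- **Setting.** Let $b\in\mathbb R$, $\sigma\neq0$, $r>0$, $K\in\mathbb R$, let $W$ be a standard Brownian motion and, for $x>0$, let $X_t=x\exp\big((b-\sigma^2)t+\sqrt2\,\sigma W_t\big)$, so that $dX_t=bX_t\,dt+\sqrt2\,\sigma X_t\,dW_t$, $X_0=x$. Let $h:(0,\infty)\to\mathbb R$ be right-continuous and increasing (not necessarily strictly), with $\lim_{x\to\infty}h(x)=\infty$ and $\mathbb E\int_0^\infty e^{-rt}|h(X_t)|\,dt<\infty$ for every $x>0$. Put $h(0)=\lim_{x\downarrow0}h(x)\in[-\infty,\infty)$, $$m,n=\frac{1}{2\sigma^2}\Big[\sigma^2-b\mp\sqrt{(b-\sigma^2)^2+4\sigma^2r}\Big],\quad m<0<n,\qquad c=\frac1{\sigma^2(n-m)},$$ $$R_h(x)=c\Big[x^m\int_0^xs^{-m-1}h(s)\,ds+x^n\int_x^\infty s^{-n-1}h(s)\,ds\Big].$$ For $K_1,K_0>0$, the HJB equation is the pair of coupled variational inequalities on $(0,\infty)$ $$\max\{\sigma^2x^2w_1''+bxw_1'-rw_1+h,\ w_0-w_1-K_0,\ -w_1-K\}=0,$$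 $$\max\{\sigma^2x^2w_0''+bxw_0'-rw_0,\ w_1-w_0-K_1,\ -w_0-K\}=0.$$ It is satisfied by $w_1,w_0$ if both functions are $C^1$ on $(0,\infty)$ and if there is a finite set outside which, at every continuity point of $h$, both are twice differentiable and both equalities hold. **The system.** Consider, for $\zeta>0$ and $0<\delta<\gamma<\beta<\alpha$, the five equations $$m\int_\beta^\alpha s^{-m-1}h(s)\,ds+rK_0\beta^{-m}+rK_1\alpha^{-m}=0,\qquad n\int_\beta^\alpha s^{-n-1}h(s)\,ds+rK_0\beta^{-n}+rK_1\alpha^{-n}=0,$$ $$n\int_\delta^\infty s^{-n-1}[h(s)+rK]\,ds-n\int_\gamma^\beta s^{-n-1}[h(s)+rK_0]\,ds=0,$$ $$n\int_\beta^\infty s^{-n-1}[h(s)+rK_0]\,ds+rK\zeta^{-n}=0,$$ $$m\int_0^\gamma s^{-m-1}[h(s)+rK_0]\,ds-m\int_0^\delta s^{-m-1}[h(s)+rK]\,ds-rK\zeta^{-m}=0,$$ and put $$\Gamma_1=-c\int_0^\delta s^{-m-1}[h(s)+rK]\,ds,\quad \Gamma_2=-c\int_\delta^\infty s^{-n-1}[h(s)+rK]\,ds,$$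 $$\Delta_1=\frac{rK\zeta^{-m}}{\sigma^2m(n-m)},\quad\Delta_2=-\frac{rK\zeta^{-n}}{\sigma^2n(n-m)},\quad A=\Delta_1-c\int_0^\alpha s^{-m-1}[h(s)-rK_1]\,ds,$$ $$w_1(x)=\begin{cases}-K,&x\le\delta\\ \Gamma_1x^m+\Gamma_2x^n+R_h(x),&\delta<x<\gamma\\ \Delta_1x^m+\Delta_2x^n-K_0,&\gamma\le x\le\beta\\ Ax^m+R_h(x),&x>\beta\end{cases}\qquad w_0(x)=\begin{cases}-K,&x\le\zeta\\ \Delta_1x^m+\Delta_2x^n,&\zeta<x<\alpha\\ Ax^m+R_h(x)-K_1,&x\ge\alpha.\end{cases}$$ **The critical values.** (a) If $h(0)<-rK$, there is a unique $\delta_\dagger>0$ with $\int_{\delta_\dagger}^\infty s^{-n-1}[h(s)+rK]\,ds=0$. (b) If moreover $K<0$, then for every $K_1>0$ there is a unique pair $(\zeta,\alpha)=(\zeta(K_1),\alpha(K_1))$ with $0<\zeta<\alpha$, $\delta_\dagger<\alpha$ and $$m\int_{\delta_\dagger}^\alpha s^{-m-1}[h(s)-rK_1]\,ds+r(K_1+K)\delta_\dagger^{-m}-rK\zeta^{-m}=0,$$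 $$-n\int_{\delta_\dagger}^\alpha s^{-n-1}[h(s)-rK_1]\,ds-r(K_1+K)\delta_\dagger^{-n}+rK\zeta^{-n}=0.$$ (c) If moreover $h(\delta_\dagger)<0$, there is a unique $K_1^\dagger>0$ such that $\zeta(K_1)<\delta_\dagger$ for all $K_1\in(0,K_1^\dagger)$ and $\delta_\dagger<\zeta(K_1)$ for all $K_1>K_1^\dagger$. (d) If moreover $0<K_1<K_1^\dagger$ and $\alpha=\alpha(K_1)$, there is a unique $\hat x\in(\delta_\dagger,\alpha)$ such that the function $$x\mapsto cmx^{m-1}\int_x^\alpha s^{-m-1}[h(s)-rK_1]\,ds-cnx^{n-1}\int_x^\alpha s^{-n-1}[h(s)-rK_1]\,ds$$ is strictly positive on $[\delta_\dagger,\hat x)$ and strictly negative on $(\hat x,\alpha)$, and $$K_0^\dagger:=-K_1-\frac{n\hat x^n}{r}\int_{\hat x}^\alpha s^{-n-1}[h(s)-rK_1]\,ds>0.$$ Thus $\delta_\dagger$ and $K_1^\dagger$ depend on neither $K_1$ nor $K_0$, and $K_0^\dagger$ does not depend on $K_0$. **The characterisation.** For all $K_1,K_0>0$ the following are equivalent.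 1. The system has a unique solution $(\zeta,\delta,\gamma,\beta,\alpha)$ with $\zeta>0$ and $0<\delta<\gamma<\beta<\alpha$, and, for this solution, $\Gamma_1,\Gamma_2,A,\Delta_1,\Delta_2>0$, the functions $w_1,w_0$ are increasing (not necessarily strictly), and they satisfy the HJB equation. 2. $K<0$, $h(0)<-rK_0$, $h(\delta_\dagger)<0$, $K_1<K_1^\dagger$ and $K_0<K_0^\dagger$. In 2 each condition is read under the preceding ones, which ensure that the critical value it mentions exists. -/

import Mathlib

open Set Filter Topology MeasureTheory ProbabilityTheory
open scoped NNReal ENNReal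

noncomputable section

/-- The data of the switching problem apart from the two switching costs: the drift `b` and the
volatility `√2 σ` of the geometric Brownian motion, the discount rate `r`, the abandonment cost `K`
and the running payoff `h` (only its values on `(0, ∞)` matter).  The switching costs `K₁`, `K₀`
are kept as separate arguments, so that it is visible what depends on them. -/
structure SwitchingModel where
  b : ℝ
  σ : ℝ
  r : ℝ
  K : ℝ
  h : ℝ → ℝ

/-- The free boundary points of the case with abandonment in both modes. -/
@[ext] structure FreeBoundary where
  ζ : ℝ
  δ : ℝ
  γ : ℝ
  β : ℝ
  α : ℝ

namespace SwitchingModel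

variable (M : SwitchingModel)

/-- The geometric Brownian motion started at `x`, i.e. the solution of
`dX = b X dt + √2 σ X dW`, `X₀ = x`. -/
def X {Ω : Type*} (W : ℝ≥0 → Ω → ℝ) (x t : ℝ) (ω : Ω) : ℝ :=
  x * Real.exp ((M.b - M.σ ^ 2) * t + Real.sqrt 2 * M.σ * W t.toNNReal ω)

/-- The standing assumptions on the data, for a Brownian motion `W` under `P`. -/
structure Standing {Ω : Type*} [MeasurableSpace Ω] (P : Measure Ω) (W : ℝ≥0 → Ω → ℝ) : Prop where
  sigma_ne : M.σ ≠ 0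
  r_pos : 0 < M.r
  right_cont : ∀ x, 0 < x → ContinuousWithinAt M.h (Ici x) x
  mono : MonotoneOn M.h (Ioi 0)
  tendsto_top : Tendsto M.h atTop atTop
  integrable : ∀ x, 0 < x →
    (∫⁻ ω, (∫⁻ t in Ioi (0 : ℝ),
      ENNReal.ofReal (Real.exp (-M.r * t) * |M.h (M.X W x t ω)|)) ∂P) < ∞

/-- The negative exponent `m` of the Euler equation `σ² x² w'' + b x w' - r w = 0`. -/
def m : ℝ :=
  (M.σ ^ 2 - M.b - Real.sqrt ((M.b - M.σ ^ 2) ^ 2 + 4 * M.σ ^ 2 * M.r)) / (2 * M.σ ^ 2)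

/-- The positive exponent `n` of the Euler equation `σ² x² w'' + b x w' - r w = 0`. -/
def n : ℝ :=
  (M.σ ^ 2 - M.b + Real.sqrt ((M.b - M.σ ^ 2) ^ 2 + 4 * M.σ ^ 2 * M.r)) / (2 * M.σ ^ 2)

/-- `h(0) = lim_{x ↓ 0} h(x)`, which may be `-∞`. -/
def hZero : EReal := limUnder (𝓝[>] (0 : ℝ)) (fun x => (M.h x : EReal))

theorem tendsto_hZero (hm : MonotoneOn M.h (Ioi 0)) :
    Tendsto (fun x => (M.h x : EReal)) (𝓝[>] (0 : ℝ)) (𝓝 M.hZero) := by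
  have hm' : MonotoneOn (fun x => (M.h x : EReal)) (Ioi 0) :=
    fun x hx y hy hxy => EReal.coe_le_coe_iff.2 (hm hx hy hxy)
  exact tendsto_nhds_limUnder ⟨_, hm'.tendsto_nhdsGT (OrderBot.bddBelow _)⟩

/-- The particular solution `R_h` of `σ² x² w'' + b x w' - r w + h = 0`. -/
def R (x : ℝ) : ℝ :=
  1 / (M.σ ^ 2 * (M.n - M.m)) *
    (x ^ M.m * (∫ s in (0 : ℝ)..x, s ^ (-M.m - 1) * M.h s) +
      x ^ M.n * (∫ s in Ioi x, s ^ (-M.n - 1) * M.h s))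

/-- `(w₁, w₀)` satisfies the HJB equation: both functions are `C¹` on `(0, ∞)` and, away from
finitely many points and from the jumps of `h`, they are twice differentiable and the two
variational inequalities hold.  At a jump of `h` the second derivative of a solution of
`σ² x² w'' + b x w' - r w + h = 0` does not exist. -/
structure SolvesHJB (K₁ K₀ : ℝ) (w₁ w₀ : ℝ → ℝ) : Prop where
  contDiff_one : ContDiffOn ℝ 1 w₁ (Ioi 0)
  contDiff_zero : ContDiffOn ℝ 1 w₀ (Ioi 0)
  eqn : ∃ F : Set ℝ, F.Finite ∧ ∀ x, 0 < x → x ∉ F → ContinuousAt M.h x →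
    DifferentiableAt ℝ (deriv w₁) x ∧ DifferentiableAt ℝ (deriv w₀) x ∧
    max (M.σ ^ 2 * x ^ 2 * deriv (deriv w₁) x + M.b * x * deriv w₁ x - M.r * w₁ x + M.h x)
      (max (w₀ x - w₁ x - K₀) (-w₁ x - M.K)) = 0 ∧
    max (M.σ ^ 2 * x ^ 2 * deriv (deriv w₀) x + M.b * x * deriv w₀ x - M.r * w₀ x)
      (max (w₁ x - w₀ x - K₁) (-w₀ x - M.K)) = 0

/-! ### The system of equations and the candidate solution -/

/-- `p` solves the five free boundary equations, with `ζ > 0` and `0 < δ < γ < β < α`. -/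
structure IsSolution (K₁ K₀ : ℝ) (p : FreeBoundary) : Prop where
  zeta_pos : 0 < p.ζ
  delta_pos : 0 < p.δ
  delta_lt_gamma : p.δ < p.γ
  gamma_lt_beta : p.γ < p.β
  beta_lt_alpha : p.β < p.α
  eq1 : M.m * (∫ s in p.β..p.α, s ^ (-M.m - 1) * M.h s)
    + M.r * K₀ * p.β ^ (-M.m) + M.r * K₁ * p.α ^ (-M.m) = 0
  eq2 : M.n * (∫ s in p.β..p.α, s ^ (-M.n - 1) * M.h s)
    + M.r * K₀ * p.β ^ (-M.n) + M.r * K₁ * p.α ^ (-M.n) = 0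
  eq3 : M.n * (∫ s in Ioi p.δ, s ^ (-M.n - 1) * (M.h s + M.r * M.K))
    - M.n * (∫ s in p.γ..p.β, s ^ (-M.n - 1) * (M.h s + M.r * K₀)) = 0
  eq4 : M.n * (∫ s in Ioi p.β, s ^ (-M.n - 1) * (M.h s + M.r * K₀))
    + M.r * M.K * p.ζ ^ (-M.n) = 0
  eq5 : M.m * (∫ s in (0 : ℝ)..p.γ, s ^ (-M.m - 1) * (M.h s + M.r * K₀))
    - M.m * (∫ s in (0 : ℝ)..p.δ, s ^ (-M.m - 1) * (M.h s + M.r * M.K))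
    - M.r * M.K * p.ζ ^ (-M.m) = 0

def Gamma₁ (p : FreeBoundary) : ℝ :=
  -(1 / (M.σ ^ 2 * (M.n - M.m))) *
    ∫ s in (0 : ℝ)..p.δ, s ^ (-M.m - 1) * (M.h s + M.r * M.K)

def Gamma₂ (p : FreeBoundary) : ℝ :=
  -(1 / (M.σ ^ 2 * (M.n - M.m))) * ∫ s in Ioi p.δ, s ^ (-M.n - 1) * (M.h s + M.r * M.K)

def Delta₁ (p : FreeBoundary) : ℝ :=
  M.r * M.K * p.ζ ^ (-M.m) / (M.σ ^ 2 * M.m * (M.n - M.m))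

def Delta₂ (p : FreeBoundary) : ℝ :=
  -(M.r * M.K * p.ζ ^ (-M.n) / (M.σ ^ 2 * M.n * (M.n - M.m)))

def A (K₁ : ℝ) (p : FreeBoundary) : ℝ :=
  M.Delta₁ p - 1 / (M.σ ^ 2 * (M.n - M.m)) *
    ∫ s in (0 : ℝ)..p.α, s ^ (-M.m - 1) * (M.h s - M.r * K₁)

/-- The candidate for the value function of the open mode. -/
def w₁ (K₁ K₀ : ℝ) (p : FreeBoundary) (x : ℝ) : ℝ :=
  if x ≤ p.δ then -M.K
  else if x < p.γ then M.Gamma₁ p * x ^ M.m + M.Gamma₂ p * x ^ M.n + M.R x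
  else if x ≤ p.β then M.Delta₁ p * x ^ M.m + M.Delta₂ p * x ^ M.n - K₀
  else M.A K₁ p * x ^ M.m + M.R x

/-- The candidate for the value function of the closed mode. -/
def w₀ (K₁ : ℝ) (p : FreeBoundary) (x : ℝ) : ℝ :=
  if x ≤ p.ζ then -M.K
  else if x < p.α then M.Delta₁ p * x ^ M.m + M.Delta₂ p * x ^ M.n
  else M.A K₁ p * x ^ M.m + M.R x - K₁

/-! ### The critical values -/

/-- `d = δ†`: a positive solution of `∫_d^∞ s^{-n-1} (h(s) + r K) ds = 0`. -/
def IsDeltaDagger (d : ℝ) : Prop :=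
  0 < d ∧ ∫ s in Ioi d, s ^ (-M.n - 1) * (M.h s + M.r * M.K) = 0

/-- The two equations for `(ζ, α)` of the simpler case without switch-out region, in which the open
project is abandoned at `d = δ†`, the closed one is abandoned at `ζ` and opened at `α`. -/
structure IsNoSwitchOutPair (d K₁ ζ α : ℝ) : Prop where
  zeta_pos : 0 < ζ
  zeta_lt : ζ < α
  d_lt : d < α
  eq1 : M.m * (∫ s in d..α, s ^ (-M.m - 1) * (M.h s - M.r * K₁))
    + M.r * (K₁ + M.K) * d ^ (-M.m) - M.r * M.K * ζ ^ (-M.m) = 0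
  eq2 : -M.n * (∫ s in d..α, s ^ (-M.n - 1) * (M.h s - M.r * K₁))
    - M.r * (K₁ + M.K) * d ^ (-M.n) + M.r * M.K * ζ ^ (-M.n) = 0

/-- `k = K₁†`: the positive number such that the point `ζ = ζ(K₁)` of the simpler case is below
`d = δ†` for positive `K₁ < k` and above it for `K₁ > k`. -/
def IsK₁Dagger (d k : ℝ) : Prop :=
  0 < k ∧ ∀ K₁, 0 < K₁ → ∀ ζ α, M.IsNoSwitchOutPair d K₁ ζ α →
    (K₁ < k → ζ < d) ∧ (k < K₁ → d < ζ)

/-- The derivative of `w₀ - w₁` to the left of `α` and to the right of `d` and `ζ`, for the functions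
`w₁`, `w₀` of the simpler case. -/
def gapDeriv (K₁ α x : ℝ) : ℝ :=
  M.m * x ^ (M.m - 1) / (M.σ ^ 2 * (M.n - M.m)) *
      (∫ s in x..α, s ^ (-M.m - 1) * (M.h s - M.r * K₁))
    - M.n * x ^ (M.n - 1) / (M.σ ^ 2 * (M.n - M.m)) *
      (∫ s in x..α, s ^ (-M.n - 1) * (M.h s - M.r * K₁))

/-- `y` is the point of `(d, α)` at which `gapDeriv` changes its sign from plus to minus. -/
def IsSignChange (d K₁ α y : ℝ) : Prop :=
  d < y ∧ y < α ∧ (∀ x, d ≤ x → x < y → 0 < M.gapDeriv K₁ α x) ∧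
    (∀ x, y < x → x < α → M.gapDeriv K₁ α x < 0)

/-- `k = K₀†`, a quantity that depends on `K₁` but not on `K₀`. -/
def IsK₀Dagger (d K₁ k : ℝ) : Prop :=
  ∃ ζ α y, M.IsNoSwitchOutPair d K₁ ζ α ∧ M.IsSignChange d K₁ α y ∧
    k = -K₁ - M.n * y ^ M.n / M.r * ∫ s in y..α, s ^ (-M.n - 1) * (M.h s - M.r * K₁)

end SwitchingModel

end

/-! Put μ = -m, E = -rK, k₀ = rK₀, k₁ = rK₁. The payoff enters only through the planar curves C_c(x)
= (p_c(x), q_c(x)), where p_c(x) = ∫_0^x (h+c) d(s^μ) and q_c(x) = ∫_x^∞ (h+c) d(-s^{-n}). Changing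
c moves C_c(x) along the direction (x^μ, x^{-n}), so every cost is such a shift. The system becomes
C_{k₀}(β) = C_{-k₁}(α), q_{k₀}(β) = E ζ^{-n} and C_{k₀}(γ) - C_{-E}(δ) = E (ζ^μ, ζ^{-n}). The point
d = δ† is the zero of q_{-E}, and the pair of (b) satisfies C_{-k₁}(α) - C_{-E}(d) = E (ζ^μ,
ζ^{-n}).

Along every C_c the ratio dp/(-dq) at parameter s is (μ/n) s^{n+μ}, whatever h and c are. The signs
of h + c on an arc therefore decide how its chord compares with the slope at a fixed parameter T
(`slope_pos` and its variants), and the convex curve ζ ↦ (ζ^μ, ζ^{-n}) lies above its tangents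
(`rpow_slope_le`). Most inequalities below are sums of two such comparisons with a common T.

For the pair, ζ is eliminated by the second equation. The first then becomes the vanishing of
`excess`, which changes sign once where ζ < x (`exists_zero_excess`). For the critical costs, the
function V = x^{n+μ} q - p is concave in x^{n+μ}, hence so is `gap`, which measures whether a fixed
point lies on the line through C_c(x) of direction (x^μ, x^{-n}). Its zeros yield the cost at which
ζ = d (`exists_isPair_self`) and the sign change x̂ together with K₀† (`IsPair.exists_signChange`).

The equivalence rests on a decoupling. The equations for (β, α) have at most one solution, and they
determine ζ. With ζ fixed and d < β, a pair (δ, γ) with γ < β exists iff p_{k₀}(β) - p_{-E}(d) < E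
ζ^μ, and it is then unique (`exists_isInner`, `IsInner.p_lt_and_unique`). Since C_{k₀}(β) =
C_{-k₁}(α), this inequality says that `excess` is negative at α, that is, that α lies below the
α(K₁) of the simpler case. Lowering K₀ from K₀† moves α down from α(K₁) (`exists_isSwitch`), which
gives solvability. Conversely, comparing chords for a given solution forces ζ(K₁) < d and K₀ < K₀†
(`IsSystem.lt_of_isPair`, `IsSystem.k₀_lt`).

For the verification, the five equations say exactly that the pieces of w₁ and w₀ fit together in
C¹; the sign of `gap` gives the monotonicity of w₀ - w₁ on either side of γ, hence the obstacle
inequalities. Probability enters only in `SwitchingModel.payoff`: a lower bound for the resolvent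
density of the logarithm of X turns the integrability assumption into finiteness of the moments of
h. -/

/-- A right-continuous increasing payoff `h` on `(0, ∞)` whose moments of order `μ` at `0` and of
order `-n` at `∞` exist. -/
structure Payoff (μ n : ℝ) (h : ℝ → ℝ) : Prop where
  mu_pos : 0 < μ
  n_pos : 0 < n
  right_cont : ∀ x, 0 < x → ContinuousWithinAt h (Ici x) x
  mono : MonotoneOn h (Ioi 0)
  tendsto_top : Tendsto h atTop atTop
  int_zero : ∀ x, 0 < x → IntegrableOn (fun s => s ^ (μ - 1) * h s) (Ioc 0 x)
  int_top : ∀ x, 0 < x → IntegrableOn (fun s => s ^ (-n - 1) * h s) (Ioi x)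

/-! ### The two moments of the payoff: increments, limits and continuity. -/

namespace Payoff

variable {μ n : ℝ} {h : ℝ → ℝ} (H : Payoff μ n h)

/-- The moment `∫_0^x (h(s) + c) d(s^μ)`. -/
noncomputable def p (_ : Payoff μ n h) (c x : ℝ) : ℝ :=
  μ * (∫ s in (0 : ℝ)..x, s ^ (μ - 1) * h s) + c * x ^ μ

/-- The moment `∫_x^∞ (h(s) + c) d(-s^{-n})`. -/
noncomputable def q (_ : Payoff μ n h) (c x : ℝ) : ℝ :=
  n * (∫ s in Ioi x, s ^ (-n - 1) * h s) + c * x ^ (-n)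

/-- With `q_eq`: a change of the constant translates (p, q) at x along (x^μ, x^{-n}). This is how
all costs are moved in and out of the moments. -/
lemma p_eq (c c' x : ℝ) : H.p c x = H.p c' x + (c - c') * x ^ μ := by unfold p; ring

lemma q_eq (c c' x : ℝ) : H.q c x = H.q c' x + (c - c') * x ^ (-n) := by unfold q; ring

include H

lemma intervalIntegrable_low {a b : ℝ} (ha : 0 ≤ a) (hb : 0 ≤ b) :
    IntervalIntegrable (fun s => s ^ (μ - 1) * h s) volume a b := by
  have key : ∀ x, 0 ≤ x → IntervalIntegrable (fun s => s ^ (μ - 1) * h s) volume 0 x := by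
    intro x hx
    rcases hx.eq_or_lt with rfl | hx
    · exact IntervalIntegrable.refl
    · exact (intervalIntegrable_iff_integrableOn_Ioc_of_le hx.le).2 (H.int_zero x hx)
  exact (key a ha).symm.trans (key b hb)

lemma intervalIntegrable_up {a b : ℝ} (ha : 0 < a) (hb : 0 < b) :
    IntervalIntegrable (fun s => s ^ (-n - 1) * h s) volume a b := by
  rw [intervalIntegrable_iff]
  exact (H.int_top (min a b) (lt_min ha hb)).mono_set fun x hx => hx.1

lemma p_integrand_integrable (c : ℝ) {a b : ℝ} (ha : 0 ≤ a) (hb : 0 ≤ b) :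
    IntervalIntegrable (fun s => μ * s ^ (μ - 1) * (h s + c)) volume a b := by
  have h1 := (H.intervalIntegrable_low ha hb).const_mul μ
  have h2 : IntervalIntegrable (fun s : ℝ => s ^ (μ - 1)) volume a b :=
    intervalIntegral.intervalIntegrable_rpow' (by linarith [H.mu_pos])
  refine (h1.add (h2.const_mul (μ * c))).congr ?_
  intro s _
  ring

lemma q_integrand_integrable (c : ℝ) {a b : ℝ} (ha : 0 < a) (hb : 0 < b) :
    IntervalIntegrable (fun s => n * s ^ (-n - 1) * (h s + c)) volume a b := by
  have h1 := (H.intervalIntegrable_up ha hb).const_mul n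
  have h2 : IntervalIntegrable (fun s : ℝ => s ^ (-n - 1)) volume a b :=
    intervalIntegral.intervalIntegrable_rpow (Or.inr (notMem_uIcc_of_lt ha hb))
  refine (h1.add (h2.const_mul (n * c))).congr ?_
  intro s _
  ring

lemma p_sub (c : ℝ) {a b : ℝ} (ha : 0 ≤ a) (hb : 0 ≤ b) :
    H.p c b - H.p c a = ∫ s in a..b, μ * s ^ (μ - 1) * (h s + c) := by
  have hμ := H.mu_pos
  have h1 := (H.intervalIntegrable_low ha hb).const_mul μ
  have h2 : IntervalIntegrable (fun s : ℝ => s ^ (μ - 1)) volume a b :=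
    intervalIntegral.intervalIntegrable_rpow' (by linarith [H.mu_pos])
  have e : (fun s => μ * s ^ (μ - 1) * (h s + c)) =
      fun s => μ * (s ^ (μ - 1) * h s) + μ * c * s ^ (μ - 1) := by
    funext s; ring
  rw [e, intervalIntegral.integral_add h1 (h2.const_mul _), intervalIntegral.integral_const_mul,
    intervalIntegral.integral_const_mul, integral_rpow (Or.inl (by linarith)),
    ← intervalIntegral.integral_interval_sub_left (H.intervalIntegrable_low le_rfl hb)
      (H.intervalIntegrable_low le_rfl ha)]
  unfold p
  rw [sub_add_cancel]
  field_simp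
  ring

lemma q_sub (c : ℝ) {a b : ℝ} (ha : 0 < a) (hb : 0 < b) :
    H.q c a - H.q c b = ∫ s in a..b, n * s ^ (-n - 1) * (h s + c) := by
  have hn := H.n_pos
  have h1 := (H.intervalIntegrable_up ha hb).const_mul n
  have h2 : IntervalIntegrable (fun s : ℝ => s ^ (-n - 1)) volume a b :=
    intervalIntegral.intervalIntegrable_rpow (Or.inr (notMem_uIcc_of_lt ha hb))
  have e : (fun s => n * s ^ (-n - 1) * (h s + c)) =
      fun s => n * (s ^ (-n - 1) * h s) + n * c * s ^ (-n - 1) := by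
    funext s; ring
  rw [e, intervalIntegral.integral_add h1 (h2.const_mul _), intervalIntegral.integral_const_mul,
    intervalIntegral.integral_const_mul,
    integral_rpow (Or.inr ⟨by linarith, notMem_uIcc_of_lt ha hb⟩),
    ← intervalIntegral.integral_Ioi_sub_Ioi' (H.int_top a ha) (H.int_top b hb)]
  unfold q
  rw [sub_add_cancel]
  field_simp
  ring

/-- The combination of the increments of both moments that has the sign of
`(s^{n+μ} - T^{n+μ}) (h(s) + c)`. -/
lemma slope_integral (c T : ℝ) {a b : ℝ} (ha : 0 < a) (hb : 0 < b) :
    H.p c b - H.p c a - μ / n * T ^ (n + μ) * (H.q c a - H.q c b) =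
      ∫ s in a..b, μ * s ^ (μ - 1) * (h s + c)
        - μ / n * T ^ (n + μ) * (n * s ^ (-n - 1) * (h s + c)) := by
  rw [intervalIntegral.integral_sub (H.p_integrand_integrable c ha.le hb.le)
    ((H.q_integrand_integrable c ha hb).const_mul _), intervalIntegral.integral_const_mul,
    H.p_sub c ha.le hb.le, H.q_sub c ha hb]

lemma slope_integrand (c T : ℝ) {s : ℝ} (hs : 0 < s) :
    μ * s ^ (μ - 1) * (h s + c) - μ / n * T ^ (n + μ) * (n * s ^ (-n - 1) * (h s + c)) =
      μ * s ^ (-n - 1) * (s ^ (n + μ) - T ^ (n + μ)) * (h s + c) := by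
  have hn := H.n_pos
  have e : s ^ (μ - 1) = s ^ (-n - 1) * s ^ (n + μ) := by
    rw [← Real.rpow_add hs]; ring_nf
  rw [e]
  field_simp

lemma slope_integrable (c T : ℝ) {a b : ℝ} (ha : 0 < a) (hb : 0 < b) :
    IntervalIntegrable (fun s => μ * s ^ (μ - 1) * (h s + c)
        - μ / n * T ^ (n + μ) * (n * s ^ (-n - 1) * (h s + c))) volume a b :=
  (H.p_integrand_integrable c ha.le hb.le).sub ((H.q_integrand_integrable c ha hb).const_mul _)

omit H in
-- Open intervals suffice, which matters because the sign of h + c is often unknown at the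
-- endpoints, where h may jump across the level.
lemma integral_nonneg_of_Ioo {f : ℝ → ℝ} {a b : ℝ} (hab : a ≤ b) (hf : ∀ s ∈ Ioo a b, 0 ≤ f s) :
    0 ≤ ∫ s in a..b, f s := by
  rw [intervalIntegral.integral_of_le hab, integral_Ioc_eq_integral_Ioo]
  exact setIntegral_nonneg measurableSet_Ioo hf

section increments

variable {c a b : ℝ}

lemma N_pos : 0 < n + μ := add_pos H.n_pos H.mu_pos

lemma p_le_of_nonneg (ha : 0 ≤ a) (hab : a ≤ b) (hc : ∀ s ∈ Ioo a b, 0 ≤ h s + c) :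
    H.p c a ≤ H.p c b := by
  rw [← sub_nonneg, H.p_sub c ha (ha.trans hab)]
  refine integral_nonneg_of_Ioo hab fun s hs => ?_
  have := hc s hs
  have : 0 < s := ha.trans_lt hs.1
  have := H.mu_pos
  positivity

lemma p_lt_of_pos (ha : 0 ≤ a) (hab : a < b) (hc : ∀ s ∈ Ioo a b, 0 < h s + c) :
    H.p c a < H.p c b := by
  rw [← sub_pos, H.p_sub c ha (ha.trans hab.le)]
  refine intervalIntegral.intervalIntegral_pos_of_pos_on
    (H.p_integrand_integrable c ha (ha.trans hab.le)) (fun s hs => ?_) hab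
  have := hc s hs
  have : 0 < s := ha.trans_lt hs.1
  have := H.mu_pos
  positivity

lemma p_le_of_nonpos (ha : 0 ≤ a) (hab : a ≤ b) (hc : ∀ s ∈ Ioo a b, h s + c ≤ 0) :
    H.p c b ≤ H.p c a := by
  rw [← sub_nonneg, ← neg_sub, H.p_sub c ha (ha.trans hab), ← intervalIntegral.integral_neg]
  refine integral_nonneg_of_Ioo hab fun s hs => ?_
  have := hc s hs
  have : 0 < s := ha.trans_lt hs.1
  have := H.mu_pos
  have : 0 ≤ μ * s ^ (μ - 1) := by positivity
  nlinarith

lemma p_lt_of_neg (ha : 0 ≤ a) (hab : a < b) (hc : ∀ s ∈ Ioo a b, h s + c < 0) :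
    H.p c b < H.p c a := by
  rw [← sub_pos, ← neg_sub, H.p_sub c ha (ha.trans hab.le), ← intervalIntegral.integral_neg]
  refine intervalIntegral.intervalIntegral_pos_of_pos_on
    (H.p_integrand_integrable c ha (ha.trans hab.le)).neg (fun s hs => ?_) hab
  have := hc s hs
  have : 0 < s := ha.trans_lt hs.1
  have := H.mu_pos
  have : 0 < μ * s ^ (μ - 1) := by positivity
  nlinarith

lemma q_le_of_nonneg (ha : 0 < a) (hab : a ≤ b) (hc : ∀ s ∈ Ioo a b, 0 ≤ h s + c) :
    H.q c b ≤ H.q c a := by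
  rw [← sub_nonneg, H.q_sub c ha (ha.trans_le hab)]
  refine integral_nonneg_of_Ioo hab fun s hs => ?_
  have := hc s hs
  have : 0 < s := ha.trans hs.1
  have := H.n_pos
  positivity

lemma q_lt_of_pos (ha : 0 < a) (hab : a < b) (hc : ∀ s ∈ Ioo a b, 0 < h s + c) :
    H.q c b < H.q c a := by
  rw [← sub_pos, H.q_sub c ha (ha.trans hab)]
  refine intervalIntegral.intervalIntegral_pos_of_pos_on
    (H.q_integrand_integrable c ha (ha.trans hab)) (fun s hs => ?_) hab
  have := hc s hs
  have : 0 < s := ha.trans hs.1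
  have := H.n_pos
  positivity

lemma q_le_of_nonpos (ha : 0 < a) (hab : a ≤ b) (hc : ∀ s ∈ Ioo a b, h s + c ≤ 0) :
    H.q c a ≤ H.q c b := by
  rw [← sub_nonneg, ← neg_sub, H.q_sub c ha (ha.trans_le hab), ← intervalIntegral.integral_neg]
  refine integral_nonneg_of_Ioo hab fun s hs => ?_
  have := hc s hs
  have : 0 < s := ha.trans hs.1
  have := H.n_pos
  have : 0 ≤ n * s ^ (-n - 1) := by positivity
  nlinarith

lemma q_lt_of_neg (ha : 0 < a) (hab : a < b) (hc : ∀ s ∈ Ioo a b, h s + c < 0) :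
    H.q c a < H.q c b := by
  rw [← sub_pos, ← neg_sub, H.q_sub c ha (ha.trans hab), ← intervalIntegral.integral_neg]
  refine intervalIntegral.intervalIntegral_pos_of_pos_on
    (H.q_integrand_integrable c ha (ha.trans hab)).neg (fun s hs => ?_) hab
  have := hc s hs
  have : 0 < s := ha.trans hs.1
  have := H.n_pos
  have : 0 < n * s ^ (-n - 1) := by positivity
  nlinarith

/-- A chord of the curve (p, q) is compared with the slope (μ/n) T^{n+μ} that the curve has at
parameter T. Arcs with parameters beyond T and h + c > 0, or before T and h + c < 0, both have
excess increment in p, so contributions of arcs from different curves can be added. -/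
lemma slope_pos {T : ℝ} (ha : 0 < a) (hab : a < b)
    (hc : ∀ s ∈ Ioo a b, 0 < (s ^ (n + μ) - T ^ (n + μ)) * (h s + c)) :
    μ / n * T ^ (n + μ) * (H.q c a - H.q c b) < H.p c b - H.p c a := by
  rw [← sub_pos, H.slope_integral c T ha (ha.trans hab)]
  refine intervalIntegral.intervalIntegral_pos_of_pos_on
    (H.slope_integrable c T ha (ha.trans hab)) (fun s hs => ?_) hab
  have hs0 : 0 < s := ha.trans hs.1
  rw [H.slope_integrand c T hs0, mul_assoc]
  have := hc s hs
  have := H.mu_pos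
  positivity

lemma slope_nonneg {T : ℝ} (ha : 0 < a) (hab : a ≤ b)
    (hc : ∀ s ∈ Ioo a b, 0 ≤ (s ^ (n + μ) - T ^ (n + μ)) * (h s + c)) :
    μ / n * T ^ (n + μ) * (H.q c a - H.q c b) ≤ H.p c b - H.p c a := by
  rw [← sub_nonneg, H.slope_integral c T ha (ha.trans_le hab)]
  refine integral_nonneg_of_Ioo hab fun s hs => ?_
  have hs0 : 0 < s := ha.trans hs.1
  rw [H.slope_integrand c T hs0, mul_assoc]
  have := hc s hs
  have := H.mu_pos
  positivity

lemma slope_neg {T : ℝ} (ha : 0 < a) (hab : a < b)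
    (hc : ∀ s ∈ Ioo a b, (s ^ (n + μ) - T ^ (n + μ)) * (h s + c) < 0) :
    H.p c b - H.p c a < μ / n * T ^ (n + μ) * (H.q c a - H.q c b) := by
  rw [← sub_pos, ← neg_sub, H.slope_integral c T ha (ha.trans hab),
    ← intervalIntegral.integral_neg]
  refine intervalIntegral.intervalIntegral_pos_of_pos_on
    (H.slope_integrable c T ha (ha.trans hab)).neg (fun s hs => ?_) hab
  have hs0 : 0 < s := ha.trans hs.1
  rw [H.slope_integrand c T hs0, mul_assoc, ← mul_neg]
  have := neg_pos.2 (hc s hs)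
  have := H.mu_pos
  positivity

lemma slope_nonpos {T : ℝ} (ha : 0 < a) (hab : a ≤ b)
    (hc : ∀ s ∈ Ioo a b, (s ^ (n + μ) - T ^ (n + μ)) * (h s + c) ≤ 0) :
    H.p c b - H.p c a ≤ μ / n * T ^ (n + μ) * (H.q c a - H.q c b) := by
  rw [← sub_nonneg, ← neg_sub, H.slope_integral c T ha (ha.trans_le hab),
    ← intervalIntegral.integral_neg]
  refine integral_nonneg_of_Ioo hab fun s hs => ?_
  have hs0 : 0 < s := ha.trans hs.1
  rw [H.slope_integrand c T hs0, mul_assoc, ← mul_neg]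
  have := neg_nonneg.2 (hc s hs)
  have := H.mu_pos
  positivity

lemma rpow_N_lt {x y : ℝ} (hx : 0 ≤ x) (hxy : x < y) : x ^ (n + μ) < y ^ (n + μ) :=
  Real.rpow_lt_rpow hx hxy H.N_pos

lemma rpow_N_le {x y : ℝ} (hx : 0 ≤ x) (hxy : x ≤ y) : x ^ (n + μ) ≤ y ^ (n + μ) :=
  Real.rpow_le_rpow hx hxy H.N_pos.le

end increments

lemma q_eq_integral (c : ℝ) {x : ℝ} (hx : 0 < x) :
    H.q c x = ∫ s in Ioi x, n * s ^ (-n - 1) * (h s + c) := by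
  have hn := H.n_pos
  have h2 : IntegrableOn (fun s : ℝ => s ^ (-n - 1)) (Ioi x) :=
    integrableOn_Ioi_rpow_of_lt (by linarith) hx
  have e : (fun s => n * s ^ (-n - 1) * (h s + c)) =
      fun s => n * (s ^ (-n - 1) * h s) + n * c * s ^ (-n - 1) := by
    funext s; ring
  rw [e, integral_add ((H.int_top x hx).const_mul n) (h2.const_mul _), integral_const_mul,
    integral_const_mul, integral_Ioi_rpow_of_lt (by linarith) hx]
  unfold q
  rw [sub_add_cancel]
  field_simp

lemma q_nonneg {c x : ℝ} (hx : 0 < x) (hc : ∀ s, x < s → 0 ≤ h s + c) : 0 ≤ H.q c x := by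
  have hn := H.n_pos
  rw [H.q_eq_integral c hx]
  refine setIntegral_nonneg measurableSet_Ioi fun s hs => ?_
  have := hc s hs
  have : 0 < s := hx.trans hs
  positivity

lemma tendsto_rpow_neg_n : Tendsto (fun x : ℝ => x ^ (-n)) atTop (𝓝 0) :=
  tendsto_rpow_neg_atTop H.n_pos

lemma tendsto_q (c : ℝ) : Tendsto (H.q c) atTop (𝓝 0) := by
  have h1 : Tendsto (fun x => ∫ s in (1 : ℝ)..x, s ^ (-n - 1) * h s) atTop
      (𝓝 (∫ s in Ioi 1, s ^ (-n - 1) * h s)) :=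
    intervalIntegral_tendsto_integral_Ioi 1 (H.int_top 1 one_pos) tendsto_id
  have h2 := ((h1.const_sub (∫ s in Ioi 1, s ^ (-n - 1) * h s)).const_mul n).add
    (H.tendsto_rpow_neg_n.const_mul c)
  rw [sub_self, mul_zero, mul_zero, add_zero] at h2
  refine h2.congr' ?_
  filter_upwards [eventually_gt_atTop 0] with x hx
  rw [← intervalIntegral.integral_Ioi_sub_Ioi' (H.int_top 1 one_pos) (H.int_top x hx)]
  unfold q
  ring

lemma continuousAt_p (c : ℝ) {x : ℝ} (hx : 0 < x) : ContinuousAt (H.p c) x := by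
  have h1 : ContinuousOn (fun y => ∫ s in (0 : ℝ)..y, s ^ (μ - 1) * h s) (uIcc 0 (x + 1)) :=
    intervalIntegral.continuousOn_primitive_interval'
      (H.intervalIntegrable_low le_rfl (by linarith)) left_mem_uIcc
  have h2 : ContinuousAt (fun y => ∫ s in (0 : ℝ)..y, s ^ (μ - 1) * h s) x := by
    refine h1.continuousAt ?_
    rw [uIcc_of_le (by linarith)]
    exact Icc_mem_nhds hx (by linarith)
  exact (h2.const_mul μ).add ((Real.continuousAt_rpow_const x μ (Or.inl hx.ne')).const_mul c)

lemma continuousAt_q (c : ℝ) {x : ℝ} (hx : 0 < x) : ContinuousAt (H.q c) x := by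
  have h1 : ContinuousOn (fun y => ∫ s in (x / 2)..y, s ^ (-n - 1) * h s) (uIcc (x / 2) (x + 1)) :=
    intervalIntegral.continuousOn_primitive_interval'
      (H.intervalIntegrable_up (by linarith) (by linarith)) left_mem_uIcc
  have h2 : ContinuousAt (fun y => ∫ s in (x / 2)..y, s ^ (-n - 1) * h s) x := by
    refine h1.continuousAt ?_
    rw [uIcc_of_le (by linarith)]
    exact Icc_mem_nhds (by linarith) (by linarith)
  have h3 : ContinuousAt (fun y => ∫ s in Ioi y, s ^ (-n - 1) * h s) x := by
    refine ((continuousAt_const (y := ∫ s in Ioi (x / 2), s ^ (-n - 1) * h s)).sub h2).congr ?_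
    filter_upwards [eventually_gt_nhds hx] with y hy
    simp only [Pi.sub_apply]
    rw [← intervalIntegral.integral_Ioi_sub_Ioi' (H.int_top _ (half_pos hx)) (H.int_top y hy)]
    ring
  exact (h3.const_mul n).add ((Real.continuousAt_rpow_const x (-n) (Or.inl hx.ne')).const_mul c)

lemma continuousOn_p (c : ℝ) {s : Set ℝ} (hs : ∀ x ∈ s, 0 < x) : ContinuousOn (H.p c) s :=
  fun x hx => (H.continuousAt_p c (hs x hx)).continuousWithinAt

lemma continuousOn_q (c : ℝ) {s : Set ℝ} (hs : ∀ x ∈ s, 0 < x) : ContinuousOn (H.q c) s :=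
  fun x hx => (H.continuousAt_q c (hs x hx)).continuousWithinAt

lemma p_zero (c : ℝ) : H.p c 0 = 0 := by
  simp [p, Real.zero_rpow H.mu_pos.ne']

end Payoff

/-! ### Real-variable tools: local monotonicity, inverses, and convexity of ζ ↦ (ζ^μ, ζ^{-n}). -/

/-- A continuous function each of whose points has larger values immediately to its right is
strictly increasing. -/
lemma lt_of_eventually_lt_right {f : ℝ → ℝ} {a b : ℝ} (hab : a < b)
    (hf : ContinuousOn f (Icc a b)) (hloc : ∀ x ∈ Ico a b, ∀ᶠ y in 𝓝[>] x, f x < f y) :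
    f a < f b := by
  have weak : ∀ a', a ≤ a' → a' < b → f a' ≤ f b := by
    intro a' ha' hb'
    have hf' : ContinuousOn f (Icc a' b) := hf.mono (Icc_subset_Icc_left ha')
    have hcl : IsClosed ({x | f a' ≤ f x} ∩ Icc a' b) := by
      rw [inter_comm]
      exact hf'.preimage_isClosed_of_isClosed isClosed_Icc isClosed_Ici
    have := IsClosed.Icc_subset_of_forall_exists_gt hcl (le_refl (f a')) ?_
    · exact this (right_mem_Icc.2 hb'.le)
    · rintro x ⟨hx, hx'⟩ y hy
      have h1 := hloc x ⟨ha'.trans hx'.1, hx'.2⟩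
      have h2 : Ioc x y ∈ 𝓝[>] x := Ioc_mem_nhdsGT hy
      obtain ⟨z, hz, hz'⟩ := (h1.and h2).exists
      exact ⟨z, (show f a' ≤ f x from hx).trans hz.le, hz'⟩
  obtain ⟨z, hz, hz'⟩ := ((hloc a ⟨le_rfl, hab⟩).and (Ioo_mem_nhdsGT hab)).exists
  exact hz.trans_le (weak z hz'.1.le hz'.2)

/-- A continuous strictly increasing function on a compact interval has a continuous inverse. -/
lemma exists_continuousOn_inverse {f : ℝ → ℝ} {a b : ℝ} (hab : a ≤ b)
    (hf : ContinuousOn f (Icc a b)) (hm : StrictMonoOn f (Icc a b)) :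
    ∃ g : ℝ → ℝ, ContinuousOn g (Icc (f a) (f b)) ∧ MapsTo g (Icc (f a) (f b)) (Icc a b) ∧
      ∀ y ∈ Icc (f a) (f b), f (g y) = y := by
  have hs : ∀ y ∈ Icc (f a) (f b), ∃ x ∈ Icc a b, f x = y := intermediate_value_Icc hab hf
  choose! g hg hfg using hs
  refine ⟨g, ?_, hg, hfg⟩
  rw [continuousOn_iff_isClosed]
  intro t ht
  refine ⟨f '' (Icc a b ∩ t), ?_, ?_⟩
  · exact ((isCompact_Icc.inter_right ht).image_of_continuousOn
      (hf.mono inter_subset_left)).isClosed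
  · ext y
    constructor
    · rintro ⟨h1, h2⟩
      exact ⟨⟨g y, ⟨hg y h2, h1⟩, hfg y h2⟩, h2⟩
    · rintro ⟨⟨x, hx, rfl⟩, h2⟩
      have := hm.injOn (hg _ h2) hx.1 (hfg _ h2)
      exact ⟨show g (f x) ∈ t by rw [this]; exact hx.2, h2⟩

/-- The curve z ↦ (z^μ, z^{-n}) lies strictly above its tangent at d. In the variable u = log z -
log d this is the sum of two instances of 1 + t < e^t, at t = μu and t = -nu, whose linear terms
cancel. -/
lemma rpow_slope_lt {μ n z d : ℝ} (hμ : 0 < μ) (hn : 0 < n) (hz : 0 < z) (hd : 0 < d)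
    (hzd : z ≠ d) :
    μ / n * d ^ (n + μ) * (d ^ (-n) - z ^ (-n)) < z ^ μ - d ^ μ := by
  set u := Real.log z - Real.log d with hu
  have hu0 : u ≠ 0 := fun h0 => hzd (Real.log_injOn_pos hz hd (by linarith))
  have e1 : z ^ μ = d ^ μ * Real.exp (μ * u) := by
    rw [Real.rpow_def_of_pos hz, Real.rpow_def_of_pos hd, ← Real.exp_add, hu]; ring_nf
  have e2 : z ^ (-n) = d ^ (-n) * Real.exp (-n * u) := by
    rw [Real.rpow_def_of_pos hz, Real.rpow_def_of_pos hd, ← Real.exp_add, hu]; ring_nf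
  have e3 : d ^ (n + μ) * d ^ (-n) = d ^ μ := by
    rw [← Real.rpow_add hd]; ring_nf
  have h1 := Real.add_one_lt_exp (mul_ne_zero hμ.ne' hu0)
  have h2 := Real.add_one_lt_exp (mul_ne_zero (neg_ne_zero.2 hn.ne') hu0)
  have hdμ : 0 < d ^ μ := Real.rpow_pos_of_pos hd _
  have e4 : μ / n * d ^ (n + μ) * (d ^ (-n) - z ^ (-n)) =
      d ^ μ * (μ / n * (1 - Real.exp (-n * u))) := by
    rw [e2, ← e3]; ring
  rw [e4, e1, ← mul_sub_one]
  refine mul_lt_mul_of_pos_left ?_ hdμ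
  have h3 : μ / n * (1 - Real.exp (-n * u)) < μ / n * (n * u) :=
    mul_lt_mul_of_pos_left (by linarith) (by positivity)
  have h4 : μ / n * (n * u) = μ * u := by field_simp
  linarith

lemma rpow_slope_le {μ n z d : ℝ} (hμ : 0 < μ) (hn : 0 < n) (hz : 0 < z) (hd : 0 < d) :
    μ / n * d ^ (n + μ) * (d ^ (-n) - z ^ (-n)) ≤ z ^ μ - d ^ μ := by
  rcases eq_or_ne z d with rfl | hzd
  · simp
  · exact (rpow_slope_lt hμ hn hz hd hzd).le

/-! ### The single sign change of q, and the concave function V. -/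

namespace Payoff

variable {μ n : ℝ} {h : ℝ → ℝ}

lemma rpow_N_mul {x : ℝ} (hx : 0 < x) : x ^ (n + μ) * x ^ (-n) = x ^ μ := by
  rw [← Real.rpow_add hx]; ring_nf

variable (H : Payoff μ n h)
include H

lemma mono' {x y : ℝ} (hx : 0 < x) (hxy : x ≤ y) : h x ≤ h y := H.mono hx (hx.trans_le hxy) hxy

lemma rpow_neg_lt {x y : ℝ} (hx : 0 < x) (hxy : x < y) : y ^ (-n) < x ^ (-n) :=
  Real.rpow_lt_rpow_of_neg hx hxy (neg_lt_zero.2 H.n_pos)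

lemma rpow_neg_le {x y : ℝ} (hx : 0 < x) (hxy : x ≤ y) : y ^ (-n) ≤ x ^ (-n) :=
  Real.rpow_le_rpow_of_nonpos hx hxy (neg_nonpos.2 H.n_pos.le)

lemma rpow_mu_lt {x y : ℝ} (hx : 0 ≤ x) (hxy : x < y) : x ^ μ < y ^ μ :=
  Real.rpow_lt_rpow hx hxy H.mu_pos

lemma rpow_mu_le {x y : ℝ} (hx : 0 ≤ x) (hxy : x ≤ y) : x ^ μ ≤ y ^ μ :=
  Real.rpow_le_rpow hx hxy H.mu_pos.le

lemma lt_of_rpow_neg_lt {x y : ℝ} (hy : 0 < y) (hxy : y ^ (-n) < x ^ (-n)) : x < y := by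
  by_contra hc
  exact absurd (H.rpow_neg_le hy (not_lt.1 hc)) (not_le.2 hxy)

/-- The point at which `h` crosses the level `c`. -/
lemma exists_turning (c : ℝ) :
    ∃ t, 0 ≤ t ∧ (∀ s, 0 < s → s < t → h s ≤ c) ∧ ∀ s, t < s → c < h s := by
  set S := {s : ℝ | 0 < s ∧ c < h s} with hS
  have hne : S.Nonempty := by
    obtain ⟨x, h1, h2⟩ :=
      ((H.tendsto_top.eventually_gt_atTop c).and (eventually_gt_atTop (0 : ℝ))).exists
    exact ⟨x, h2, h1⟩
  have hbd : BddBelow S := ⟨0, fun x hx => hx.1.le⟩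
  refine ⟨sInf S, le_csInf hne fun x hx => hx.1.le, fun s hs hst => ?_, fun s hs => ?_⟩
  · by_contra hc
    exact absurd (csInf_le hbd (show s ∈ S from ⟨hs, not_le.1 hc⟩)) (not_le.2 hst)
  · obtain ⟨x, hx, hxs⟩ := exists_lt_of_csInf_lt hne hs
    exact hx.2.trans_le (H.mono' hx.1 hxs.le)

/-- Strictness comes from h → ∞: beyond some y the integrand is strictly positive. -/
lemma q_pos_of_le {e x : ℝ} (hx : 0 < x) (he : e ≤ h x) : 0 < H.q (-e) x := by
  obtain ⟨y, h1, h2⟩ :=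
    ((H.tendsto_top.eventually_gt_atTop e).and (eventually_gt_atTop x)).exists
  have hy : 0 < y := hx.trans h2
  have a1 : H.q (-e) y ≤ H.q (-e) x := H.q_le_of_nonneg hx h2.le fun s hs => by
    linarith [H.mono' hx hs.1.le]
  have a2 : H.q (-e) (y + 1) < H.q (-e) y := H.q_lt_of_pos hy (by linarith) fun s hs => by
    linarith [H.mono' hy hs.1.le]
  have a3 : 0 ≤ H.q (-e) (y + 1) := H.q_nonneg (by linarith) fun s hs => by
    linarith [H.mono' hy (show y ≤ s by linarith)]
  linarith

lemma q_lt_of_lt {e x y : ℝ} (hx : 0 < x) (hxy : x < y) (he : h y < e) :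
    H.q (-e) x < H.q (-e) y :=
  H.q_lt_of_neg hx hxy fun s hs => by linarith [H.mono' (hx.trans hs.1) hs.2.le]

/-- Below x₁ the integrand is at most -(e - h(x₁)) times the density of -s^{-n}, whose mass near 0
is infinite. -/
lemma exists_q_neg {e x₁ : ℝ} (hx₁ : 0 < x₁) (he : h x₁ < e) :
    ∃ x, 0 < x ∧ x < x₁ ∧ H.q (-e) x < 0 := by
  set ε := e - h x₁ with hε
  have hε0 : 0 < ε := sub_pos.2 he
  have h1 : Tendsto (fun x : ℝ => x ^ (-n)) (𝓝[>] 0) atTop :=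
    tendsto_rpow_neg_nhdsGT_zero (neg_lt_zero.2 H.n_pos)
  obtain ⟨x, ⟨h2, h3⟩⟩ := ((h1.eventually_gt_atTop (H.q (-h x₁) x₁ / ε)).and
    (Ioo_mem_nhdsGT hx₁)).exists
  refine ⟨x, h3.1, h3.2, ?_⟩
  have h4 : H.q (-h x₁) x ≤ H.q (-h x₁) x₁ := H.q_le_of_nonpos h3.1 h3.2.le fun s hs => by
    linarith [H.mono' (h3.1.trans hs.1) hs.2.le]
  rw [div_lt_iff₀ hε0] at h2
  have h5 := H.q_eq (-e) (-h x₁) x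
  have h6 : (-e - -h x₁) * x ^ (-n) = - (x ^ (-n) * ε) := by rw [hε]; ring
  linarith

/-- The function `x ↦ ∫_x^∞ (h(s) - e) d(-s^{-n})` changes its sign exactly once. -/
lemma exists_zero_q {e x₁ : ℝ} (hx₁ : 0 < x₁) (he : h x₁ < e) :
    ∃ a, 0 < a ∧ H.q (-e) a = 0 ∧ h a < e ∧ (∀ x, 0 < x → x < a → H.q (-e) x < 0) ∧
      ∀ x, a < x → 0 < H.q (-e) x := by
  obtain ⟨x, hx, -, hqx⟩ := H.exists_q_neg hx₁ he
  -- While h < e the function q_{-e} increases strictly, and as soon as h ≥ e it is positive; hence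
  -- a zero exists and is unique.
  obtain ⟨y, h1, h2⟩ :=
    ((H.tendsto_top.eventually_gt_atTop e).and (eventually_gt_atTop x)).exists
  have hqy := H.q_pos_of_le (hx.trans h2) h1.le
  obtain ⟨a, ha, ha0⟩ := intermediate_value_Ioo h2.le
    (H.continuousOn_q (-e) fun s (hs : s ∈ Icc x y) => hx.trans_le hs.1) ⟨hqx, hqy⟩
  have hapos : 0 < a := hx.trans ha.1
  have hha : h a < e := by
    by_contra hc
    exact absurd ha0 (H.q_pos_of_le hapos (not_lt.1 hc)).ne'
  refine ⟨a, hapos, ha0, hha, fun z hz hza => ?_, fun z hza => ?_⟩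
  · rw [← ha0]; exact H.q_lt_of_lt hz hza hha
  · rcases lt_or_ge (h z) e with h3 | h3
    · rw [← ha0]; exact H.q_lt_of_lt hapos hza h3
    · exact H.q_pos_of_le (hapos.trans hza) h3

lemma h_lt_of_q_eq_zero {e d : ℝ} (hd : 0 < d) (hq : H.q (-e) d = 0) : h d < e := by
  by_contra hc
  exact absurd hq (H.q_pos_of_le hd (not_lt.1 hc)).ne'

lemma q_neg_iff {e d x : ℝ} (hd : 0 < d) (hq : H.q (-e) d = 0) (hx : 0 < x) :
    H.q (-e) x < 0 ↔ x < d := by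
  obtain ⟨a, ha, ha0, -, h1, h2⟩ := H.exists_zero_q hd (H.h_lt_of_q_eq_zero hd hq)
  have hda : d = a := by
    rcases lt_trichotomy d a with h3 | h3 | h3
    · exact absurd hq (h1 d hd h3).ne
    · exact h3
    · exact absurd hq (h2 d h3).ne'
  subst hda
  refine ⟨fun h3 => ?_, h1 x hx⟩
  by_contra hc
  rcases (not_lt.1 hc).eq_or_lt with h4 | h4
  · rw [← h4, ha0] at h3; exact lt_irrefl _ h3
  · linarith [h2 x h4]

lemma q_pos_iff {e d x : ℝ} (hd : 0 < d) (hq : H.q (-e) d = 0) (hx : 0 < x) :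
    0 < H.q (-e) x ↔ d < x := by
  obtain ⟨a, ha, ha0, -, h1, h2⟩ := H.exists_zero_q hd (H.h_lt_of_q_eq_zero hd hq)
  have hda : d = a := by
    rcases lt_trichotomy d a with h3 | h3 | h3
    · exact absurd hq (h1 d hd h3).ne
    · exact h3
    · exact absurd hq (h2 d h3).ne'
  subst hda
  refine ⟨fun h3 => ?_, h2 x⟩
  by_contra hc
  rcases (not_lt.1 hc).eq_or_lt with h4 | h4
  · rw [h4, ha0] at h3; exact lt_irrefl _ h3
  · linarith [h1 x hx h4]

omit H in
/-- `x^{n+μ} q - p`, a concave function of `x^{n+μ}`; up to a positive factor `x^{-μ-1}` it is the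
derivative of the resolvent of `h`. -/
noncomputable def V (H : Payoff μ n h) (x : ℝ) : ℝ := x ^ (n + μ) * H.q 0 x - H.p 0 x

lemma V_eq (c : ℝ) {x : ℝ} (hx : 0 < x) : H.V x = x ^ (n + μ) * H.q c x - H.p c x := by
  rw [V, H.q_eq c 0, H.p_eq c 0]
  linear_combination (-c) * rpow_N_mul (n := n) (μ := μ) hx

/-- Concavity of V in the variable x^{n+μ}. Computing V with the constant c = -h(x), the supporting
slope at x is q_{-h(x)}(x), because h - h(x) changes sign at x. -/
lemma V_le_tangent {x z : ℝ} (hx : 0 < x) (hz : 0 < z) :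
    H.V z ≤ H.V x + (z ^ (n + μ) - x ^ (n + μ)) * H.q (-h x) x := by
  rw [H.V_eq (-h x) hx, H.V_eq (-h x) hz]
  have hzN : 0 ≤ z ^ (n + μ) := Real.rpow_nonneg hz.le _
  rcases le_total x z with hxz | hxz
  · have hs : ∀ s ∈ Ioo x z, 0 ≤ h s + -h x := fun s hs => by
      linarith [H.mono' hx hs.1.le]
    nlinarith [H.p_le_of_nonneg hx.le hxz hs, H.q_le_of_nonneg hx hxz hs]
  · have hs : ∀ s ∈ Ioo z x, h s + -h x ≤ 0 := fun s hs => by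
      linarith [H.mono' (hz.trans hs.1) hs.2.le]
    nlinarith [H.p_le_of_nonpos hz.le hxz hs, H.q_le_of_nonpos hz hxz hs]

lemma q_self_nonneg {x : ℝ} (hx : 0 < x) : 0 ≤ H.q (-h x) x :=
  H.q_nonneg hx fun s hs => by linarith [H.mono' hx hs.le]

/-- The supporting slopes q_{-h(z)}(z) are nonnegative. -/
lemma V_mono {x z : ℝ} (hx : 0 < x) (hxz : x ≤ z) : H.V x ≤ H.V z := by
  have hz : 0 < z := hx.trans_le hxz
  have h1 := H.V_le_tangent hz hx
  have h2 := H.rpow_N_le hx.le hxz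
  nlinarith [H.q_self_nonneg hz]

/-- For the point `(a, b)` of the plane, `H.gap a b` vanishes at `x` iff `(a, b)` lies on the line
through `(p(x), q(x))` of direction `(x^μ, x^{-n})`. -/
noncomputable def gap (H : Payoff μ n h) (a b x : ℝ) : ℝ := H.V x + a - b * x ^ (n + μ)

lemma gap_eq (c a b : ℝ) {x : ℝ} (hx : 0 < x) :
    H.gap a b x = (a - H.p c x) + x ^ (n + μ) * (H.q c x - b) := by
  rw [gap, H.V_eq c hx]; ring

lemma gap_eq_zero {c a b x : ℝ} (hx : 0 < x) (ha : H.p c x = a) (hb : H.q c x = b) :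
    H.gap a b x = 0 := by
  rw [H.gap_eq c a b hx, ha, hb]; ring

/-- As a function of x^{n+μ} the gap is V plus an affine function, hence concave: between two points
where it is nonnegative, and positive at one of them, it is positive. -/
lemma gap_pos_of_ne {a b x y z : ℝ} (hx : 0 < x) (hxy : x < y) (hyz : y < z)
    (h1 : 0 ≤ H.gap a b x) (h2 : 0 ≤ H.gap a b z) (h3 : 0 < H.gap a b x ∨ 0 < H.gap a b z) :
    0 < H.gap a b y := by
  have hy := hx.trans hxy
  have t1 := H.V_le_tangent hy hx
  have t2 := H.V_le_tangent hy (hy.trans hyz)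
  have e1 := H.rpow_N_lt hx.le hxy
  have e2 := H.rpow_N_lt hy.le hyz
  unfold gap at *
  set ψ := H.q (-h y) y - b with hψ
  have t1' : H.V x + a - b * x ^ (n + μ) ≤
      H.V y + a - b * y ^ (n + μ) + (x ^ (n + μ) - y ^ (n + μ)) * ψ := by rw [hψ]; linarith
  have t2' : H.V z + a - b * z ^ (n + μ) ≤
      H.V y + a - b * y ^ (n + μ) + (z ^ (n + μ) - y ^ (n + μ)) * ψ := by rw [hψ]; linarith
  by_contra hc
  rcases lt_trichotomy ψ 0 with h4 | h4 | h4
  · nlinarith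
  · rw [h4] at t1' t2'
    rcases h3 with h3 | h3 <;> linarith
  · nlinarith

lemma gap_nonneg {a b x y z : ℝ} (hx : 0 < x) (hxy : x ≤ y) (hyz : y ≤ z)
    (h1 : 0 ≤ H.gap a b x) (h2 : 0 ≤ H.gap a b z) : 0 ≤ H.gap a b y := by
  have hy := hx.trans_le hxy
  have t1 := H.V_le_tangent hy hx
  have t2 := H.V_le_tangent hy (hy.trans_le hyz)
  have e1 := H.rpow_N_le hx.le hxy
  have e2 := H.rpow_N_le hy.le hyz
  unfold gap at *
  rcases le_total (H.q (-h y) y - b) 0 with h4 | h4 <;> nlinarith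

lemma continuousOn_gap (a b : ℝ) {s : Set ℝ} (hs : ∀ x ∈ s, 0 < x) :
    ContinuousOn (H.gap a b) s := by
  have h1 : ContinuousOn (fun x : ℝ => x ^ (n + μ)) s := fun x hx =>
    (Real.continuousAt_rpow_const x _ (Or.inl (hs x hx).ne')).continuousWithinAt
  exact (((h1.mul (H.continuousOn_q 0 hs)).sub (H.continuousOn_p 0 hs)).add
    continuousOn_const).sub (continuousOn_const.mul h1)

/-- To the left of a point of the curve `(p_c, q_c)` where `h + c < 0`, the gap is negative. -/
lemma gap_neg_left {c x y : ℝ} (hx : 0 < x) (hxy : x < y) (hc : ∀ s ∈ Ioo x y, h s + c < 0) :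
    H.gap (H.p c y) (H.q c y) x < 0 := by
  rw [H.gap_eq c _ _ hx]
  have := Real.rpow_pos_of_pos hx (n + μ)
  nlinarith [H.p_lt_of_neg hx.le hxy hc, H.q_lt_of_neg hx hxy hc]

lemma gap_pos_left {c x y : ℝ} (hx : 0 < x) (hxy : x < y) (hc : ∀ s ∈ Ioo x y, 0 < h s + c) :
    0 < H.gap (H.p c y) (H.q c y) x := by
  rw [H.gap_eq c _ _ hx]
  have := Real.rpow_pos_of_pos hx (n + μ)
  nlinarith [H.p_lt_of_pos hx.le hxy hc, H.q_lt_of_pos hx hxy hc]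

end Payoff

/-! ### The case without switch-out region: existence, uniqueness and monotonicity of (ζ, α). -/

/-- The solution `ζ > 0` of `E ζ^{-n} = y`. -/
noncomputable def negPowRoot (n E y : ℝ) : ℝ := (y / E) ^ (-(1 / n))

lemma negPowRoot_pos {n E y : ℝ} (hE : 0 < E) (hy : 0 < y) : 0 < negPowRoot n E y :=
  Real.rpow_pos_of_pos (div_pos hy hE) _

lemma mul_negPowRoot {n E y : ℝ} (hn : 0 < n) (hE : 0 < E) (hy : 0 < y) :
    E * negPowRoot n E y ^ (-n) = y := by
  rw [negPowRoot, ← Real.rpow_mul (div_pos hy hE).le]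
  have : -(1 / n) * -n = 1 := by field_simp
  rw [this, Real.rpow_one]
  field_simp

lemma negPowRoot_eq {n E y z : ℝ} (hn : 0 < n) (hE : 0 < E) (hz : 0 < z) (h : E * z ^ (-n) = y) :
    negPowRoot n E y = z := by
  have hy : y / E = z ^ (-n) := by rw [← h]; field_simp
  rw [negPowRoot, hy, ← Real.rpow_mul hz.le]
  have : -n * -(1 / n) = 1 := by field_simp
  rw [this, Real.rpow_one]

lemma continuousAt_negPowRoot {n E y : ℝ} (hE : 0 < E) (hy : 0 < y) :
    ContinuousAt (negPowRoot n E) y :=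
  (continuousAt_id.div_const E).rpow_const (Or.inl (div_pos hy hE).ne')

namespace Payoff

variable {μ n : ℝ} {h : ℝ → ℝ} (H : Payoff μ n h)

/-- The first coordinate of `C_{-k}(x) - C_{-E}(d) - E (ζ^μ, ζ^{-n})`, where `C_c = (p_c, q_c)` and `ζ`
is chosen such that `q_{-k}(x) = E ζ^{-n}`. -/
noncomputable def excess (E k d x : ℝ) : ℝ :=
  H.p (-k) x - H.p (-E) d - E * negPowRoot n E (H.q (-k) x) ^ μ

include H

lemma tendsto_p (c : ℝ) : Tendsto (H.p c) atTop atTop := by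
  obtain ⟨x₀, h1, h2⟩ :=
    ((H.tendsto_top.eventually_ge_atTop (1 - c)).and (eventually_gt_atTop (0 : ℝ))).exists
  have h3 : Tendsto (fun x : ℝ => H.p (c - 1) x₀ + x ^ μ) atTop atTop :=
    tendsto_atTop_add_const_left _ _ (tendsto_rpow_atTop H.mu_pos)
  refine tendsto_atTop_mono' _ ?_ h3
  filter_upwards [eventually_ge_atTop x₀] with x hx
  have h4 : H.p (c - 1) x₀ ≤ H.p (c - 1) x := H.p_le_of_nonneg h2.le hx fun s hs => by
    linarith [H.mono' h2 hs.1.le]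
  have h5 := H.p_eq c (c - 1) x
  rw [h5]; linarith

lemma continuousAt_excess {E k d x : ℝ} (hE : 0 < E) (hx : 0 < x) (hq : 0 < H.q (-k) x) :
    ContinuousAt (H.excess E k d) x := by
  have h1 : ContinuousAt (fun y => negPowRoot n E (H.q (-k) y)) x :=
    ContinuousAt.comp (f := H.q (-k)) (continuousAt_negPowRoot hE hq) (H.continuousAt_q _ hx)
  exact ((H.continuousAt_p _ hx).sub continuousAt_const).sub
    ((h1.rpow_const (Or.inl (negPowRoot_pos hE hq).ne')).const_mul E)

lemma excess_eq {E k d x z : ℝ} (hE : 0 < E) (hz : 0 < z) (hq : H.q (-k) x = E * z ^ (-n)) :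
    H.excess E k d x = H.p (-k) x - H.p (-E) d - E * z ^ μ := by
  rw [excess, negPowRoot_eq H.n_pos hE hz hq.symm]

lemma q_sub_eq (E k : ℝ) (x : ℝ) : H.q (-(E + k)) x = H.q (-k) x - E * x ^ (-n) := by
  rw [H.q_eq (-(E + k)) (-k)]; ring

lemma p_sub_eq (E k : ℝ) (x : ℝ) : H.p (-(E + k)) x = H.p (-k) x - E * x ^ μ := by
  rw [H.p_eq (-(E + k)) (-k)]; ring

/-- Along C_{-k} from d to x the chord lies on one side of the slope at d, since h ≤ k and s > d.
The tangent of ζ ↦ E (ζ^μ, ζ^{-n}) at d bounds the other term. With q_{-E}(d) = 0 the sum leaves at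
most -k (d^μ + (μ/n) d^{n+μ} d^{-n}). -/
lemma excess_neg_of_le {E k d x : ℝ} (hE : 0 < E) (hk : 0 < k) (hd : 0 < d)
    (hqd : H.q (-E) d = 0) (hdx : d < x) (hq : 0 < H.q (-k) x)
    (hx : ∀ s ∈ Ioo d x, h s ≤ k) : H.excess E k d x < 0 := by
  have hz := negPowRoot_pos (n := n) hE hq
  have hzq := mul_negPowRoot H.n_pos hE hq
  set z := negPowRoot n E (H.q (-k) x) with hzdef
  rw [H.excess_eq hE hz hzq.symm]
  have h1 := H.slope_nonpos (c := -k) (T := d) hd hdx.le fun s hs =>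
    mul_nonpos_of_nonneg_of_nonpos (sub_nonneg.2 (H.rpow_N_le hd.le hs.1.le))
      (by linarith [hx s hs])
  have h2 := mul_le_mul_of_nonneg_left (rpow_slope_le H.mu_pos H.n_pos hz hd) hE.le
  have h3 := H.p_eq (-k) (-E) d
  have h4 := H.q_eq (-k) (-E) d
  rw [hqd, zero_add] at h4
  rw [h3, h4, ← hzq] at h1
  have hn := H.n_pos
  have hμ := H.mu_pos
  have h5 : 0 < k * (d ^ μ + μ / n * d ^ (n + μ) * d ^ (-n)) := by positivity
  linear_combination h1 + h2 + h5

/-- From w to v the curve C_{-k} gains in p at a rate above (μ/n) w^{n+μ} relative to the loss in q.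
The same loss in q moves ζ up to y = ζ(v) ≤ w, and by convexity costs E ζ^μ at a rate of at most
(μ/n) y^{n+μ}. The condition y ≤ w makes this a local statement, globalised by
`lt_of_eventually_lt_right`. -/
lemma excess_lt_of_near {E k d w v : ℝ} (hE : 0 < E) (hw : 0 < w) (hwv : w < v)
    (hk : ∀ s ∈ Ioo w v, k < h s) (hqv : 0 < H.q (-k) v)
    (hz : negPowRoot n E (H.q (-k) v) ≤ w) : H.excess E k d w < H.excess E k d v := by
  have hn := H.n_pos
  have hμ := H.mu_pos
  have hqlt : H.q (-k) v < H.q (-k) w := H.q_lt_of_pos hw hwv fun s hs => by linarith [hk s hs]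
  have hqw := hqv.trans hqlt
  have hzv := negPowRoot_pos (n := n) hE hqv
  have hzvq := mul_negPowRoot H.n_pos hE hqv
  have hzw := negPowRoot_pos (n := n) hE hqw
  have hzwq := mul_negPowRoot H.n_pos hE hqw
  set y := negPowRoot n E (H.q (-k) v)
  set z := negPowRoot n E (H.q (-k) w)
  rw [H.excess_eq hE hzv hzvq.symm, H.excess_eq hE hzw hzwq.symm]
  have h1 := H.slope_pos (c := -k) (T := w) hw hwv fun s hs =>
    mul_pos (sub_pos.2 (H.rpow_N_lt hw.le hs.1)) (by linarith [hk s hs])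
  have h2 := mul_le_mul_of_nonneg_left (rpow_slope_le H.mu_pos H.n_pos hzw hzv) hE.le
  have h3 : μ / n * y ^ (n + μ) * (H.q (-k) w - H.q (-k) v) ≤
      μ / n * w ^ (n + μ) * (H.q (-k) w - H.q (-k) v) := by
    have := H.rpow_N_le hzv.le hz
    have := sub_pos.2 hqlt
    gcongr
  have h4 : E * (μ / n * y ^ (n + μ) * (y ^ (-n) - z ^ (-n))) =
      -(μ / n * y ^ (n + μ) * (H.q (-k) w - H.q (-k) v)) := by
    rw [← hzvq, ← hzwq]; ring
  linarith

/-- The sign of `H.excess E k d` on the region where it is relevant. -/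
lemma exists_zero_excess {E k d : ℝ} (hE : 0 < E) (hk : 0 < k) (hd : 0 < d)
    (hqd : H.q (-E) d = 0) :
    ∃ a, d < a ∧ (∃ t < a, ∀ x, t < x → k < h x) ∧ E * a ^ (-n) < H.q (-k) a ∧ H.excess E k d a = 0 ∧
      ∀ x, 0 < x → E * x ^ (-n) < H.q (-k) x →
        (x < a → H.excess E k d x < 0) ∧ (a < x → 0 < H.excess E k d x) := by
  have hn := H.n_pos
  have hhd := H.h_lt_of_q_eq_zero hd hqd
  -- At a₀, the zero of q_{-(E+k)}, the eliminated ζ equals x; to the right of it ζ < x, which is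
  -- the relevant region.
  obtain ⟨a₀, ha₀, hqa₀, hha₀, -, -⟩ :=
    H.exists_zero_q (e := E + k) hd (by linarith)
  have region : ∀ x, 0 < x → (E * x ^ (-n) < H.q (-k) x ↔ a₀ < x) := by
    intro x hx
    rw [← H.q_pos_iff ha₀ hqa₀ hx, H.q_sub_eq, sub_pos]
  have hda₀ : d < a₀ := by
    rw [← H.q_neg_iff ha₀ hqa₀ hd, add_comm, H.q_sub_eq, hqd]
    have := Real.rpow_pos_of_pos hd (-n)
    nlinarith
  have qpos : ∀ x, a₀ ≤ x → 0 < H.q (-k) x := by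
    intro x hx
    have hx0 := ha₀.trans_le hx
    have h1 : 0 < E * x ^ (-n) := by positivity
    rcases hx.eq_or_lt with rfl | h2
    · have := H.q_sub_eq E k a₀; linarith
    · exact h1.trans ((region x hx0).2 h2)
  have hGa₀ : H.excess E k d a₀ < 0 := by
    have h1 := H.q_sub_eq E k a₀
    rw [H.excess_eq hE ha₀ (by linarith)]
    have h2 : H.p (-(E + k)) a₀ ≤ H.p (-(E + k)) d := H.p_le_of_nonpos hd.le hda₀.le fun s hs => by
      linarith [H.mono' (hd.trans hs.1) hs.2.le]
    have h3 := H.p_sub_eq E k a₀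
    have h4 := H.p_eq (-(E + k)) (-E) d
    have h5 : 0 < k * d ^ μ := by positivity
    linarith
  obtain ⟨t, ht0, htl, htr⟩ := H.exists_turning k
  have hGt : ∀ x, a₀ ≤ x → x ≤ t → H.excess E k d x < 0 := fun x h1 h2 =>
    H.excess_neg_of_le hE hk hd hqd (hda₀.trans_le h1) (qpos x h1) fun s hs =>
      htl s (hd.trans hs.1) (hs.2.trans_le h2)
  -- Up to a₁ the excess is negative, either because h ≤ k or by direct evaluation at a₀. Beyond a₁
  -- both h > k and ζ < x hold, so it increases strictly.
  set a₁ := max a₀ t with ha₁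
  have ha₀₁ : a₀ ≤ a₁ := le_max_left _ _
  have hGa₁ : H.excess E k d a₁ < 0 := by
    rcases le_total a₀ t with h1 | h1
    · rw [ha₁, max_eq_right h1]; exact hGt t h1 le_rfl
    · rw [ha₁, max_eq_left h1]; exact hGa₀
  have cont : ∀ x, a₀ ≤ x → ContinuousAt (H.excess E k d) x := fun x hx =>
    H.continuousAt_excess hE (ha₀.trans_le hx) (qpos x hx)
  have hmono : ∀ x y, a₁ < x → x < y → H.excess E k d x < H.excess E k d y := by
    intro x y hx hxy
    refine lt_of_eventually_lt_right hxy (fun w hw => (cont w ?_).continuousWithinAt) ?_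
    · exact ha₀₁.trans (hx.le.trans hw.1)
    · intro w hw
      have hw1 : a₁ < w := hx.trans_le hw.1
      have hw0 : a₀ < w := ha₀₁.trans_lt hw1
      have hwpos : 0 < w := ha₀.trans hw0
      have hz : negPowRoot n E (H.q (-k) w) < w := by
        have h1 := (region w hwpos).2 hw0
        rw [← mul_negPowRoot hn hE (qpos w hw0.le)] at h1
        exact H.lt_of_rpow_neg_lt hwpos (lt_of_mul_lt_mul_left h1 hE.le)
      have hc : ContinuousAt (fun y => negPowRoot n E (H.q (-k) y)) w :=
        ContinuousAt.comp (f := H.q (-k)) (continuousAt_negPowRoot hE (qpos w hw0.le))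
          (H.continuousAt_q _ hwpos)
      filter_upwards [(hc.eventually_lt continuousAt_const hz).filter_mono nhdsWithin_le_nhds,
        self_mem_nhdsWithin] with v hv hwv
      exact H.excess_lt_of_near hE hwpos hwv
        (fun s hs => htr s (((le_max_right a₀ t).trans_lt hw1).trans hs.1))
        (qpos v (hw0.trans hwv).le) hv.le
  -- Since ζ < y, the excess at y is at least p_{-(E+k)}(y) - p_{-E}(d), which tends to infinity.
  obtain ⟨y, hy1, hy2⟩ := (((H.tendsto_p (-(E + k))).eventually_gt_atTop (H.p (-E) d)).and
    (eventually_gt_atTop a₁)).exists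
  have hGy : 0 < H.excess E k d y := by
    have hy0 : a₀ < y := ha₀₁.trans_lt hy2
    have hypos := ha₀.trans hy0
    have hz : negPowRoot n E (H.q (-k) y) < y := by
      have h1 := (region y hypos).2 hy0
      rw [← mul_negPowRoot hn hE (qpos y hy0.le)] at h1
      exact H.lt_of_rpow_neg_lt hypos (lt_of_mul_lt_mul_left h1 hE.le)
    have h2 := H.rpow_mu_le (negPowRoot_pos hE (qpos y hy0.le)).le hz.le
    have h3 := H.p_sub_eq E k y
    unfold excess
    nlinarith
  obtain ⟨a, ha, haG⟩ := intermediate_value_Ioo hy2.le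
    (fun x (hx : x ∈ Icc a₁ y) => (cont x (ha₀₁.trans hx.1)).continuousWithinAt) ⟨hGa₁, hGy⟩
  have ha0 : a₀ < a := ha₀₁.trans_lt ha.1
  refine ⟨a, hda₀.trans ha0, ⟨t, (le_max_right a₀ t).trans_lt ha.1, htr⟩,
    (region a (ha₀.trans ha0)).2 ha0, haG, fun x hx hxq => ⟨fun hxa => ?_, fun hxa => ?_⟩⟩
  · have hx0 := (region x hx).1 hxq
    rcases le_or_gt x a₁ with h1 | h1
    · rcases le_total a₀ t with h2 | h2
      · exact hGt x hx0.le (by rwa [ha₁, max_eq_right h2] at h1)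
      · rw [ha₁, max_eq_left h2] at h1; linarith
    · rw [← haG]; exact hmono x a h1 hxa
  · rw [← haG]; exact hmono a x ha.1 hxa

/-- `(ζ, α)` solves the two equations of the case without switch-out region. -/
structure IsPair (E k d z a : ℝ) : Prop where
  z_pos : 0 < z
  z_lt : z < a
  d_lt : d < a
  p_eq : H.p (-k) a - H.p (-E) d = E * z ^ μ
  q_eq : H.q (-k) a = E * z ^ (-n)

/-- Existence and uniqueness of the solution `(ζ, α)` of the case without switch-out region. -/
lemma exists_isPair {E k d : ℝ} (hE : 0 < E) (hk : 0 < k) (hd : 0 < d) (hqd : H.q (-E) d = 0) :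
    ∃ z a, H.IsPair E k d z a ∧ (∀ z' a', H.IsPair E k d z' a' → z' = z ∧ a' = a) ∧
      (∃ t < a, ∀ x, t < x → k < h x) ∧ ∀ x, 0 < x → E * x ^ (-n) < H.q (-k) x →
        (x < a → H.excess E k d x < 0) ∧ (a < x → 0 < H.excess E k d x) := by
  have hn := H.n_pos
  obtain ⟨a, hda, hka, hqa, hGa, hG⟩ := H.exists_zero_excess hE hk hd hqd
  have ha := hd.trans hda
  have hqa0 : 0 < H.q (-k) a := (by positivity : 0 < E * a ^ (-n)).trans hqa
  have hz := mul_negPowRoot hn hE hqa0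
  have hzpos := negPowRoot_pos (n := n) hE hqa0
  refine ⟨negPowRoot n E (H.q (-k) a), a, ⟨hzpos, ?_, hda, ?_, hz.symm⟩, fun z' a' hp => ?_,
    hka, hG⟩
  · rw [← hz] at hqa
    exact H.lt_of_rpow_neg_lt ha (lt_of_mul_lt_mul_left hqa hE.le)
  · unfold excess at hGa; linarith
  · have ha' := hd.trans hp.d_lt
    have h1 : H.excess E k d a' = 0 := by
      rw [H.excess_eq hE hp.z_pos hp.q_eq, hp.p_eq]; ring
    have h2 := hG a' ha' (by
      rw [hp.q_eq]; exact mul_lt_mul_of_pos_left (H.rpow_neg_lt hp.z_pos hp.z_lt) hE)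
    have h3 : a' = a := by
      rcases lt_trichotomy a' a with h3 | h3 | h3
      · exact absurd h1 (h2.1 h3).ne
      · exact h3
      · exact absurd h1 (h2.2 h3).ne'
    subst h3
    exact ⟨(negPowRoot_eq hn hE hp.z_pos hp.q_eq.symm).symm, rfl⟩

lemma IsPair.excess_neg {E k d z a x : ℝ} (hp : H.IsPair E k d z a) (hE : 0 < E) (hk : 0 < k)
    (hd : 0 < d) (hqd : H.q (-E) d = 0) (hx : 0 < x) (hxq : E * x ^ (-n) < H.q (-k) x)
    (hxa : x < a) : H.excess E k d x < 0 := by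
  obtain ⟨z', a', -, h2, -, h4⟩ := H.exists_isPair hE hk hd hqd
  obtain ⟨rfl, rfl⟩ := h2 z a hp
  exact (h4 x hx hxq).1 hxa

lemma IsPair.excess_pos {E k d z a x : ℝ} (hp : H.IsPair E k d z a) (hE : 0 < E) (hk : 0 < k)
    (hd : 0 < d) (hqd : H.q (-E) d = 0) (hxq : E * x ^ (-n) < H.q (-k) x)
    (hxa : a < x) : 0 < H.excess E k d x := by
  obtain ⟨z', a', -, h2, -, h4⟩ := H.exists_isPair hE hk hd hqd
  obtain ⟨rfl, rfl⟩ := h2 z a hp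
  exact (h4 x (hd.trans (hp.d_lt.trans hxa)) hxq).2 hxa

/-- Beyond h(α) > k this gives h > k on a left neighbourhood of α, which right-continuity alone
would not provide. -/
lemma IsPair.exists_lt_h {E k d z a : ℝ} (hp : H.IsPair E k d z a) (hE : 0 < E) (hk : 0 < k)
    (hd : 0 < d) (hqd : H.q (-E) d = 0) : ∃ t < a, ∀ x, t < x → k < h x := by
  obtain ⟨z', a', -, h2, h3, -⟩ := H.exists_isPair hE hk hd hqd
  obtain ⟨rfl, rfl⟩ := h2 z a hp
  exact h3

lemma IsPair.lt_h {E k d z a x : ℝ} (hp : H.IsPair E k d z a) (hE : 0 < E) (hk : 0 < k)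
    (hd : 0 < d) (hqd : H.q (-E) d = 0) (hxa : a ≤ x) : k < h x := by
  obtain ⟨t, hta, ht⟩ := IsPair.exists_lt_h H hp hE hk hd hqd
  exact ht x (hta.trans_le hxa)

lemma IsPair.unique {E k d z a z' a' : ℝ} (hp : H.IsPair E k d z a) (hp' : H.IsPair E k d z' a')
    (hE : 0 < E) (hk : 0 < k) (hd : 0 < d) (hqd : H.q (-E) d = 0) : z = z' ∧ a = a' := by
  obtain ⟨_, _, -, h2, -⟩ := H.exists_isPair hE hk hd hqd
  obtain ⟨rfl, rfl⟩ := h2 z a hp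
  obtain ⟨rfl, rfl⟩ := h2 z' a' hp'
  exact ⟨rfl, rfl⟩

/-- Both components of the pair increase with the cost `k`. -/
lemma IsPair.strictMono {E k k' d z a z' a' : ℝ} (hp : H.IsPair E k d z a)
    (hp' : H.IsPair E k' d z' a') (hE : 0 < E) (hk : 0 < k) (hkk' : k < k')
    (hd : 0 < d) (hqd : H.q (-E) d = 0) : z < z' ∧ a < a' := by
  have hn := H.n_pos
  have hμ := H.mu_pos
  have ha' := hd.trans hp'.d_lt
  have hz' := hp'.z_pos
  have hq := H.q_eq (-k) (-k') a'
  have hpp := H.p_eq (-k) (-k') a'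
  have e1 : 0 < (-k - -k') * a' ^ (-n) := mul_pos (by linarith) (Real.rpow_pos_of_pos ha' _)
  have e2 : 0 < (-k - -k') * a' ^ μ := mul_pos (by linarith) (Real.rpow_pos_of_pos ha' _)
  have hq0 : 0 < H.q (-k) a' := by
    rw [hq, hp'.q_eq]
    have : 0 < E * z' ^ (-n) := by positivity
    linarith
  have hw := mul_negPowRoot hn hE hq0
  have hwpos := negPowRoot_pos (n := n) hE hq0
  -- The point w is the ζ that the smaller cost k assigns to a'. Since C_{-k}(a') exceeds
  -- C_{-k'}(a') in both coordinates, w < z' and the excess for k at a' is positive, which places a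
  -- below a'.
  set w := negPowRoot n E (H.q (-k) a')
  have hwz : w < z' := by
    refine H.lt_of_rpow_neg_lt hz' (lt_of_mul_lt_mul_left ?_ hE.le)
    rw [hw, hq, hp'.q_eq]; linarith
  have hex : 0 < H.excess E k d a' := by
    rw [H.excess_eq hE hwpos hw.symm]
    have := H.rpow_mu_lt hwpos.le hwz
    have := hp'.p_eq
    nlinarith
  have hreg : E * a' ^ (-n) < H.q (-k) a' := by
    rw [← hw]
    exact mul_lt_mul_of_pos_left (H.rpow_neg_lt hwpos (hwz.trans hp'.z_lt)) hE
  have haa' : a < a' := by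
    rcases lt_trichotomy a a' with h3 | h3 | h3
    · exact h3
    · subst h3
      rw [H.excess_eq hE hp.z_pos hp.q_eq, hp.p_eq] at hex
      linarith
    · linarith [IsPair.excess_neg H hp hE hk hd hqd ha' hreg h3]
  refine ⟨?_, haa'⟩
  have h5 : H.q (-k) a' < H.q (-k) a := H.q_lt_of_pos (hd.trans hp.d_lt) haa' fun s hs => by
    linarith [IsPair.lt_h H hp hE hk hd hqd hs.1.le]
  refine lt_trans (H.lt_of_rpow_neg_lt hwpos (lt_of_mul_lt_mul_left ?_ hE.le)) hwz
  rw [hw, ← hp.q_eq]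
  exact h5

end Payoff

/-! ### The critical costs of switching in and of switching out. -/

namespace Payoff

variable {μ n : ℝ} {h : ℝ → ℝ} (H : Payoff μ n h)
include H

/-- If `h(d) < 0`, there is a cost `k > 0` for which the pair is `(d, α)`. -/
lemma exists_isPair_self {E d : ℝ} (hE : 0 < E) (hd : 0 < d) (hqd : H.q (-E) d = 0)
    (hhd : h d < 0) : ∃ k a, 0 < k ∧ H.IsPair E k d d a := by
  have hn := H.n_pos
  have hμ := H.mu_pos
  -- With ζ = d the point C_{-E}(d) + E (d^μ, d^{-n}) is C_0(d). Thus a is sought such that C_0(a) -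
  -- C_0(d) is a multiple k of (a^μ, a^{-n}), i.e. as a zero of the gap of C_0(d).
  have hq0 : H.q 0 d = E * d ^ (-n) := by
    have := H.q_eq (-E) 0 d
    linarith
  have hp0 : H.p 0 d = H.p (-E) d + E * d ^ μ := by
    have := H.p_eq (-E) 0 d
    linarith
  obtain ⟨y, hhy, hdy⟩ : ∃ y, h y < 0 ∧ d < y := by
    have h1 : ∀ᶠ y in 𝓝[≥] d, h y < 0 := (H.right_cont d hd).eventually_lt continuousWithinAt_const hhd
    have h2 : ∀ᶠ y in 𝓝[>] d, h y < 0 := h1.filter_mono (nhdsWithin_mono _ Ioi_subset_Ici_self)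
    exact (h2.and self_mem_nhdsWithin).exists
  have hy := hd.trans hdy
  have neg : ∀ s ∈ Ioo d y, h s + 0 < 0 := fun s hs => by
    linarith [H.mono' (hd.trans hs.1) hs.2.le]
  have hpy := H.p_lt_of_neg hd.le hdy neg
  have hqy := H.q_lt_of_neg hd hdy neg
  have hGy : 0 < H.gap (H.p 0 d) (H.q 0 d) y := by
    rw [H.gap_eq 0 _ _ hy]
    have := Real.rpow_pos_of_pos hy (n + μ)
    nlinarith
  have hqd0 : 0 < H.q 0 d := by rw [hq0]; positivity
  obtain ⟨x, ⟨hx1, hx2⟩, hx3⟩ := ((((H.tendsto_q 0).eventually_lt_const hqd0).and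
    ((H.tendsto_p 0).eventually_gt_atTop (H.p 0 d))).and (eventually_gt_atTop y)).exists
  have hGx : H.gap (H.p 0 d) (H.q 0 d) x < 0 := by
    rw [H.gap_eq 0 _ _ (hy.trans hx3)]
    have := Real.rpow_pos_of_pos (hy.trans hx3) (n + μ)
    nlinarith
  obtain ⟨a, ha, haG⟩ := intermediate_value_Ioo' hx3.le
    (H.continuousOn_gap (H.p 0 d) (H.q 0 d) fun s (hs : s ∈ Icc y x) => hy.trans_le hs.1)
    ⟨hGx, hGy⟩
  have hya : y < a := ha.1
  have ha0 : 0 < a := hy.trans hya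
  have haμ : 0 < a ^ μ := by positivity
  have hann : 0 < a ^ (-n) := by positivity
  rw [H.gap_eq 0 _ _ ha0] at haG
  set k := a ^ (n + μ) * (H.q 0 a - H.q 0 d) / a ^ μ with hk
  have hk1 : k * a ^ μ = H.p 0 a - H.p 0 d := by
    rw [hk, div_mul_cancel₀ _ haμ.ne']; linarith
  have hk2 : k * a ^ (-n) = H.q 0 a - H.q 0 d := by
    rw [hk, ← rpow_N_mul (n := n) (μ := μ) ha0]
    have : a ^ (n + μ) ≠ 0 := (Real.rpow_pos_of_pos ha0 _).ne'
    field_simp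
  -- If h changes sign at T < a, both arcs of C_0 from d to T and from T to a have the favourable
  -- sign relative to the slope at T; otherwise h ≤ 0 up to a and q_0 has only increased.
  have hkpos : 0 < k := by
    obtain ⟨T, hT0, hTl, hTr⟩ := H.exists_turning 0
    have hyT : y ≤ T := by
      by_contra hc
      linarith [hTr y (not_le.1 hc)]
    rcases lt_or_ge T a with hTa | hTa
    · have hTpos := hy.trans_le hyT
      have s1 := H.slope_nonneg (c := 0) (T := T) hd (hdy.le.trans hyT) fun s hs =>
        mul_nonneg_of_nonpos_of_nonpos
          (sub_nonpos.2 (H.rpow_N_le (hd.trans hs.1).le hs.2.le))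
          (by linarith [hTl s (hd.trans hs.1) hs.2])
      have s2 := H.slope_pos (c := 0) (T := T) hTpos hTa fun s hs =>
        mul_pos (sub_pos.2 (H.rpow_N_lt hTpos.le hs.1)) (by linarith [hTr s hs.1])
      have s3 : 0 < k * (a ^ μ + μ / n * T ^ (n + μ) * a ^ (-n)) := by
        linear_combination s1 + s2 - hk1 - μ / n * T ^ (n + μ) * hk2
      exact pos_of_mul_pos_left s3 (by positivity)
    · have s1 : H.p 0 a ≤ H.p 0 y := H.p_le_of_nonpos hy.le hya.le fun s hs => by
        linarith [hTl s (hy.trans hs.1) (hs.2.trans_le hTa)]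
      have s2 : H.q 0 y ≤ H.q 0 a := H.q_le_of_nonpos hy hya.le fun s hs => by
        linarith [hTl s (hy.trans hs.1) (hs.2.trans_le hTa)]
      have s3 : 0 < k * a ^ (-n) := by linarith
      exact pos_of_mul_pos_left s3 hann.le
  refine ⟨k, a, hkpos, hd, hdy.trans hya, hdy.trans hya, ?_, ?_⟩
  · rw [H.p_eq (-k) 0]; linarith
  · rw [H.q_eq (-k) 0]; linarith

/-- In the case without switch-out region with `ζ < d`, the gap changes its sign exactly once; there
the cost `k₀` of switching out is critical. -/
lemma IsPair.exists_signChange {E k d z a : ℝ} (hp : H.IsPair E k d z a) (hE : 0 < E) (hk : 0 < k)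
    (hd : 0 < d) (hqd : H.q (-E) d = 0) (hzd : z < d) :
    ∃ y k₀, d < y ∧ y < a ∧ (∀ x, d ≤ x → x < y → H.gap (H.p (-k) a) (H.q (-k) a) x < 0) ∧
      (∀ x, y < x → x < a → 0 < H.gap (H.p (-k) a) (H.q (-k) a) x) ∧
      0 < k₀ ∧ H.p k₀ y = H.p (-k) a ∧ H.q k₀ y = H.q (-k) a ∧
      ∀ s, 0 < s → s < y → h s + k₀ ≤ 0 := by
  have hn := H.n_pos
  have hμ := H.mu_pos
  have ha := hd.trans hp.d_lt
  have hz := hp.z_pos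
  obtain ⟨t, hta, ht⟩ := IsPair.exists_lt_h H hp hE hk hd hqd
  -- At d the gap equals E ζ^{-n} (ζ^{n+μ} - d^{n+μ}), so its sign is exactly the comparison of ζ
  -- with d.
  have gd : H.gap (H.p (-k) a) (H.q (-k) a) d < 0 := by
    rw [H.gap_eq (-E) _ _ hd, hqd, hp.p_eq, hp.q_eq, ← rpow_N_mul (n := n) hz]
    have h1 := H.rpow_N_lt hz.le hzd
    have h2 : 0 < E * z ^ (-n) := by positivity
    nlinarith
  obtain ⟨y₀, hy₀, hy₀a⟩ := exists_between (max_lt hta hp.d_lt)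
  have hdy₀ := (le_max_right _ _).trans_lt hy₀
  have gy₀ : 0 < H.gap (H.p (-k) a) (H.q (-k) a) y₀ :=
    H.gap_pos_left (hd.trans hdy₀) hy₀a fun s hs => by
      linarith [ht s (((le_max_left _ _).trans_lt hy₀).trans hs.1)]
  have ga : H.gap (H.p (-k) a) (H.q (-k) a) a = 0 := H.gap_eq_zero ha rfl rfl
  obtain ⟨y, hy, gy⟩ := intermediate_value_Ioo hdy₀.le
    (H.continuousOn_gap (H.p (-k) a) (H.q (-k) a) fun s (hs : s ∈ Icc d y₀) => hd.trans_le hs.1)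
    ⟨gd, gy₀⟩
  have hdy := hy.1
  have hy0 := hd.trans hdy
  have left : ∀ x, d ≤ x → x < y → H.gap (H.p (-k) a) (H.q (-k) a) x < 0 := by
    intro x hdx hxy
    by_contra hc
    exact (H.gap_pos_of_ne (hd.trans_le hdx) hxy hy.2 (not_lt.1 hc) gy₀.le (Or.inr gy₀)).ne' gy
  have right : ∀ x, y < x → x < a → 0 < H.gap (H.p (-k) a) (H.q (-k) a) x := by
    intro x hyx hxa
    rcases lt_trichotomy x y₀ with h1 | rfl | h1
    · exact H.gap_pos_of_ne hy0 hyx h1 gy.ge gy₀.le (Or.inr gy₀)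
    · exact gy₀
    · exact H.gap_pos_of_ne (hd.trans hdy₀) h1 hxa gy₀.le ga.ge (Or.inl gy₀)
  have hyμ : 0 < y ^ μ := by positivity
  -- Vanishing of the gap at y means that C_{-k}(a) - C_0(y) is a multiple of (y^μ, y^{-n}); k₀ is
  -- that multiple.
  set k₀ := (H.p (-k) a - H.p 0 y) / y ^ μ with hk₀
  have e1 : H.p k₀ y = H.p (-k) a := by
    rw [H.p_eq k₀ 0, sub_zero, hk₀, div_mul_cancel₀ _ hyμ.ne']; ring
  have e2 : H.q k₀ y = H.q (-k) a := by
    rw [H.gap_eq k₀ _ _ hy0, e1] at gy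
    have : y ^ (n + μ) ≠ 0 := (Real.rpow_pos_of_pos hy0 _).ne'
    have h3 : y ^ (n + μ) * (H.q k₀ y - H.q (-k) a) = 0 := by linarith
    linarith [(mul_eq_zero.1 h3).resolve_left this]
  -- If h + k₀ were positive at s it would be so on (s, y), and the gap would be positive at s by
  -- `gap_pos_left`.
  have hle : ∀ s, d ≤ s → s < y → h s + k₀ ≤ 0 := by
    intro s hds hsy
    by_contra hc
    have hs := hd.trans_le hds
    have h1 := H.gap_pos_left (c := k₀) hs hsy fun r hr => by
      linarith [H.mono' hs hr.1.le]
    rw [e1, e2] at h1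
    linarith [left s hds hsy]
  have hle' : ∀ s, 0 < s → s < y → h s + k₀ ≤ 0 := by
    intro s hs hsy
    rcases le_total d s with h1 | h1
    · exact hle s h1 hsy
    · linarith [hle d le_rfl hdy, H.mono' hs h1]
  refine ⟨y, k₀, hdy, hy.2.trans hy₀a, left, right, ?_, e1, e2, hle'⟩
  -- Positivity of k₀: the chord of C_{k₀} from d to y against the slope at d, and the strict
  -- tangent inequality at d, which uses ζ ≠ d.
  have s1 := H.slope_nonpos (c := k₀) (T := d) hd hdy.le fun s hs =>
    mul_nonpos_of_nonneg_of_nonpos (sub_nonneg.2 (H.rpow_N_le hd.le hs.1.le))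
      (hle s hs.1.le hs.2)
  have s2 := mul_lt_mul_of_pos_left (rpow_slope_lt hμ hn hz hd hzd.ne) hE
  have s3 := H.p_eq k₀ (-E) d
  have s4 := H.q_eq k₀ (-E) d
  have s5 := hp.p_eq
  have s6 := hp.q_eq
  rw [e1, e2, s3, s4, hqd, s6] at s1
  have s7 : 0 < k₀ * (d ^ μ + μ / n * d ^ (n + μ) * d ^ (-n)) := by
    linear_combination s1 + s2 - s5
  exact pos_of_mul_pos_left s7 (by positivity)

/-! ### The pure switching equations for (β, α). -/

/-- `(β, α)` solves the two equations of the pure switching problem. -/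
structure IsSwitch (k₀ k₁ b a : ℝ) : Prop where
  b_pos : 0 < b
  b_lt : b < a
  p_eq : H.p k₀ b = H.p (-k₁) a
  q_eq : H.q k₀ b = H.q (-k₁) a

/-- Otherwise h + k₀ ≥ 0 from b on, so q_{k₀}(a) ≤ q_{k₀}(b) = q_{-k₁}(a), contrary to k₀ > -k₁. -/
lemma IsSwitch.h_lt {k₀ k₁ b a : ℝ} (hs : H.IsSwitch k₀ k₁ b a) (hk : 0 < k₀ + k₁) :
    h b + k₀ < 0 := by
  by_contra hc
  have h1 : H.q k₀ a ≤ H.q k₀ b := H.q_le_of_nonneg hs.b_pos hs.b_lt.le fun s hs' => by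
    linarith [H.mono' hs.b_pos hs'.1.le]
  have h2 := H.q_eq k₀ (-k₁) a
  have h3 : 0 < (k₀ - -k₁) * a ^ (-n) :=
    mul_pos (by linarith) (Real.rpow_pos_of_pos (hs.b_pos.trans hs.b_lt) _)
  linarith [hs.q_eq]

lemma IsSwitch.exists_lt_h {k₀ k₁ b a : ℝ} (hs : H.IsSwitch k₀ k₁ b a) (hk : 0 < k₀ + k₁) :
    ∃ t < a, ∀ x, t < x → k₁ < h x := by
  by_contra! hc
  have h1 : H.p (-k₁) a ≤ H.p (-k₁) b := H.p_le_of_nonpos hs.b_pos.le hs.b_lt.le fun s hs' => by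
    obtain ⟨x, h1, h2⟩ := hc s hs'.2
    linarith [H.mono' (hs.b_pos.trans hs'.1) h1.le]
  have h2 := H.p_eq k₀ (-k₁) b
  have h3 : 0 < (k₀ - -k₁) * b ^ μ :=
    mul_pos (by linarith) (Real.rpow_pos_of_pos hs.b_pos _)
  linarith [hs.p_eq]

/-- If b < b', then p drops along C_{k₀}, which forces a' < a. The arc of C_{k₀} from b to b' and
that of C_{-k₁} from a' to a form a closed loop, yet both have strictly favourable chords relative
to the slope at b'. -/
lemma IsSwitch.not_lt_b {k₀ k₁ b a b' a' : ℝ} (hs : H.IsSwitch k₀ k₁ b a)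
    (hs' : H.IsSwitch k₀ k₁ b' a') (hk : 0 < k₀ + k₁) : ¬ b < b' := by
  intro hbb
  have hb := hs.b_pos
  obtain ⟨t, hta, ht⟩ := IsSwitch.exists_lt_h H hs hk
  obtain ⟨t', hta', ht'⟩ := IsSwitch.exists_lt_h H hs' hk
  have hb' := IsSwitch.h_lt H hs' hk
  have hneg : ∀ s ∈ Ioo b b', h s + k₀ < 0 := fun s hs1 => by
    linarith [H.mono' (hb.trans hs1.1) hs1.2.le]
  have haa : a' < a := by
    by_contra hc
    have h1 : H.p (-k₁) a ≤ H.p (-k₁) a' :=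
      H.p_le_of_nonneg (hb.trans hs.b_lt).le (not_lt.1 hc) fun s hs1 => by
        linarith [ht s (hta.trans hs1.1)]
    linarith [H.p_lt_of_neg hb.le hbb hneg, hs.p_eq, hs'.p_eq]
  have s1 := H.slope_pos (c := k₀) (T := b') hb hbb fun s hs1 =>
    mul_pos_of_neg_of_neg (sub_neg.2 (H.rpow_N_lt (hb.trans hs1.1).le hs1.2)) (hneg s hs1)
  have s2 := H.slope_pos (c := -k₁) (T := b') (hs'.b_pos.trans hs'.b_lt) haa fun s hs1 =>
    mul_pos (sub_pos.2 (H.rpow_N_lt hs'.b_pos.le (hs'.b_lt.trans hs1.1)))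
      (by linarith [ht' s (hta'.trans hs1.1)])
  rw [← hs.p_eq, ← hs'.p_eq, ← hs.q_eq, ← hs'.q_eq] at s2
  linarith

lemma IsSwitch.unique {k₀ k₁ b a b' a' : ℝ} (hs : H.IsSwitch k₀ k₁ b a)
    (hs' : H.IsSwitch k₀ k₁ b' a') (hk : 0 < k₀ + k₁) : b = b' ∧ a = a' := by
  have hbb : b = b' := le_antisymm (not_lt.1 (IsSwitch.not_lt_b H hs' hs hk))
    (not_lt.1 (IsSwitch.not_lt_b H hs hs' hk))
  subst hbb
  refine ⟨rfl, ?_⟩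
  obtain ⟨t, hta, ht⟩ := IsSwitch.exists_lt_h H hs hk
  obtain ⟨t', hta', ht'⟩ := IsSwitch.exists_lt_h H hs' hk
  have he : H.p (-k₁) a = H.p (-k₁) a' := hs.p_eq.symm.trans hs'.p_eq
  rcases lt_trichotomy a a' with h1 | h1 | h1
  · exact absurd he (H.p_lt_of_pos (hs.b_pos.trans hs.b_lt).le h1 fun s hs1 => by
      linarith [ht s (hta.trans hs1.1)]).ne
  · exact h1
  · exact absurd he (H.p_lt_of_pos (hs.b_pos.trans hs'.b_lt).le h1 fun s hs1 => by
      linarith [ht' s (hta'.trans hs1.1)]).ne'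

/-- Lowering the cost `k₀'` of switching out to `k₀` moves `β` up and `α` down. -/
lemma exists_isSwitch {k₀ k₀' k₁ y a : ℝ} (hk₀ : 0 < k₀) (hk₁ : 0 < k₁) (hk : k₀ < k₀')
    (hy : 0 < y) (ha : 0 < a) (hp : H.p k₀' y = H.p (-k₁) a) (hq : H.q k₀' y = H.q (-k₁) a)
    (hle : ∀ s, 0 < s → s < y → h s + k₀' ≤ 0) (hka : k₁ < h a) :
    ∃ b a', H.IsSwitch k₀ k₁ b a' ∧ y < b ∧ a' < a := by
  -- The levels are ordered y ≤ t₀ ≤ t₁ ≤ a. The point β is sought on [y, t₀], where p_{k₀} does not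
  -- increase, and α on [t₁, a], where p_{-k₁} increases strictly.
  obtain ⟨t₀, ht₀, ht₀l, ht₀r⟩ := H.exists_turning (-k₀)
  obtain ⟨t₁, ht₁, ht₁l, ht₁r⟩ := H.exists_turning k₁
  have hyt₀ : y ≤ t₀ := by
    by_contra hc
    obtain ⟨s, hs1, hs2⟩ := exists_between (not_le.1 hc)
    linarith [hle s (ht₀.trans_lt hs1) hs2, ht₀r s hs1]
  have ht₀₁ : t₀ ≤ t₁ := by
    by_contra hc
    obtain ⟨s, hs1, hs2⟩ := exists_between (not_le.1 hc)
    linarith [ht₀l s (ht₁.trans_lt hs1) hs2, ht₁r s hs1]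
  have ht₁a : t₁ ≤ a := by
    by_contra hc
    linarith [ht₁l a ha (not_le.1 hc)]
  have ht₀pos := hy.trans_le hyt₀
  have ht₁pos := ht₀pos.trans_le ht₀₁
  have hyμ := Real.rpow_pos_of_pos hy μ
  have hyn := Real.rpow_pos_of_pos hy (-n)
  have eP : H.p k₀ y < H.p (-k₁) a := by
    rw [← hp, H.p_eq k₀' k₀]; nlinarith
  have eQ : H.q k₀ y < H.q (-k₁) a := by
    rw [← hq, H.q_eq k₀' k₀]; nlinarith
  have cP : H.p (-k₁) t₁ ≤ H.p k₀ t₀ := by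
    have h1 : H.p (-k₁) t₁ ≤ H.p (-k₁) t₀ := H.p_le_of_nonpos ht₀ ht₀₁ fun s hs => by
      linarith [ht₁l s (ht₀pos.trans hs.1) hs.2]
    rw [H.p_eq k₀ (-k₁)]
    nlinarith [Real.rpow_pos_of_pos ht₀pos μ]
  have cQ : H.q (-k₁) t₁ < H.q k₀ t₀ := by
    have h1 : H.q k₀ t₁ ≤ H.q k₀ t₀ := H.q_le_of_nonneg ht₀pos ht₀₁ fun s hs => by
      linarith [ht₀r s hs.1]
    rw [H.q_eq k₀ (-k₁) t₁] at h1
    nlinarith [Real.rpow_pos_of_pos ht₁pos (-n)]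
  have hanti : ∀ x ∈ Icc y t₀, H.p k₀ t₀ ≤ H.p k₀ x ∧ H.p k₀ x ≤ H.p k₀ y := fun x hx =>
    ⟨H.p_le_of_nonpos (hy.trans_le hx.1).le hx.2 fun s hs => by
      linarith [ht₀l s (hy.trans_le (hx.1.trans hs.1.le)) hs.2],
     H.p_le_of_nonpos hy.le hx.1 fun s hs => by
      linarith [ht₀l s (hy.trans hs.1) (hs.2.trans_le hx.2)]⟩
  -- The arc of C_{-k₁} over [t₁, a] is parametrised by its p-coordinate; matching p makes α a
  -- continuous function of β and leaves one equation in q, with opposite signs at y and t₀.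
  obtain ⟨g, hgc, hgm, hg⟩ := exists_continuousOn_inverse ht₁a
    (H.continuousOn_p (-k₁) fun s (hs : s ∈ Icc t₁ a) => ht₁pos.trans_le hs.1)
    (fun u hu v _ huv => H.p_lt_of_pos (ht₁.trans hu.1) huv fun s hs => by
      linarith [ht₁r s (hu.1.trans_lt hs.1)])
  have hmaps : MapsTo (H.p k₀) (Icc y t₀) (Icc (H.p (-k₁) t₁) (H.p (-k₁) a)) := fun x hx =>
    ⟨cP.trans (hanti x hx).1, (hanti x hx).2.trans eP.le⟩
  have hgmem : ∀ x ∈ Icc y t₀, g (H.p k₀ x) ∈ Icc t₁ a := fun x hx => hgm (hmaps hx)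
  have hqmono : ∀ u ∈ Icc t₁ a, H.q (-k₁) a ≤ H.q (-k₁) u ∧ H.q (-k₁) u ≤ H.q (-k₁) t₁ :=
    fun u hu => ⟨H.q_le_of_nonneg (ht₁pos.trans_le hu.1) hu.2 fun s hs => by
        linarith [ht₁r s (hu.1.trans_lt hs.1)],
      H.q_le_of_nonneg ht₁pos hu.1 fun s hs => by linarith [ht₁r s hs.1]⟩
  have hcont : ContinuousOn (fun x => H.q k₀ x - H.q (-k₁) (g (H.p k₀ x))) (Icc y t₀) := by
    have h0 : ContinuousOn (H.p k₀) (Icc y t₀) := H.continuousOn_p _ fun s hs => hy.trans_le hs.1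
    have h1 : ContinuousOn (fun x => g (H.p k₀ x)) (Icc y t₀) := hgc.comp h0 hmaps
    have h2 : ContinuousOn (H.q (-k₁)) (Icc t₁ a) :=
      H.continuousOn_q _ fun s hs => ht₁pos.trans_le hs.1
    exact (H.continuousOn_q _ fun s hs => hy.trans_le hs.1).sub (h2.comp h1 hgmem)
  obtain ⟨b, hb, hb0⟩ := intermediate_value_Ioo hyt₀ hcont
    (show (0 : ℝ) ∈ Ioo _ _ from
      ⟨by linarith [(hqmono _ (hgmem y ⟨le_rfl, hyt₀⟩)).1],
       by linarith [(hqmono _ (hgmem t₀ ⟨hyt₀, le_rfl⟩)).2]⟩)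
  have hbI : b ∈ Icc y t₀ := ⟨hb.1.le, hb.2.le⟩
  have hmem := hgmem b hbI
  have hpe := hg _ (hmaps hbI)
  refine ⟨b, g (H.p k₀ b), ⟨hy.trans hb.1, hb.2.trans_le (ht₀₁.trans hmem.1), hpe.symm,
    by simp only at hb0; linarith⟩, hb.1, lt_of_le_of_ne hmem.2 fun h0 => ?_⟩
  rw [h0] at hpe
  linarith [(hanti b hbI).2]

/-! ### The inner equations for (δ, γ) when ζ and β are given. -/

/-- `(δ, γ)` solves the two equations which `ζ` and the costs of abandoning and switching out
determine. -/
structure IsInner (E k₀ z x g : ℝ) : Prop where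
  x_pos : 0 < x
  x_lt : x < g
  p_eq : H.p k₀ g - H.p (-E) x = E * z ^ μ
  q_eq : H.q k₀ g - H.q (-E) x = E * z ^ (-n)

lemma q_shift (E k : ℝ) (x : ℝ) : H.q k x = H.q (-E) x + (k + E) * x ^ (-n) := by
  rw [H.q_eq k (-E)]; ring

lemma p_shift (E k : ℝ) (x : ℝ) : H.p k x = H.p (-E) x + (k + E) * x ^ μ := by
  rw [H.p_eq k (-E)]; ring

lemma q_lt_of_h_neg {k b x y : ℝ} (hb : h b + k < 0) (hx : 0 < x) (hxy : x < y) (hyb : y ≤ b) :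
    H.q k x < H.q k y :=
  H.q_lt_of_neg hx hxy fun s hs => by
    linarith [H.mono' (hx.trans hs.1) (hs.2.le.trans hyb)]

/-- As h + k₀ < 0 up to b, q_{k₀} increases there. Comparing its values at x and g gives the left
end x₀ of the range of x, and z < x. -/
lemma IsInner.mul_lt {E k₀ z x g b : ℝ} (hi : H.IsInner E k₀ z x g) (hb : h b + k₀ < 0)
    (hgb : g ≤ b) : (k₀ + E) * x ^ (-n) < E * z ^ (-n) := by
  have h1 := H.q_lt_of_h_neg hb hi.x_pos hi.x_lt hgb
  have h2 := H.q_shift E k₀ x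
  linarith [hi.q_eq]

lemma IsInner.z_lt {E k₀ z x g b : ℝ} (hi : H.IsInner E k₀ z x g) (hE : 0 < E) (hk₀ : 0 < k₀)
    (hb : h b + k₀ < 0) (hgb : g ≤ b) : z < x := by
  have h1 := IsInner.mul_lt H hi hb hgb
  refine H.lt_of_rpow_neg_lt hi.x_pos (lt_of_mul_lt_mul_left ?_ hE.le)
  nlinarith [Real.rpow_pos_of_pos hi.x_pos (-n)]

lemma IsInner.x_lt_d {E k₀ z x g b d : ℝ} (hi : H.IsInner E k₀ z x g) (hd : 0 < d)
    (hqd : H.q (-E) d = 0) (hb : h b + k₀ < 0) (hgb : g < b)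
    (hbz : H.q k₀ b = E * z ^ (-n)) : x < d := by
  rw [← H.q_neg_iff hd hqd hi.x_pos]
  have h1 := H.q_lt_of_h_neg hb (hi.x_pos.trans hi.x_lt) hgb le_rfl
  linarith [hi.q_eq]

/-- q_{-E}(b) = E z^{-n} - (k₀ + E) b^{-n}, which is positive by `IsInner.mul_lt` and x < b; and
q_{-E} is positive only to the right of d. -/
lemma IsInner.d_lt {E k₀ z x g b d : ℝ} (hi : H.IsInner E k₀ z x g) (hE : 0 < E) (hk₀ : 0 < k₀)
    (hd : 0 < d) (hqd : H.q (-E) d = 0) (hb : h b + k₀ < 0) (hgb : g < b)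
    (hbz : H.q k₀ b = E * z ^ (-n)) : d < b := by
  have hb0 := hi.x_pos.trans (hi.x_lt.trans hgb)
  rw [← H.q_pos_iff hd hqd hb0]
  have h1 := IsInner.mul_lt H hi hb hgb.le
  have h2 := H.q_shift E k₀ b
  have h3 := H.rpow_neg_lt hi.x_pos (hi.x_lt.trans hgb)
  nlinarith

/-- The curve of all `(δ, γ)` that satisfy the second of the two equations, and the behaviour of the
first equation along it. -/
lemma exists_inner_curve {E k₀ z b d : ℝ} (hE : 0 < E) (hk₀ : 0 < k₀) (hd : 0 < d)
    (hqd : H.q (-E) d = 0) (hz : 0 < z) (hdb : d < b) (hb : h b + k₀ < 0)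
    (hbz : H.q k₀ b = E * z ^ (-n)) :
    ∃ (x₀ : ℝ) (G : ℝ → ℝ), 0 < x₀ ∧ x₀ < d ∧ (k₀ + E) * x₀ ^ (-n) = E * z ^ (-n) ∧ G x₀ = x₀ ∧
      G d = b ∧ (∀ x ∈ Icc x₀ d, G x ∈ Icc x₀ b ∧ H.q k₀ (G x) = E * z ^ (-n) + H.q (-E) x) ∧
      (∀ x, x₀ < x → x ≤ d → x < G x) ∧
      ContinuousOn (fun x => H.p k₀ (G x) - H.p (-E) x - E * z ^ μ) (Icc x₀ d) ∧
      ∀ x y, x₀ < x → x < y → y ≤ d → H.p k₀ (G y) - H.p (-E) y - E * z ^ μ <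
        H.p k₀ (G x) - H.p (-E) x - E * z ^ μ := by
  have hn := H.n_pos
  have hkE : 0 < k₀ + E := by linarith
  have hzE : 0 < E * z ^ (-n) := by positivity
  have hhd := H.h_lt_of_q_eq_zero hd hqd
  -- At x₀ the equation in q holds with γ = δ = x₀; at δ = d it holds with γ = b, because q_{-E}(d)
  -- = 0. These are the ends of the curve.
  set x₀ := negPowRoot n (k₀ + E) (E * z ^ (-n)) with hx₀
  have hx₀pos : 0 < x₀ := negPowRoot_pos hkE hzE
  have hx₀eq : (k₀ + E) * x₀ ^ (-n) = E * z ^ (-n) := mul_negPowRoot hn hkE hzE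
  have hx₀d : x₀ < d := by
    refine H.lt_of_rpow_neg_lt hd (lt_of_mul_lt_mul_left ?_ hkE.le)
    rw [hx₀eq, ← hbz]
    have h1 := H.q_lt_of_h_neg hb hd hdb le_rfl
    have h2 := H.q_shift E k₀ d
    linarith
  have hinj : StrictMonoOn (H.q k₀) (Icc x₀ b) := fun u hu v hv huv =>
    H.q_lt_of_h_neg hb (hx₀pos.trans_le hu.1) huv hv.2
  obtain ⟨g, hgc, hgm, hg⟩ := exists_continuousOn_inverse (hx₀d.trans hdb).le
    (H.continuousOn_q k₀ fun s (hs : s ∈ Icc x₀ b) => hx₀pos.trans_le hs.1) hinj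
  set v : ℝ → ℝ := fun x => E * z ^ (-n) + H.q (-E) x with hv
  have hvmono : ∀ x y, 0 < x → x < y → y ≤ d → v x < v y := fun x y hx hxy hyd => by
    have := H.q_lt_of_lt (e := E) hx hxy ((H.mono' (hx.trans hxy) hyd).trans_lt hhd)
    simp only [hv]; linarith
  have hvx₀ : v x₀ = H.q k₀ x₀ := by
    simp only [hv]; rw [H.q_shift E k₀, hx₀eq]; ring
  have hvd : v d = H.q k₀ b := by simp only [hv]; rw [hqd, hbz, add_zero]
  have hvm : MapsTo v (Icc x₀ d) (Icc (H.q k₀ x₀) (H.q k₀ b)) := by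
    intro x hx
    rw [← hvx₀, ← hvd]
    constructor
    · rcases hx.1.eq_or_lt with rfl | h1
      · exact le_rfl
      · exact (hvmono _ _ hx₀pos h1 hx.2).le
    · rcases hx.2.eq_or_lt with rfl | h1
      · exact le_rfl
      · exact (hvmono _ _ (hx₀pos.trans_le hx.1) h1 le_rfl).le
  set G : ℝ → ℝ := fun x => g (v x) with hG
  have hGmem : ∀ x ∈ Icc x₀ d, G x ∈ Icc x₀ b := fun x hx => hgm (hvm hx)
  have hGq : ∀ x ∈ Icc x₀ d, H.q k₀ (G x) = v x := fun x hx => hg _ (hvm hx)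
  have hGx₀ : G x₀ = x₀ := hinj.injOn (hGmem _ ⟨le_rfl, hx₀d.le⟩) ⟨le_rfl, (hx₀d.trans hdb).le⟩
    ((hGq _ ⟨le_rfl, hx₀d.le⟩).trans hvx₀)
  have hGd : G d = b := hinj.injOn (hGmem _ ⟨hx₀d.le, le_rfl⟩) ⟨(hx₀d.trans hdb).le, le_rfl⟩
    ((hGq _ ⟨hx₀d.le, le_rfl⟩).trans hvd)
  have hGlt : ∀ x, x₀ < x → x ≤ d → x < G x := by
    intro x hx hxd
    have hxpos := hx₀pos.trans hx
    have hxI : x ∈ Icc x₀ d := ⟨hx.le, hxd⟩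
    rw [← hinj.lt_iff_lt ⟨hx.le, hxd.trans hdb.le⟩ (hGmem x hxI), hGq x hxI, H.q_shift E k₀ x]
    have := mul_lt_mul_of_pos_left (H.rpow_neg_lt hx₀pos hx) hkE
    simp only [hv]; linarith
  have hGc : ContinuousOn G (Icc x₀ d) := hgc.comp
    (continuousOn_const.add (H.continuousOn_q (-E) fun s hs => hx₀pos.trans_le hs.1)) hvm
  have hJc : ContinuousOn (fun x => H.p k₀ (G x) - H.p (-E) x - E * z ^ μ) (Icc x₀ d) := by
    have h2 : ContinuousOn (H.p k₀) (Icc x₀ b) :=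
      H.continuousOn_p _ fun s hs => hx₀pos.trans_le hs.1
    exact ((h2.comp hGc hGmem).sub (H.continuousOn_p _ fun s hs => hx₀pos.trans_le hs.1)).sub
      continuousOn_const
  refine ⟨x₀, G, hx₀pos, hx₀d, hx₀eq, hGx₀, hGd, fun x hx => ⟨hGmem x hx, hGq x hx⟩, hGlt, hJc,
    fun x y hx hxy hyd => ?_⟩
  have hsub : Icc x y ⊆ Icc x₀ d := Icc_subset_Icc hx.le hyd
  refine neg_lt_neg_iff.1 (lt_of_eventually_lt_right
    (f := fun x => -(H.p k₀ (G x) - H.p (-E) x - E * z ^ μ)) hxy (hJc.mono hsub).neg ?_)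
  intro w hw
  have hw0 : x₀ < w := hx.trans_le hw.1
  have hwpos := hx₀pos.trans hw0
  have hwI : w ∈ Icc x₀ d := hsub ⟨hw.1, hw.2.le⟩
  have hwG := hGlt w hw0 hwI.2
  filter_upwards [Ioo_mem_nhdsGT (lt_min hw.2 hwG)] with u hu
  have huy := hu.2.trans_le (min_le_left _ _)
  have huG := hu.2.trans_le (min_le_right _ _)
  have huI : u ∈ Icc x₀ d := ⟨(hw0.trans hu.1).le, huy.le.trans hyd⟩
  have hGG : G w < G u := by
    rw [← hinj.lt_iff_lt (hGmem w hwI) (hGmem u huI), hGq w hwI, hGq u huI]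
    exact hvmono w u hwpos hu.1 huI.2
  -- Passing from w to u changes q by the same amount on both curves. Parameters on C_{-E} are below
  -- G w and those on C_{k₀} above it, so the drop in p_{k₀} outweighs that in p_{-E}.
  have s1 := H.slope_pos (c := -E) (T := G w) hwpos hu.1 fun s hs =>
    mul_pos_of_neg_of_neg
      (sub_neg.2 (H.rpow_N_lt (hwpos.trans hs.1).le (hs.2.trans huG)))
      (by linarith [H.mono' (hwpos.trans hs.1) (hs.2.le.trans huI.2)])
  have s2 := H.slope_neg (c := k₀) (T := G w) (hwpos.trans hwG) hGG fun s hs =>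
    mul_neg_of_pos_of_neg (sub_pos.2 (H.rpow_N_lt (hwpos.trans hwG).le hs.1))
      (by linarith [H.mono' (hwpos.trans (hwG.trans hs.1)) (hs.2.le.trans (hGmem u huI).2)])
  have e1 : H.q k₀ (G w) - H.q k₀ (G u) = H.q (-E) w - H.q (-E) u := by
    rw [hGq w hwI, hGq u huI]; simp only [hv]; ring
  rw [e1] at s2
  show -_ < -_
  linarith

/-- Along the curve the first equation starts positive: at x₀ the difference of the two points is
(k₀ + E)(x₀^μ, x₀^{-n}) and z < x₀. It ends negative at (d, b) by the assumption on b. -/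
lemma exists_isInner {E k₀ z b d : ℝ} (hE : 0 < E) (hk₀ : 0 < k₀) (hd : 0 < d)
    (hqd : H.q (-E) d = 0) (hz : 0 < z) (hdb : d < b) (hb : h b + k₀ < 0)
    (hbz : H.q k₀ b = E * z ^ (-n)) (hJ : H.p k₀ b - H.p (-E) d < E * z ^ μ) :
    ∃ x g, H.IsInner E k₀ z x g ∧ g < b := by
  obtain ⟨x₀, G, hx₀, hx₀d, hx₀eq, hGx₀, hGd, hG, hGlt, hJc, -⟩ :=
    H.exists_inner_curve hE hk₀ hd hqd hz hdb hb hbz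
  have hzx₀ : z < x₀ := by
    refine H.lt_of_rpow_neg_lt hx₀ (lt_of_mul_lt_mul_left ?_ hE.le)
    nlinarith [Real.rpow_pos_of_pos hx₀ (-n)]
  have hstart : 0 < H.p k₀ (G x₀) - H.p (-E) x₀ - E * z ^ μ := by
    rw [hGx₀, H.p_shift E k₀]
    nlinarith [H.rpow_mu_lt hz.le hzx₀, Real.rpow_pos_of_pos hx₀ μ]
  have hend : H.p k₀ (G d) - H.p (-E) d - E * z ^ μ < 0 := by rw [hGd]; linarith
  obtain ⟨x, hx, hx0⟩ := intermediate_value_Ioo' hx₀d.le hJc ⟨hend, hstart⟩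
  have hxI : x ∈ Icc x₀ d := ⟨hx.1.le, hx.2.le⟩
  have hGx := hG x hxI
  simp only at hx0
  refine ⟨x, G x, ⟨hx₀.trans hx.1, hGlt x hx.1 hx.2.le, by linarith, by linarith⟩,
    lt_of_le_of_ne hGx.1.2 fun h0 => ?_⟩
  have h1 := hGx.2
  rw [h0, hbz] at h1
  have h2 := (H.q_neg_iff hd hqd (hx₀.trans hx.1)).2 hx.2
  linarith

/-- Every inner solution with g < b lies on the curve of `exists_inner_curve` with x < d. The first
equation is strictly decreasing along it, so its zero is unique and its value at the end (d, b) is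
negative. -/
lemma IsInner.p_lt_and_unique {E k₀ z b d x g : ℝ} (hi : H.IsInner E k₀ z x g) (hgb : g < b)
    (hE : 0 < E) (hk₀ : 0 < k₀) (hd : 0 < d) (hqd : H.q (-E) d = 0) (hz : 0 < z)
    (hb : h b + k₀ < 0) (hbz : H.q k₀ b = E * z ^ (-n)) :
    H.p k₀ b - H.p (-E) d < E * z ^ μ ∧
      ∀ x' g', H.IsInner E k₀ z x' g' → g' < b → x' = x ∧ g' = g := by
  have hdb := IsInner.d_lt H hi hE hk₀ hd hqd hb hgb hbz
  obtain ⟨x₀, G, hx₀, hx₀d, hx₀eq, hGx₀, hGd, hG, hGlt, hJc, hJ⟩ :=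
    H.exists_inner_curve hE hk₀ hd hqd hz hdb hb hbz
  have key : ∀ x' g', H.IsInner E k₀ z x' g' → g' < b → x₀ < x' ∧ x' < d ∧ g' = G x' ∧
      H.p k₀ (G x') - H.p (-E) x' - E * z ^ μ = 0 := by
    intro x' g' hi' hgb'
    have h1 : x₀ < x' := by
      refine H.lt_of_rpow_neg_lt hi'.x_pos
        (lt_of_mul_lt_mul_left ?_ (by linarith : (0 : ℝ) ≤ k₀ + E))
      rw [hx₀eq]
      exact IsInner.mul_lt H hi' hb hgb'.le
    have h2 := IsInner.x_lt_d H hi' hd hqd hb hgb' hbz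
    have hGx := hG x' ⟨h1.le, h2.le⟩
    have h3 : g' = G x' := by
      have h4 : H.q k₀ g' = H.q k₀ (G x') := by linarith [hi'.q_eq, hGx.2]
      rcases lt_trichotomy g' (G x') with h5 | h5 | h5
      · exact absurd h4 (H.q_lt_of_h_neg hb (hi'.x_pos.trans hi'.x_lt) h5 hGx.1.2).ne
      · exact h5
      · exact absurd h4 (H.q_lt_of_h_neg hb (hx₀.trans_le hGx.1.1) h5 hgb'.le).ne'
    exact ⟨h1, h2, h3, by rw [← h3, hi'.p_eq]; ring⟩
  obtain ⟨k1, k2, k3, k4⟩ := key x g hi hgb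
  refine ⟨?_, fun x' g' hi' hgb' => ?_⟩
  · have := hJ x d k1 k2 le_rfl
    rw [hGd] at this
    linarith
  · obtain ⟨l1, l2, l3, l4⟩ := key x' g' hi' hgb'
    have hxx : x' = x := by
      rcases lt_trichotomy x' x with h5 | h5 | h5
      · linarith [hJ x' x l1 h5 k2.le]
      · exact h5
      · linarith [hJ x x' k1 h5 l2.le]
    subst hxx
    exact ⟨rfl, l3.trans k3.symm⟩

end Payoff

/-! ### The full system: uniqueness, necessary bounds on the costs, existence. -/

namespace Payoff

variable {μ n : ℝ} {h : ℝ → ℝ} (H : Payoff μ n h)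
include H

/-- The five free boundary equations. -/
structure IsSystem (E k₀ k₁ z x g b a : ℝ) : Prop where
  z_pos : 0 < z
  inner : H.IsInner E k₀ z x g
  g_lt : g < b
  switch : H.IsSwitch k₀ k₁ b a
  q_b : H.q k₀ b = E * z ^ (-n)

lemma IsSystem.unique {E k₀ k₁ d z x g b a z' x' g' b' a' : ℝ}
    (hs : H.IsSystem E k₀ k₁ z x g b a) (hs' : H.IsSystem E k₀ k₁ z' x' g' b' a')
    (hE : 0 < E) (hk₀ : 0 < k₀) (hk₁ : 0 < k₁) (hd : 0 < d) (hqd : H.q (-E) d = 0) :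
    z' = z ∧ x' = x ∧ g' = g ∧ b' = b ∧ a' = a := by
  have hk : 0 < k₀ + k₁ := add_pos hk₀ hk₁
  obtain ⟨rfl, rfl⟩ := IsSwitch.unique H hs.switch hs'.switch hk
  have hz : z' = z := by
    rw [← negPowRoot_eq H.n_pos hE hs.z_pos hs.q_b.symm,
      ← negPowRoot_eq H.n_pos hE hs'.z_pos hs'.q_b.symm]
  subst hz
  obtain ⟨h1, h2⟩ := (IsInner.p_lt_and_unique H hs.inner hs.g_lt hE hk₀ hd hqd hs.z_pos
    (IsSwitch.h_lt H hs.switch hk) hs.q_b).2 x' g' hs'.inner hs'.g_lt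
  exact ⟨rfl, h1, h2, rfl, rfl⟩

/-- The inner inequality at (d, b) says that the excess at α is negative, whence a < ab. For zb < d,
the contrary would place a point a' in (a, ab] with ζ-value exactly d, and chords along C_{k₀} from
d to b and C_{-k₁} from a to a' would be incompatible. -/
lemma IsSystem.lt_of_isPair {E k₀ k₁ d z x g b a zb ab : ℝ}
    (hs : H.IsSystem E k₀ k₁ z x g b a) (hp : H.IsPair E k₁ d zb ab)
    (hE : 0 < E) (hk₀ : 0 < k₀) (hk₁ : 0 < k₁) (hd : 0 < d) (hqd : H.q (-E) d = 0) :
    d < b ∧ a < ab ∧ zb < d := by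
  have hk : 0 < k₀ + k₁ := add_pos hk₀ hk₁
  have hn := H.n_pos
  have hμ := H.mu_pos
  have hhb := IsSwitch.h_lt H hs.switch hk
  have hdb := IsInner.d_lt H hs.inner hE hk₀ hd hqd hhb hs.g_lt hs.q_b
  have hzx := IsInner.z_lt H hs.inner hE hk₀ hhb hs.g_lt.le
  have hxd := IsInner.x_lt_d H hs.inner hd hqd hhb hs.g_lt hs.q_b
  have hJ := (IsInner.p_lt_and_unique H hs.inner hs.g_lt hE hk₀ hd hqd hs.z_pos hhb hs.q_b).1
  have hqa : H.q (-k₁) a = E * z ^ (-n) := hs.switch.q_eq.symm.trans hs.q_b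
  have hda := hdb.trans hs.switch.b_lt
  have ha := hd.trans hda
  have hreg : E * a ^ (-n) < H.q (-k₁) a := by
    rw [hqa]
    exact mul_lt_mul_of_pos_left (H.rpow_neg_lt hs.z_pos ((hzx.trans hxd).trans hda)) hE
  have hex : H.excess E k₁ d a < 0 := by
    rw [H.excess_eq hE hs.z_pos hqa, ← hs.switch.p_eq]; linarith
  have haab : a < ab := by
    rcases lt_trichotomy a ab with h1 | rfl | h1
    · exact h1
    · rw [H.excess_eq hE hp.z_pos hp.q_eq, hp.p_eq, sub_self] at hex
      exact absurd hex (lt_irrefl _)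
    · linarith [IsPair.excess_pos H hp hE hk₁ hd hqd hreg h1]
  refine ⟨hdb, haab, ?_⟩
  obtain ⟨t, hta, ht⟩ := IsSwitch.exists_lt_h H hs.switch hk
  by_contra hc
  have hdzb := not_lt.1 hc
  have e1 : E * d ^ (-n) < H.q (-k₁) a := by
    rw [hqa]
    exact mul_lt_mul_of_pos_left (H.rpow_neg_lt hs.z_pos (hzx.trans hxd)) hE
  have e2 : H.q (-k₁) ab ≤ E * d ^ (-n) := by
    rw [hp.q_eq]
    exact mul_le_mul_of_nonneg_left (H.rpow_neg_le hd hdzb) hE.le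
  obtain ⟨a', ha', hqa'⟩ := intermediate_value_Icc' haab.le
    (H.continuousOn_q (-k₁) fun s (hs : s ∈ Icc a ab) => ha.trans_le hs.1) ⟨e2, e1.le⟩
  have haa' : a < a' := lt_of_le_of_ne ha'.1 fun h0 => by rw [h0, hqa'] at e1; exact lt_irrefl _ e1
  -- The excess at a' is at most 0, i.e. p_{-k₁}(a') ≤ p_0(d), while q_{-k₁}(a') = q_0(d). Both arcs
  -- below are compared with the slope at b, and passing from C_0(d) to C_{k₀}(d) adds the strictly
  -- positive term s7.
  have hpa' : H.p (-k₁) a' - H.p (-E) d ≤ E * d ^ μ := by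
    rcases ha'.2.eq_or_lt with rfl | h1
    · rw [hp.p_eq]
      have h2 : zb = d := by
        rw [← negPowRoot_eq hn hE hp.z_pos hp.q_eq.symm, negPowRoot_eq hn hE hd hqa'.symm]
      rw [h2]
    · have h2 := IsPair.excess_neg H hp hE hk₁ hd hqd (ha.trans haa') (by
        rw [hqa']
        exact mul_lt_mul_of_pos_left (H.rpow_neg_lt hd (hda.trans haa')) hE) h1
      rw [H.excess_eq hE hd hqa'] at h2
      linarith
  have s1 := H.slope_pos (c := k₀) (T := b) hd hdb fun s hs1 =>
    mul_pos_of_neg_of_neg (sub_neg.2 (H.rpow_N_lt (hd.trans hs1.1).le hs1.2))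
      (by linarith [H.mono' (hd.trans hs1.1) hs1.2.le])
  have s2 := H.slope_pos (c := -k₁) (T := b) ha haa' fun s hs1 =>
    mul_pos (sub_pos.2 (H.rpow_N_lt hs.switch.b_pos.le (hs.switch.b_lt.trans hs1.1)))
      (by linarith [ht s (hta.trans hs1.1)])
  have s3 := H.p_shift E k₀ d
  have s4 := H.q_shift E k₀ d
  have s5 := hs.switch.p_eq
  have s6 := hs.switch.q_eq
  have hb := hs.switch.b_pos
  have s7 : 0 < k₀ * (d ^ μ + μ / n * b ^ (n + μ) * d ^ (-n)) := by positivity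
  rw [← s6, hqa'] at s2
  rw [s4, hqd, s3] at s1
  have s8 : (0 : ℝ) < 0 := by linear_combination s1 + s2 + hpa' + s5 + s7
  exact lt_irrefl _ s8

/-- The cost of switching out is below its critical value. -/
lemma IsSystem.k₀_lt {E k₀ k₁ d z x g b a zb ab y k : ℝ}
    (hs : H.IsSystem E k₀ k₁ z x g b a) (hp : H.IsPair E k₁ d zb ab)
    (hE : 0 < E) (hk₀ : 0 < k₀) (hk₁ : 0 < k₁) (hd : 0 < d) (hqd : H.q (-E) d = 0)
    (hdy : d < y) (hneg : ∀ x, d ≤ x → x < y → H.gap (H.p (-k₁) ab) (H.q (-k₁) ab) x < 0)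
    (hpy : H.p k y = H.p (-k₁) ab) (hqy : H.q k y = H.q (-k₁) ab) : k₀ < k := by
  have hk : 0 < k₀ + k₁ := add_pos hk₀ hk₁
  have hn := H.n_pos
  have hμ := H.mu_pos
  have hb := hs.switch.b_pos
  have hhb := IsSwitch.h_lt H hs.switch hk
  obtain ⟨hdb, haab, -⟩ := IsSystem.lt_of_isPair H hs hp hE hk₀ hk₁ hd hqd
  obtain ⟨t, hta, ht⟩ := IsSwitch.exists_lt_h H hs.switch hk
  have ha := hb.trans hs.switch.b_lt
  have hy := hd.trans hdy
  have hpos : ∀ s ∈ Ioo a ab, 0 < h s + -k₁ := fun s hs1 => by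
    linarith [ht s (hta.trans hs1.1)]
  have p1 := H.p_lt_of_pos ha.le haab hpos
  have q1 := H.q_lt_of_pos ha haab hpos
  -- Both coordinates of C_{k₀}(b) = C_{-k₁}(a) lie on the side of C_{-k₁}(ab) that makes the gap
  -- positive; since the gap is negative on [d, y) and zero at y, this forces y < b.
  have hgb : 0 < H.gap (H.p (-k₁) ab) (H.q (-k₁) ab) b := by
    rw [H.gap_eq k₀ _ _ hb, hs.switch.p_eq, hs.switch.q_eq]
    have := Real.rpow_pos_of_pos hb (n + μ)
    nlinarith
  have hgy : H.gap (H.p (-k₁) ab) (H.q (-k₁) ab) y = 0 := H.gap_eq_zero hy hpy hqy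
  have hyb : y < b := by
    rcases lt_trichotomy y b with h1 | rfl | h1
    · exact h1
    · linarith
    · linarith [hneg b hdb.le h1]
  -- The path along C_{k₀} from y to b and then along C_{-k₁} from a to ab ends at C_k(y). Both arcs
  -- are favourable relative to the slope at b, so the total displacement (k - k₀)(y^μ, y^{-n}) has
  -- k > k₀.
  have s1 := H.slope_pos (c := k₀) (T := b) hy hyb fun s hs1 =>
    mul_pos_of_neg_of_neg (sub_neg.2 (H.rpow_N_lt (hy.trans hs1.1).le hs1.2))
      (by linarith [H.mono' (hy.trans hs1.1) hs1.2.le])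
  have s2 := H.slope_pos (c := -k₁) (T := b) ha haab fun s hs1 =>
    mul_pos (sub_pos.2 (H.rpow_N_lt hb.le (hs.switch.b_lt.trans hs1.1))) (hpos s hs1)
  have s3 := H.p_eq k k₀ y
  have s4 := H.q_eq k k₀ y
  rw [hpy] at s3
  rw [hqy] at s4
  rw [← hs.switch.q_eq, ← hs.switch.p_eq, s3, s4] at s2
  have s5 : 0 < (k - k₀) * (y ^ μ + μ / n * b ^ (n + μ) * y ^ (-n)) := by
    linear_combination s1 + s2
  exact sub_pos.1 (pos_of_mul_pos_left s5 (by positivity))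

/-- Existence of a solution of the system if the cost of switching out is below its critical
value. -/
lemma exists_isSystem {E k₀ k₁ d zb ab y k : ℝ} (hp : H.IsPair E k₁ d zb ab)
    (hE : 0 < E) (hk₀ : 0 < k₀) (hk₁ : 0 < k₁) (hd : 0 < d) (hqd : H.q (-E) d = 0)
    (hdy : d < y) (hle : ∀ s, 0 < s → s < y → h s + k ≤ 0)
    (hpy : H.p k y = H.p (-k₁) ab) (hqy : H.q k y = H.q (-k₁) ab) (hk : k₀ < k) :
    ∃ z x g b a, H.IsSystem E k₀ k₁ z x g b a := by
  have hn := H.n_pos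
  obtain ⟨b, a, hsw, hyb, haab⟩ := H.exists_isSwitch hk₀ hk₁ hk (hd.trans hdy)
    (hd.trans hp.d_lt) hpy hqy hle (IsPair.lt_h H hp hE hk₁ hd hqd le_rfl)
  have hhb := IsSwitch.h_lt H hsw (add_pos hk₀ hk₁)
  have hdb := hdy.trans hyb
  have hdn := Real.rpow_pos_of_pos hd (-n)
  have hqb : (k₀ + E) * d ^ (-n) < H.q k₀ b := by
    have h1 := H.q_lt_of_h_neg hhb hd hdb le_rfl
    have h2 := H.q_shift E k₀ d
    linarith
  have hqb0 : 0 < H.q k₀ b := lt_trans (by positivity) hqb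
  have hz := negPowRoot_pos (n := n) hE hqb0
  have hzq := mul_negPowRoot hn hE hqb0
  have hda := hdb.trans hsw.b_lt
  -- Since a < ab, the excess at a is negative; rewritten at b it is the criterion of
  -- `exists_isInner`.
  have hex := IsPair.excess_neg H hp hE hk₁ hd hqd (hd.trans hda) (by
    rw [← hsw.q_eq]
    have := H.rpow_neg_lt hd hda
    nlinarith) haab
  rw [H.excess_eq hE hz (hsw.q_eq.symm.trans hzq.symm), ← hsw.p_eq] at hex
  obtain ⟨x, g, hi, hgb⟩ := H.exists_isInner hE hk₀ hd hqd hz hdb hhb hzq.symm (by linarith)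
  exact ⟨_, x, g, b, a, hz, hi, hgb, hsw, hzq.symm⟩

end Payoff

/-! ### Regularity of the solutions of the inhomogeneous Euler equation. -/

namespace Payoff

variable {μ n : ℝ} {h : ℝ → ℝ} (H : Payoff μ n h)

/-- A solution of the inhomogeneous Euler equation with right-hand side `ε h + c`, up to scaling. -/
noncomputable def piece (ε a b c x : ℝ) : ℝ :=
  (ε * H.p 0 x + a + c * x ^ μ) * x ^ (-μ) / μ + (ε * H.q 0 x + b + c * x ^ (-n)) * x ^ n / n

/-- The derivative of `H.piece ε a b c`. -/
noncomputable def pieceDeriv (ε a b x : ℝ) : ℝ :=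
  x ^ (-μ - 1) * (ε * H.V x + b * x ^ (n + μ) - a)

include H

/-- Truncation at x/2 extends h monotonically to the whole line, where left limits exist. -/
lemma exists_tendsto_left {x : ℝ} (hx : 0 < x) : ∃ l, Tendsto h (𝓝[<] x) (𝓝 l) := by
  set g : ℝ → ℝ := fun s => h (max s (x / 2)) with hg
  have hm : Monotone g := fun s t hst =>
    H.mono' (lt_max_of_lt_right (half_pos hx)) (max_le_max_right _ hst)
  refine ⟨_, (hm.tendsto_nhdsLT x).congr' ?_⟩
  filter_upwards [Ioo_mem_nhdsLT (half_lt_self hx)] with s hs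
  simp only [hg, max_eq_left hs.1.le]

/-- The `FTCFilter` formulation covers left, right and two-sided derivatives at once. The limit l is
that of h along the filter modulo null sets, so that at a jump the value at x itself is ignored. -/
lemma hasDerivWithinAt_p {x l : ℝ} {s t : Set ℝ} [intervalIntegral.FTCFilter x (𝓝[s] x) (𝓝[t] x)]
    (hx : 0 < x) (hl : Tendsto h (𝓝[t] x ⊓ ae volume) (𝓝 l)) :
    HasDerivWithinAt (H.p 0) (μ * x ^ (μ - 1) * l) s x := by
  have h1 : Tendsto (fun s => μ * s ^ (μ - 1) * (h s + 0)) (𝓝[t] x ⊓ ae volume)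
      (𝓝 (μ * x ^ (μ - 1) * (l + 0))) := by
    have h2 : Tendsto (fun s : ℝ => s ^ (μ - 1)) (𝓝[t] x ⊓ ae volume) (𝓝 (x ^ (μ - 1))) :=
      (Real.continuousAt_rpow_const x _ (Or.inl hx.ne')).tendsto.mono_left
        (inf_le_left.trans nhdsWithin_le_nhds)
    exact (h2.const_mul μ).mul (hl.add_const 0)
  have hmeas : StronglyMeasurableAtFilter (fun s => μ * s ^ (μ - 1) * (h s + 0)) (𝓝[t] x) volume := by
    refine ⟨Ioc (x / 2) (2 * x), ?_, ?_⟩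
    · exact mem_nhdsWithin_of_mem_nhds
        (mem_of_superset (Ioo_mem_nhds (by linarith) (by linarith)) Ioo_subset_Ioc_self)
    · exact (H.p_integrand_integrable 0 (by linarith : 0 ≤ x / 2)
        (by linarith : 0 ≤ 2 * x)).1.aestronglyMeasurable
  have h3 := (intervalIntegral.integral_hasDerivWithinAt_of_tendsto_ae_right
    (a := x) (b := x) (s := s) (t := t) IntervalIntegrable.refl hmeas h1).const_add (H.p 0 x)
  rw [add_zero] at h3
  refine (h3.mono_of_mem_nhdsWithin (self_mem_nhdsWithin)).congr_of_eventuallyEq ?_ ?_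
  · filter_upwards [nhdsWithin_le_nhds (Ioi_mem_nhds hx)] with y hy
    rw [← H.p_sub 0 hx.le (le_of_lt hy)]; ring
  · simp

lemma hasDerivWithinAt_q {x l : ℝ} {s t : Set ℝ} [intervalIntegral.FTCFilter x (𝓝[s] x) (𝓝[t] x)]
    (hx : 0 < x) (hl : Tendsto h (𝓝[t] x ⊓ ae volume) (𝓝 l)) :
    HasDerivWithinAt (H.q 0) (-(n * x ^ (-n - 1) * l)) s x := by
  have h1 : Tendsto (fun s => n * s ^ (-n - 1) * (h s + 0)) (𝓝[t] x ⊓ ae volume)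
      (𝓝 (n * x ^ (-n - 1) * (l + 0))) := by
    have h2 : Tendsto (fun s : ℝ => s ^ (-n - 1)) (𝓝[t] x ⊓ ae volume) (𝓝 (x ^ (-n - 1))) :=
      (Real.continuousAt_rpow_const x _ (Or.inl hx.ne')).tendsto.mono_left
        (inf_le_left.trans nhdsWithin_le_nhds)
    exact (h2.const_mul n).mul (hl.add_const 0)
  have hmeas : StronglyMeasurableAtFilter (fun s => n * s ^ (-n - 1) * (h s + 0)) (𝓝[t] x) volume := by
    refine ⟨Ioc (x / 2) (2 * x), ?_, ?_⟩
    · exact mem_nhdsWithin_of_mem_nhds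
        (mem_of_superset (Ioo_mem_nhds (by linarith) (by linarith)) Ioo_subset_Ioc_self)
    · exact (H.q_integrand_integrable 0 (by linarith : 0 < x / 2)
        (by linarith : 0 < 2 * x)).1.aestronglyMeasurable
  have h3 := (intervalIntegral.integral_hasDerivWithinAt_of_tendsto_ae_right
    (a := x) (b := x) (s := s) (t := t) IntervalIntegrable.refl hmeas h1).const_sub (H.q 0 x)
  rw [add_zero] at h3
  refine (h3.mono_of_mem_nhdsWithin (self_mem_nhdsWithin)).congr_of_eventuallyEq ?_ ?_
  · filter_upwards [nhdsWithin_le_nhds (Ioi_mem_nhds hx)] with y hy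
    rw [← H.q_sub 0 hx hy]; ring
  · simp

/-- The constant c drops out of the derivative because x^{n+μ} x^{-n} = x^μ; it is inserted to
express the derivative through the two brackets of `piece`. -/
lemma pieceDeriv_eq (ε a b c : ℝ) {x : ℝ} (hx : 0 < x) :
    H.pieceDeriv ε a b x = x ^ (-μ - 1) *
      (x ^ (n + μ) * (ε * H.q 0 x + b + c * x ^ (-n)) - (ε * H.p 0 x + a + c * x ^ μ)) := by
  rw [pieceDeriv, V, ← rpow_N_mul (n := n) (μ := μ) hx]
  ring

lemma hasDerivWithinAt_piece (ε a b c : ℝ) {x l : ℝ} {s : Set ℝ} (hx : 0 < x)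
    (hp : HasDerivWithinAt (H.p 0) (μ * x ^ (μ - 1) * l) s x)
    (hq : HasDerivWithinAt (H.q 0) (-(n * x ^ (-n - 1) * l)) s x) :
    HasDerivWithinAt (H.piece ε a b c) (H.pieceDeriv ε a b x) s x := by
  have hμ := H.mu_pos
  have hn := H.n_pos
  have r : ∀ e : ℝ, HasDerivWithinAt (fun y : ℝ => y ^ e) (e * x ^ (e - 1)) s x := fun e =>
    (Real.hasDerivAt_rpow_const (Or.inl hx.ne')).hasDerivWithinAt
  have h1 := ((((hp.const_mul ε).add_const a).add ((r μ).const_mul c)).mul (r (-μ))).div_const μ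
  have h2 := ((((hq.const_mul ε).add_const b).add ((r (-n)).const_mul c)).mul (r n)).div_const n
  refine (h1.add h2).congr_deriv ?_
  rw [H.pieceDeriv_eq ε a b c hx]
  simp only [Real.rpow_sub_one hx.ne', Real.rpow_neg hx.le, Real.rpow_add hx, Pi.add_apply]
  have hA : x ^ μ ≠ 0 := (Real.rpow_pos_of_pos hx _).ne'
  have hB : x ^ n ≠ 0 := (Real.rpow_pos_of_pos hx _).ne'
  field_simp
  ring

/-- The one-sided derivatives of p and q involve the one-sided limits of h, but these contributions
cancel in the derivative of `piece`. Hence pieces are differentiable even at jumps of h. -/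
lemma hasDerivAt_piece (ε a b c : ℝ) {x : ℝ} (hx : 0 < x) :
    HasDerivAt (H.piece ε a b c) (H.pieceDeriv ε a b x) x := by
  obtain ⟨l, hl⟩ := H.exists_tendsto_left hx
  have hne : ({x}ᶜ : Set ℝ) ∈ ae (volume : Measure ℝ) := by
    simp [mem_ae_iff]
  have hle : 𝓝[≤] x ⊓ ae volume ≤ 𝓝[<] x := by
    have e : Iio x = Iic x ∩ {x}ᶜ := by ext y; simp [lt_iff_le_and_ne]
    rw [e, nhdsWithin_inter']
    exact inf_le_inf_left _ (le_principal_iff.2 hne)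
  have hl' : Tendsto h (𝓝[≤] x ⊓ ae volume) (𝓝 l) := hl.mono_left hle
  have hr' : Tendsto h (𝓝[>] x ⊓ ae volume) (𝓝 (h x)) :=
    (H.right_cont x hx).tendsto.mono_left
      (inf_le_left.trans (nhdsWithin_mono _ Ioi_subset_Ici_self))
  have d1 := H.hasDerivWithinAt_piece ε a b c hx
    (H.hasDerivWithinAt_p (s := Iic x) hx hl') (H.hasDerivWithinAt_q (s := Iic x) hx hl')
  have d2 := H.hasDerivWithinAt_piece ε a b c hx
    (H.hasDerivWithinAt_p (s := Ici x) hx hr') (H.hasDerivWithinAt_q (s := Ici x) hx hr')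
  have d3 := d1.union d2
  rwa [Iic_union_Ici, hasDerivWithinAt_univ] at d3

lemma continuousOn_V : ContinuousOn H.V (Ioi 0) := by
  have h1 : ContinuousOn (fun x : ℝ => x ^ (n + μ)) (Ioi 0) := fun x hx =>
    (Real.continuousAt_rpow_const x _ (Or.inl (ne_of_gt hx))).continuousWithinAt
  exact (h1.mul (H.continuousOn_q 0 fun x hx => hx)).sub (H.continuousOn_p 0 fun x hx => hx)

lemma continuousOn_pieceDeriv (ε a b : ℝ) : ContinuousOn (H.pieceDeriv ε a b) (Ioi 0) := by
  have r : ∀ e : ℝ, ContinuousOn (fun x : ℝ => x ^ e) (Ioi 0) := fun e x hx =>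
    (Real.continuousAt_rpow_const x _ (Or.inl (ne_of_gt hx))).continuousWithinAt
  exact (r _).mul (((continuousOn_const.mul H.continuousOn_V).add
    (continuousOn_const.mul (r _))).sub continuousOn_const)

/-- At the continuity points of `h` the pieces solve the Euler equation. -/
lemma exists_hasDerivAt_pieceDeriv (ε a b c : ℝ) {x : ℝ} (hx : 0 < x) (hc : ContinuousAt h x) :
    ∃ D, HasDerivAt (H.pieceDeriv ε a b) D x ∧
      x ^ 2 * D + (1 + μ - n) * x * H.pieceDeriv ε a b x - μ * n * H.piece ε a b c x =
        -((n + μ) * (ε * h x + c)) := by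
  have hμ := H.mu_pos
  have hn := H.n_pos
  have hl : Tendsto h (𝓝[univ] x ⊓ ae volume) (𝓝 (h x)) :=
    hc.tendsto.mono_left (inf_le_left.trans nhdsWithin_le_nhds)
  have hl' : Tendsto h (𝓝 x ⊓ ae volume) (𝓝 (h x)) := hc.tendsto.mono_left inf_le_left
  -- The two-sided case, with `univ` in place of a half-line.
  have : intervalIntegral.FTCFilter x (𝓝[univ] x) (𝓝[univ] x) := by
    rw [nhdsWithin_univ]; infer_instance
  have hp := hasDerivWithinAt_univ.1 (H.hasDerivWithinAt_p (s := univ) (t := univ) hx hl)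
  have hq := hasDerivWithinAt_univ.1 (H.hasDerivWithinAt_q (s := univ) (t := univ) hx hl)
  have r : ∀ e : ℝ, HasDerivAt (fun y : ℝ => y ^ e) (e * x ^ (e - 1)) x := fun e =>
    Real.hasDerivAt_rpow_const (Or.inl hx.ne')
  have hV : HasDerivAt H.V ((n + μ) * x ^ (n + μ - 1) * H.q 0 x +
      x ^ (n + μ) * -(n * x ^ (-n - 1) * h x) - μ * x ^ (μ - 1) * h x) x :=
    ((r (n + μ)).mul hq).sub hp
  refine ⟨_, (r (-μ - 1)).mul (((hV.const_mul ε).add ((r (n + μ)).const_mul b)).sub_const a), ?_⟩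
  rw [pieceDeriv, piece, V]
  simp only [Real.rpow_sub_one hx.ne', Real.rpow_neg hx.le, Real.rpow_add hx]
  have hA : x ^ μ ≠ 0 := (Real.rpow_pos_of_pos hx _).ne'
  have hB : x ^ n ≠ 0 := (Real.rpow_pos_of_pos hx _).ne'
  field_simp
  ring

end Payoff

/-! ### Gluing continuously differentiable functions. -/

/-- The function equal to `f` on `(-∞, a]` and to `g` on `(a, ∞)`. -/
noncomputable def glue (a : ℝ) (f g : ℝ → ℝ) (x : ℝ) : ℝ := if x ≤ a then f x else g x

lemma glue_of_le {a x : ℝ} (f g : ℝ → ℝ) (hx : x ≤ a) : glue a f g x = f x := if_pos hx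

lemma glue_of_lt {a x : ℝ} (f g : ℝ → ℝ) (hx : a < x) : glue a f g x = g x := if_neg (not_le.2 hx)

lemma glue_of_ge {a x : ℝ} {f g : ℝ → ℝ} (hfg : f a = g a) (hx : a ≤ x) : glue a f g x = g x := by
  rcases hx.eq_or_lt with rfl | hx
  · rw [glue_of_le _ _ le_rfl, hfg]
  · exact glue_of_lt _ _ hx

lemma glue_eventuallyEq_left {a x : ℝ} (f g : ℝ → ℝ) (hx : x < a) : glue a f g =ᶠ[𝓝 x] f := by
  filter_upwards [Iio_mem_nhds hx] with y hy using glue_of_le f g (le_of_lt hy)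

lemma glue_eventuallyEq_right {a x : ℝ} (f g : ℝ → ℝ) (hx : a < x) : glue a f g =ᶠ[𝓝 x] g := by
  filter_upwards [Ioi_mem_nhds hx] with y hy using glue_of_lt f g hy

/-- `f` is continuously differentiable on `(0, ∞)` with derivative `f'`. -/
def IsC1 (f f' : ℝ → ℝ) : Prop := (∀ x, 0 < x → HasDerivAt f (f' x) x) ∧ ContinuousOn f' (Ioi 0)

lemma IsC1.glue {f f' g g' : ℝ → ℝ} {a : ℝ} (hf : IsC1 f f') (hg : IsC1 g g')
    (h0 : f a = g a) (h1 : f' a = g' a) : IsC1 (glue a f g) (glue a f' g') := by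
  refine ⟨fun x hx => ?_, ?_⟩
  · rcases lt_trichotomy x a with hxa | rfl | hxa
    · rw [glue_of_le _ _ hxa.le]
      exact (hf.1 x hx).congr_of_eventuallyEq (glue_eventuallyEq_left f g hxa)
    · have l : HasDerivWithinAt (_root_.glue x f g) (_root_.glue x f' g' x) (Iic x) x := by
        rw [glue_of_le _ _ le_rfl]
        exact (hf.1 x hx).hasDerivWithinAt.congr (fun y hy => glue_of_le f g hy)
          (glue_of_le f g le_rfl)
      have r : HasDerivWithinAt (_root_.glue x f g) (_root_.glue x f' g' x) (Ici x) x := by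
        rw [glue_of_ge h1 le_rfl]
        exact (hg.1 x hx).hasDerivWithinAt.congr (fun y hy => glue_of_ge h0 hy)
          (glue_of_ge h0 le_rfl)
      have := l.union r
      rwa [Iic_union_Ici, hasDerivWithinAt_univ] at this
    · rw [glue_of_lt _ _ hxa]
      exact (hg.1 x hx).congr_of_eventuallyEq (glue_eventuallyEq_right f g hxa)
  · intro x hx
    have cf : ContinuousAt f' x := hf.2.continuousAt (Ioi_mem_nhds hx)
    have cg : ContinuousAt g' x := hg.2.continuousAt (Ioi_mem_nhds hx)
    refine ContinuousAt.continuousWithinAt ?_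
    rcases lt_trichotomy x a with hxa | rfl | hxa
    · exact cf.congr (glue_eventuallyEq_left f' g' hxa).symm
    · have l : ContinuousWithinAt (_root_.glue x f' g') (Iic x) x :=
        cf.continuousWithinAt.congr (fun y hy => glue_of_le f' g' hy) (glue_of_le f' g' le_rfl)
      have r : ContinuousWithinAt (_root_.glue x f' g') (Ici x) x :=
        cg.continuousWithinAt.congr (fun y hy => glue_of_ge h1 hy) (glue_of_ge h1 le_rfl)
      have := l.union r
      rwa [Iic_union_Ici, continuousWithinAt_univ] at this
    · exact cg.congr (glue_eventuallyEq_right f' g' hxa).symm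

lemma IsC1.sub {f f' g g' : ℝ → ℝ} (hf : IsC1 f f') (hg : IsC1 g g') :
    IsC1 (fun x => f x - g x) (fun x => f' x - g' x) :=
  ⟨fun x hx => (hf.1 x hx).sub (hg.1 x hx), hf.2.sub hg.2⟩

lemma IsC1.monotoneOn {f f' : ℝ → ℝ} (hf : IsC1 f f') {D : Set ℝ} (hD : Convex ℝ D)
    (hD0 : ∀ x ∈ D, 0 < x) (h : ∀ x ∈ D, 0 ≤ f' x) : MonotoneOn f D :=
  monotoneOn_of_deriv_nonneg hD
    (fun x hx => (hf.1 x (hD0 x hx)).continuousAt.continuousWithinAt)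
    (fun x hx => (hf.1 x (hD0 x (interior_subset hx))).differentiableAt.differentiableWithinAt)
    fun x hx => by
      rw [(hf.1 x (hD0 x (interior_subset hx))).deriv]; exact h x (interior_subset hx)

lemma IsC1.antitoneOn {f f' : ℝ → ℝ} (hf : IsC1 f f') {D : Set ℝ} (hD : Convex ℝ D)
    (hD0 : ∀ x ∈ D, 0 < x) (h : ∀ x ∈ D, f' x ≤ 0) : AntitoneOn f D :=
  antitoneOn_of_deriv_nonpos hD
    (fun x hx => (hf.1 x (hD0 x hx)).continuousAt.continuousWithinAt)
    (fun x hx => (hf.1 x (hD0 x (interior_subset hx))).differentiableAt.differentiableWithinAt)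
    fun x hx => by
      rw [(hf.1 x (hD0 x (interior_subset hx))).deriv]; exact h x (interior_subset hx)

/-! ### The candidate functions: smooth fit, monotonicity and variational inequalities. -/

namespace Payoff

variable {μ n : ℝ} {h : ℝ → ℝ} (H : Payoff μ n h)

/-- `f` with derivative `f'` solves the Euler equation with right-hand side `ε h + c` at `x`. -/
def Euler (_ : Payoff μ n h) (ε c : ℝ) (f f' : ℝ → ℝ) (x : ℝ) : Prop :=
  ∃ D, HasDerivAt f' D x ∧
    x ^ 2 * D + (1 + μ - n) * x * f' x - μ * n * f x = -((n + μ) * (ε * h x + c))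

/-- The scaled candidate for the value function of the open mode. -/
noncomputable def W₁ (E k₀ ζ δ γ β : ℝ) : ℝ → ℝ :=
  glue δ (H.piece 0 0 0 E) (glue γ (H.piece 1 (-H.p (-E) δ) (-H.q (-E) δ) 0)
    (glue β (H.piece 0 (E * ζ ^ μ) (E * ζ ^ (-n)) (-k₀)) (H.piece 1 (E * ζ ^ μ - H.p k₀ β) 0 0)))

/-- The derivative of `H.W₁`. -/
noncomputable def dW₁ (E k₀ ζ δ γ β : ℝ) : ℝ → ℝ :=
  glue δ (H.pieceDeriv 0 0 0) (glue γ (H.pieceDeriv 1 (-H.p (-E) δ) (-H.q (-E) δ))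
    (glue β (H.pieceDeriv 0 (E * ζ ^ μ) (E * ζ ^ (-n))) (H.pieceDeriv 1 (E * ζ ^ μ - H.p k₀ β) 0)))

/-- The scaled candidate for the value function of the closed mode. -/
noncomputable def W₀ (E k₀ k₁ ζ β α : ℝ) : ℝ → ℝ :=
  glue ζ (H.piece 0 0 0 E) (glue α (H.piece 0 (E * ζ ^ μ) (E * ζ ^ (-n)) 0)
    (H.piece 1 (E * ζ ^ μ - H.p k₀ β) 0 (-k₁)))

/-- The derivative of `H.W₀`. -/
noncomputable def dW₀ (E k₀ ζ β α : ℝ) : ℝ → ℝ :=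
  glue ζ (H.pieceDeriv 0 0 0) (glue α (H.pieceDeriv 0 (E * ζ ^ μ) (E * ζ ^ (-n)))
    (H.pieceDeriv 1 (E * ζ ^ μ - H.p k₀ β) 0))

lemma Euler.glue_left {ε c a x : ℝ} {f f' g g' : ℝ → ℝ} (hf : H.Euler ε c f f' x) (hx : x < a) :
    H.Euler ε c (glue a f g) (glue a f' g') x := by
  obtain ⟨D, h1, h2⟩ := hf
  exact ⟨D, h1.congr_of_eventuallyEq (glue_eventuallyEq_left _ _ hx), by
    rwa [glue_of_le _ _ hx.le, glue_of_le _ _ hx.le]⟩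

lemma Euler.glue_right {ε c a x : ℝ} {f f' g g' : ℝ → ℝ} (hf : H.Euler ε c g g' x) (hx : a < x) :
    H.Euler ε c (glue a f g) (glue a f' g') x := by
  obtain ⟨D, h1, h2⟩ := hf
  exact ⟨D, h1.congr_of_eventuallyEq (glue_eventuallyEq_right _ _ hx), by
    rwa [glue_of_lt _ _ hx, glue_of_lt _ _ hx]⟩

include H

lemma isC1_piece (ε a b c : ℝ) : IsC1 (H.piece ε a b c) (H.pieceDeriv ε a b) :=
  ⟨fun _ hx => H.hasDerivAt_piece ε a b c hx, H.continuousOn_pieceDeriv ε a b⟩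

/-- At a point x, a piece and its derivative depend only on two brackets. Equality of both brackets
is therefore the smooth fit condition; see also `pieceDeriv_congr`. -/
lemma piece_congr {ε a b c ε' a' b' c' x : ℝ}
    (hp : ε * H.p 0 x + a + c * x ^ μ = ε' * H.p 0 x + a' + c' * x ^ μ)
    (hq : ε * H.q 0 x + b + c * x ^ (-n) = ε' * H.q 0 x + b' + c' * x ^ (-n)) :
    H.piece ε a b c x = H.piece ε' a' b' c' x := by
  rw [piece, piece, hp, hq]

lemma pieceDeriv_congr {ε a b c ε' a' b' c' x : ℝ} (hx : 0 < x)
    (hp : ε * H.p 0 x + a + c * x ^ μ = ε' * H.p 0 x + a' + c' * x ^ μ)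
    (hq : ε * H.q 0 x + b + c * x ^ (-n) = ε' * H.q 0 x + b' + c' * x ^ (-n)) :
    H.pieceDeriv ε a b x = H.pieceDeriv ε' a' b' x := by
  rw [H.pieceDeriv_eq ε a b c hx, H.pieceDeriv_eq ε' a' b' c' hx, hp, hq]

/-- The parameter c contributes a constant function, and c (1/μ + 1/n) is the scaled form of the
cost c. -/
lemma piece_const (ε a b c c' : ℝ) {x : ℝ} (hx : 0 < x) :
    H.piece ε a b c x = H.piece ε a b c' x + (c - c') * (1 / μ + 1 / n) := by
  have hA : x ^ μ ≠ 0 := (Real.rpow_pos_of_pos hx _).ne'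
  have hB : x ^ n ≠ 0 := (Real.rpow_pos_of_pos hx _).ne'
  have hμ := H.mu_pos.ne'
  have hn := H.n_pos.ne'
  simp only [piece, Real.rpow_neg hx.le]
  field_simp
  ring

lemma piece_zero (c : ℝ) {x : ℝ} (hx : 0 < x) : H.piece 0 0 0 c x = c * (1 / μ + 1 / n) := by
  rw [H.piece_const 0 0 0 c 0 hx]; simp [piece]

lemma pieceDeriv_zero (x : ℝ) : H.pieceDeriv 0 0 0 x = 0 := by simp [pieceDeriv]

/-- Links the derivative of W₀ - W₁ to the concave gap, whose sign is known. -/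
lemma pieceDeriv_sub (a b a' b' x : ℝ) :
    H.pieceDeriv 0 a b x - H.pieceDeriv 1 a' b' x =
      -(x ^ (-μ - 1) * H.gap (a - a') (b - b') x) := by
  rw [pieceDeriv, pieceDeriv, gap]; ring

section system

variable {E k₀ k₁ d ζ δ γ β α : ℝ} (hs : H.IsSystem E k₀ k₁ ζ δ γ β α)
include hs

lemma IsSystem.match_γ : H.p 0 γ + k₀ * γ ^ μ = E * ζ ^ μ + H.p (-E) δ ∧
    H.q 0 γ + k₀ * γ ^ (-n) = E * ζ ^ (-n) + H.q (-E) δ := by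
  have h1 := hs.inner.p_eq
  have h2 := hs.inner.q_eq
  rw [H.p_eq k₀ 0] at h1
  rw [H.q_eq k₀ 0] at h2
  constructor <;> linarith

lemma IsSystem.match_α : H.p 0 α - k₁ * α ^ μ = H.p k₀ β ∧
    H.q 0 α - k₁ * α ^ (-n) = E * ζ ^ (-n) := by
  have h1 := hs.switch.p_eq
  have h2 := hs.switch.q_eq
  have h3 := hs.q_b
  rw [H.p_eq (-k₁) 0] at h1
  rw [H.q_eq (-k₁) 0] at h2
  constructor <;> linarith

/-- The free boundary equations as smooth fit conditions, listed at δ, γ, β for the open mode and at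
ζ, α for the closed mode. -/
lemma IsSystem.pieces_match :
    (0 * H.p 0 δ + 0 + E * δ ^ μ = 1 * H.p 0 δ + -H.p (-E) δ + 0 * δ ^ μ ∧
      0 * H.q 0 δ + 0 + E * δ ^ (-n) = 1 * H.q 0 δ + -H.q (-E) δ + 0 * δ ^ (-n)) ∧
    (1 * H.p 0 γ + -H.p (-E) δ + 0 * γ ^ μ = 0 * H.p 0 γ + E * ζ ^ μ + -k₀ * γ ^ μ ∧
      1 * H.q 0 γ + -H.q (-E) δ + 0 * γ ^ (-n) =
        0 * H.q 0 γ + E * ζ ^ (-n) + -k₀ * γ ^ (-n)) ∧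
    (0 * H.p 0 β + E * ζ ^ μ + -k₀ * β ^ μ =
        1 * H.p 0 β + (E * ζ ^ μ - H.p k₀ β) + 0 * β ^ μ ∧
      0 * H.q 0 β + E * ζ ^ (-n) + -k₀ * β ^ (-n) = 1 * H.q 0 β + 0 + 0 * β ^ (-n)) ∧
    (0 * H.p 0 ζ + 0 + E * ζ ^ μ = 0 * H.p 0 ζ + E * ζ ^ μ + 0 * ζ ^ μ ∧
      0 * H.q 0 ζ + 0 + E * ζ ^ (-n) = 0 * H.q 0 ζ + E * ζ ^ (-n) + 0 * ζ ^ (-n)) ∧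
    (0 * H.p 0 α + E * ζ ^ μ + 0 * α ^ μ =
        1 * H.p 0 α + (E * ζ ^ μ - H.p k₀ β) + -k₁ * α ^ μ ∧
      0 * H.q 0 α + E * ζ ^ (-n) + 0 * α ^ (-n) = 1 * H.q 0 α + 0 + -k₁ * α ^ (-n)) := by
  have g := IsSystem.match_γ H hs
  have a := IsSystem.match_α H hs
  have p1 := H.p_eq (-E) 0 δ
  have q1 := H.q_eq (-E) 0 δ
  have p2 := H.p_eq k₀ 0 β
  have q2 := H.q_eq k₀ 0 β
  have q3 := hs.q_b
  refine ⟨⟨?_, ?_⟩, ⟨?_, ?_⟩, ⟨?_, ?_⟩, ⟨?_, ?_⟩, ⟨?_, ?_⟩⟩ <;> linarith [g.1, g.2, a.1, a.2]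

end system

end Payoff

namespace Payoff

variable {μ n : ℝ} {h : ℝ → ℝ} (H : Payoff μ n h)
variable {E k₀ k₁ d ζ δ γ β α : ℝ}
include H

section C1

variable (hs : H.IsSystem E k₀ k₁ ζ δ γ β α)
include hs

lemma IsSystem.pos : 0 < δ ∧ 0 < γ ∧ 0 < β ∧ 0 < α := by
  have h1 := hs.inner.x_pos
  have h2 := h1.trans hs.inner.x_lt
  have h3 := h2.trans hs.g_lt
  exact ⟨h1, h2, h3, h3.trans hs.switch.b_lt⟩

lemma IsSystem.isC1_W₁ : IsC1 (H.W₁ E k₀ ζ δ γ β) (H.dW₁ E k₀ ζ δ γ β) := by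
  obtain ⟨hδ, hγ, hβ, hα⟩ := IsSystem.pos H hs
  obtain ⟨m1, m2, m3, m4, m5⟩ := IsSystem.pieces_match H hs
  have hδγ := hs.inner.x_lt
  have hγβ := hs.g_lt
  refine (H.isC1_piece _ _ _ _).glue (((H.isC1_piece _ _ _ _)).glue
    ((H.isC1_piece _ _ _ _).glue (H.isC1_piece _ _ _ _)
      (H.piece_congr m3.1 m3.2) (H.pieceDeriv_congr hβ m3.1 m3.2)) ?_ ?_) ?_ ?_
  · rw [glue_of_le _ _ hγβ.le]; exact H.piece_congr m2.1 m2.2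
  · rw [glue_of_le _ _ hγβ.le]; exact H.pieceDeriv_congr hγ m2.1 m2.2
  · rw [glue_of_le _ _ hδγ.le]; exact H.piece_congr m1.1 m1.2
  · rw [glue_of_le _ _ hδγ.le]; exact H.pieceDeriv_congr hδ m1.1 m1.2

lemma IsSystem.isC1_W₀ (hζα : ζ < α) : IsC1 (H.W₀ E k₀ k₁ ζ β α) (H.dW₀ E k₀ ζ β α) := by
  obtain ⟨hδ, hγ, hβ, hα⟩ := IsSystem.pos H hs
  obtain ⟨m1, m2, m3, m4, m5⟩ := IsSystem.pieces_match H hs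
  refine (H.isC1_piece _ _ _ _).glue ((H.isC1_piece _ _ _ _).glue (H.isC1_piece _ _ _ _)
      (H.piece_congr m5.1 m5.2) (H.pieceDeriv_congr hα m5.1 m5.2)) ?_ ?_
  · rw [glue_of_le _ _ hζα.le]; exact H.piece_congr m4.1 m4.2
  · rw [glue_of_le _ _ hζα.le]; exact H.pieceDeriv_congr hs.z_pos m4.1 m4.2

end C1

section regions

variable {x : ℝ}

lemma W₁_left (hx : x ≤ δ) : H.W₁ E k₀ ζ δ γ β x = H.piece 0 0 0 E x := glue_of_le _ _ hx

lemma W₁_inner (h1 : δ < x) (h2 : x ≤ γ) :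
    H.W₁ E k₀ ζ δ γ β x = H.piece 1 (-H.p (-E) δ) (-H.q (-E) δ) 0 x :=
  (glue_of_lt _ _ h1).trans (glue_of_le _ _ h2)

lemma W₁_middle (h0 : δ < γ) (h1 : γ < x) (h2 : x ≤ β) :
    H.W₁ E k₀ ζ δ γ β x = H.piece 0 (E * ζ ^ μ) (E * ζ ^ (-n)) (-k₀) x :=
  (glue_of_lt _ _ (h0.trans h1)).trans ((glue_of_lt _ _ h1).trans (glue_of_le _ _ h2))

lemma W₁_right (h0 : δ < γ) (h1 : γ < β) (h2 : β < x) :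
    H.W₁ E k₀ ζ δ γ β x = H.piece 1 (E * ζ ^ μ - H.p k₀ β) 0 0 x :=
  (glue_of_lt _ _ (h0.trans (h1.trans h2))).trans
    ((glue_of_lt _ _ (h1.trans h2)).trans (glue_of_lt _ _ h2))

lemma dW₁_left (hx : x ≤ δ) : H.dW₁ E k₀ ζ δ γ β x = 0 :=
  (glue_of_le _ _ hx).trans (H.pieceDeriv_zero x)

lemma dW₁_inner (h1 : δ < x) (h2 : x ≤ γ) :
    H.dW₁ E k₀ ζ δ γ β x = H.pieceDeriv 1 (-H.p (-E) δ) (-H.q (-E) δ) x :=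
  (glue_of_lt _ _ h1).trans (glue_of_le _ _ h2)

lemma dW₁_middle (h0 : δ < γ) (h1 : γ < x) (h2 : x ≤ β) :
    H.dW₁ E k₀ ζ δ γ β x = H.pieceDeriv 0 (E * ζ ^ μ) (E * ζ ^ (-n)) x :=
  (glue_of_lt _ _ (h0.trans h1)).trans ((glue_of_lt _ _ h1).trans (glue_of_le _ _ h2))

lemma dW₁_right (h0 : δ < γ) (h1 : γ < β) (h2 : β < x) :
    H.dW₁ E k₀ ζ δ γ β x = H.pieceDeriv 1 (E * ζ ^ μ - H.p k₀ β) 0 x :=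
  (glue_of_lt _ _ (h0.trans (h1.trans h2))).trans
    ((glue_of_lt _ _ (h1.trans h2)).trans (glue_of_lt _ _ h2))

lemma W₀_left (hx : x ≤ ζ) : H.W₀ E k₀ k₁ ζ β α x = H.piece 0 0 0 E x := glue_of_le _ _ hx

lemma W₀_middle (h1 : ζ < x) (h2 : x ≤ α) :
    H.W₀ E k₀ k₁ ζ β α x = H.piece 0 (E * ζ ^ μ) (E * ζ ^ (-n)) 0 x :=
  (glue_of_lt _ _ h1).trans (glue_of_le _ _ h2)

lemma W₀_right (h0 : ζ < α) (h1 : α < x) :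
    H.W₀ E k₀ k₁ ζ β α x = H.piece 1 (E * ζ ^ μ - H.p k₀ β) 0 (-k₁) x :=
  (glue_of_lt _ _ (h0.trans h1)).trans (glue_of_lt _ _ h1)

lemma dW₀_left (hx : x ≤ ζ) : H.dW₀ E k₀ ζ β α x = 0 :=
  (glue_of_le _ _ hx).trans (H.pieceDeriv_zero x)

lemma dW₀_middle (h1 : ζ < x) (h2 : x ≤ α) :
    H.dW₀ E k₀ ζ β α x = H.pieceDeriv 0 (E * ζ ^ μ) (E * ζ ^ (-n)) x :=
  (glue_of_lt _ _ h1).trans (glue_of_le _ _ h2)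

lemma dW₀_right (h0 : ζ < α) (h1 : α < x) :
    H.dW₀ E k₀ ζ β α x = H.pieceDeriv 1 (E * ζ ^ μ - H.p k₀ β) 0 x :=
  (glue_of_lt _ _ (h0.trans h1)).trans (glue_of_lt _ _ h1)

end regions

section signs

variable {x : ℝ}

lemma pieceDeriv_hom_nonneg (hE : 0 < E) (hζ : 0 < ζ) (hx : ζ ≤ x) :
    0 ≤ x ^ (n + μ) * (E * ζ ^ (-n)) - E * ζ ^ μ ∧
      0 ≤ H.pieceDeriv 0 (E * ζ ^ μ) (E * ζ ^ (-n)) x := by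
  have h1 := H.rpow_N_le hζ.le hx
  have h2 : 0 < E * ζ ^ (-n) := mul_pos hE (Real.rpow_pos_of_pos hζ _)
  have h3 := mul_le_mul_of_nonneg_right h1 h2.le
  have h4 := rpow_N_mul (n := n) (μ := μ) hζ
  have h5 : 0 ≤ x ^ (n + μ) * (E * ζ ^ (-n)) - E * ζ ^ μ := by rw [← h4]; linarith
  refine ⟨h5, ?_⟩
  rw [pieceDeriv]
  refine mul_nonneg (Real.rpow_nonneg (hζ.le.trans hx) _) ?_
  linarith

/-- Since V(x) ≥ V(δ) = δ^{n+μ} q - p, the bracket is at least -q (x^{n+μ} - δ^{n+μ}) with q =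
q_{-E}(δ) < 0. -/
lemma pieceDeriv_inner_nonneg (hδ : 0 < δ) (hq : H.q (-E) δ < 0) (hx : δ ≤ x) :
    0 ≤ H.pieceDeriv 1 (-H.p (-E) δ) (-H.q (-E) δ) x := by
  rw [pieceDeriv]
  refine mul_nonneg (Real.rpow_nonneg (hδ.le.trans hx) _) ?_
  have h1 := H.V_mono hδ hx
  rw [H.V_eq (-E) hδ] at h1
  nlinarith [H.rpow_N_le hδ.le hx]

variable (hs : H.IsSystem E k₀ k₁ ζ δ γ β α)
include hs

lemma IsSystem.pieceDeriv_right_nonneg (hE : 0 < E) (hζβ : ζ ≤ β) (hx : β ≤ x) :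
    0 ≤ H.pieceDeriv 1 (E * ζ ^ μ - H.p k₀ β) 0 x := by
  obtain ⟨hδ, hγ, hβ, hα⟩ := IsSystem.pos H hs
  rw [pieceDeriv]
  refine mul_nonneg (Real.rpow_nonneg (hβ.le.trans hx) _) ?_
  have h1 := H.V_mono hβ hx
  rw [H.V_eq k₀ hβ, hs.q_b] at h1
  linarith [(H.pieceDeriv_hom_nonneg hE hs.z_pos hζβ).1]

lemma IsSystem.dW₁_nonneg (hE : 0 < E) (hζδ : ζ < δ) (hq : H.q (-E) δ < 0) :
    0 ≤ H.dW₁ E k₀ ζ δ γ β x := by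
  obtain ⟨hδ, hγ, hβ, hα⟩ := IsSystem.pos H hs
  have hδγ := hs.inner.x_lt
  have hγβ := hs.g_lt
  rcases le_or_gt x δ with h1 | h1
  · rw [H.dW₁_left h1]
  rcases le_or_gt x γ with h2 | h2
  · rw [H.dW₁_inner h1 h2]; exact H.pieceDeriv_inner_nonneg hδ hq h1.le
  rcases le_or_gt x β with h3 | h3
  · rw [H.dW₁_middle hδγ h2 h3]
    exact (H.pieceDeriv_hom_nonneg hE hs.z_pos (hζδ.trans h1).le).2
  · rw [H.dW₁_right hδγ hγβ h3]
    exact IsSystem.pieceDeriv_right_nonneg H hs hE (hζδ.trans (hδγ.trans hγβ)).le h3.le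

lemma IsSystem.dW₀_nonneg (hE : 0 < E) (hζδ : ζ < δ) : 0 ≤ H.dW₀ E k₀ ζ β α x := by
  obtain ⟨hδ, hγ, hβ, hα⟩ := IsSystem.pos H hs
  have hζβ := hζδ.trans (hs.inner.x_lt.trans hs.g_lt)
  have hβα := hs.switch.b_lt
  rcases le_or_gt x ζ with h1 | h1
  · rw [H.dW₀_left h1]
  rcases le_or_gt x α with h2 | h2
  · rw [H.dW₀_middle h1 h2]; exact (H.pieceDeriv_hom_nonneg hE hs.z_pos h1.le).2
  · rw [H.dW₀_right (hζβ.trans hβα) h2]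
    exact IsSystem.pieceDeriv_right_nonneg H hs hE hζβ.le (hβα.trans h2).le

/-- On (δ, γ] the difference of derivatives is minus the gap of the point C_{k₀}(γ), negative to the
left of γ because h + k₀ < 0 there. -/
lemma IsSystem.dW_sub_nonneg (hE : 0 < E) (hζδ : ζ < δ) (hh : h β + k₀ < 0) (hx0 : 0 < x)
    (hx : x ≤ γ) : 0 ≤ H.dW₀ E k₀ ζ β α x - H.dW₁ E k₀ ζ δ γ β x := by
  obtain ⟨hδ, hγ, hβ, hα⟩ := IsSystem.pos H hs
  have hγα := hs.g_lt.trans hs.switch.b_lt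
  rcases le_or_gt x δ with h1 | h1
  · rw [H.dW₁_left h1, sub_zero]; exact IsSystem.dW₀_nonneg H hs hE hζδ
  · rw [H.dW₁_inner h1 hx, H.dW₀_middle (hζδ.trans h1) (hx.trans hγα.le), H.pieceDeriv_sub]
    have e1 : E * ζ ^ μ - -H.p (-E) δ = H.p k₀ γ := by linarith [hs.inner.p_eq]
    have e2 : E * ζ ^ (-n) - -H.q (-E) δ = H.q k₀ γ := by linarith [hs.inner.q_eq]
    rw [e1, e2, ← mul_neg]
    refine mul_nonneg (Real.rpow_nonneg hx0.le _) (neg_nonneg.2 ?_)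
    rcases hx.eq_or_lt with rfl | h2
    · exact (H.gap_eq_zero hx0 rfl rfl).le
    · exact (H.gap_neg_left hx0 h2 fun s hs1 => by
        linarith [H.mono' (hx0.trans hs1.1) (hs1.2.le.trans hs.g_lt.le)]).le

/-- On (β, α] the relevant gap is that of the common point C_{k₀}(β) = C_{-k₁}(α). It vanishes at
both ends and is therefore nonnegative in between by concavity. -/
lemma IsSystem.dW_sub_nonpos (hζδ : ζ < δ) (hx : γ ≤ x) :
    H.dW₀ E k₀ ζ β α x - H.dW₁ E k₀ ζ δ γ β x ≤ 0 := by
  obtain ⟨hδ, hγ, hβ, hα⟩ := IsSystem.pos H hs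
  obtain ⟨m1, m2, m3, m4, m5⟩ := IsSystem.pieces_match H hs
  have hδγ := hs.inner.x_lt
  have hγβ := hs.g_lt
  have hβα := hs.switch.b_lt
  have hζx := hζδ.trans (hδγ.trans_le hx)
  rcases hx.eq_or_lt with rfl | h1
  · rw [H.dW₁_inner hδγ le_rfl, H.dW₀_middle hζx (hγβ.trans hβα).le,
      H.pieceDeriv_congr hγ m2.1 m2.2, sub_self]
  rcases le_or_gt x β with h2 | h2
  · rw [H.dW₁_middle hδγ h1 h2, H.dW₀_middle hζx (h2.trans hβα.le), sub_self]
  rcases le_or_gt x α with h3 | h3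
  · rw [H.dW₁_right hδγ hγβ h2, H.dW₀_middle hζx h3, H.pieceDeriv_sub]
    have e1 : E * ζ ^ μ - (E * ζ ^ μ - H.p k₀ β) = H.p k₀ β := by ring
    rw [e1, sub_zero, neg_nonpos]
    refine mul_nonneg (Real.rpow_nonneg (hγ.trans h1).le _) (H.gap_nonneg hβ h2.le h3 ?_ ?_)
    · exact (H.gap_eq_zero hβ rfl hs.q_b).ge
    · exact (H.gap_eq_zero hα hs.switch.p_eq.symm (hs.switch.q_eq.symm.trans hs.q_b)).ge
  · rw [H.dW₁_right hδγ hγβ h2, H.dW₀_right (hζδ.trans (hδγ.trans (hγβ.trans hβα))) h3, sub_self]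

end signs

section values

variable (hs : H.IsSystem E k₀ k₁ ζ δ γ β α)
include hs

lemma IsSystem.W_sub_middle (hζδ : ζ < δ) {x : ℝ} (h1 : γ ≤ x) (h2 : x ≤ β) :
    H.W₀ E k₀ k₁ ζ β α x - H.W₁ E k₀ ζ δ γ β x = k₀ * (1 / μ + 1 / n) := by
  obtain ⟨hδ, hγ, hβ, hα⟩ := IsSystem.pos H hs
  obtain ⟨m1, m2, m3, m4, m5⟩ := IsSystem.pieces_match H hs
  have hδγ := hs.inner.x_lt
  have e : H.W₁ E k₀ ζ δ γ β x = H.piece 0 (E * ζ ^ μ) (E * ζ ^ (-n)) (-k₀) x := by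
    rcases h1.eq_or_lt with rfl | h1
    · rw [H.W₁_inner hδγ le_rfl, H.piece_congr m2.1 m2.2]
    · exact H.W₁_middle hδγ h1 h2
  rw [e, H.W₀_middle (hζδ.trans (hδγ.trans_le h1)) (h2.trans hs.switch.b_lt.le),
    H.piece_const 0 _ _ (-k₀) 0 (hγ.trans_le h1)]
  ring

lemma IsSystem.W_sub_right (hζδ : ζ < δ) {x : ℝ} (h1 : α ≤ x) :
    H.W₀ E k₀ k₁ ζ β α x - H.W₁ E k₀ ζ δ γ β x = -k₁ * (1 / μ + 1 / n) := by
  obtain ⟨hδ, hγ, hβ, hα⟩ := IsSystem.pos H hs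
  obtain ⟨m1, m2, m3, m4, m5⟩ := IsSystem.pieces_match H hs
  have hδγ := hs.inner.x_lt
  have hζα := hζδ.trans (hδγ.trans (hs.g_lt.trans hs.switch.b_lt))
  have e : H.W₀ E k₀ k₁ ζ β α x = H.piece 1 (E * ζ ^ μ - H.p k₀ β) 0 (-k₁) x := by
    rcases h1.eq_or_lt with rfl | h1
    · rw [H.W₀_middle hζα le_rfl, H.piece_congr m5.1 m5.2]
    · exact H.W₀_right hζα h1
  rw [e, H.W₁_right hδγ hs.g_lt (hs.switch.b_lt.trans_le h1),
    H.piece_const 1 _ _ (-k₁) 0 (hα.trans_le h1)]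
  ring

/-- W₀ - W₁ is 0 where both projects are abandoned, rises to the plateau k₀ (1/μ + 1/n) on [γ, β],
and falls to its constant value -k₁ (1/μ + 1/n) on [α, ∞). -/
lemma IsSystem.W_sub_le_and_ge (hE : 0 < E) (hk₀ : 0 < k₀) (hk₁ : 0 < k₁) (hζδ : ζ < δ)
    {x : ℝ} (hx : 0 < x) :
    H.W₀ E k₀ k₁ ζ β α x - H.W₁ E k₀ ζ δ γ β x ≤ k₀ * (1 / μ + 1 / n) ∧
      -k₁ * (1 / μ + 1 / n) ≤ H.W₀ E k₀ k₁ ζ β α x - H.W₁ E k₀ ζ δ γ β x := by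
  obtain ⟨hδ, hγ, hβ, hα⟩ := IsSystem.pos H hs
  have hμ := H.mu_pos
  have hn := H.n_pos
  have hh := IsSwitch.h_lt H hs.switch (add_pos hk₀ hk₁)
  have hκ : 0 < k₁ * (1 / μ + 1 / n) := by positivity
  have hζα := hζδ.trans (hs.inner.x_lt.trans (hs.g_lt.trans hs.switch.b_lt))
  have hC := (IsSystem.isC1_W₀ H hs hζα).sub (IsSystem.isC1_W₁ H hs)
  have hmono := hC.monotoneOn (convex_Ioc 0 γ) (fun x hx => hx.1) fun x hx =>
    IsSystem.dW_sub_nonneg H hs hE hζδ hh hx.1 hx.2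
  have hanti := hC.antitoneOn (convex_Ici γ) (fun x hx => hγ.trans_le hx) fun x hx =>
    IsSystem.dW_sub_nonpos H hs hζδ hx
  rcases le_total x γ with h1 | h1
  · constructor
    · rw [← IsSystem.W_sub_middle H hs hζδ le_rfl hs.g_lt.le]
      exact hmono ⟨hx, h1⟩ ⟨hγ, le_rfl⟩ h1
    · set y := min x ζ with hy
      have hy0 : 0 < y := lt_min hx hs.z_pos
      have h2 := hmono ⟨hy0, (min_le_left _ _).trans h1⟩ ⟨hx, h1⟩ (min_le_left x ζ)
      simp only at h2
      rw [H.W₀_left (min_le_right _ _), H.W₁_left ((min_le_right _ _).trans hζδ.le)] at h2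
      linarith
  · constructor
    · rw [← IsSystem.W_sub_middle H hs hζδ le_rfl hs.g_lt.le]
      exact hanti self_mem_Ici h1 h1
    · rw [← IsSystem.W_sub_right H hs hζδ (le_max_right x α)]
      exact hanti h1 (h1.trans (le_max_left _ _)) (le_max_left _ _)

lemma IsSystem.monotoneOn_W₁ (hE : 0 < E) (hζδ : ζ < δ) (hq : H.q (-E) δ < 0) :
    MonotoneOn (H.W₁ E k₀ ζ δ γ β) (Ioi 0) :=
  (IsSystem.isC1_W₁ H hs).monotoneOn (convex_Ioi 0) (fun _ hx => hx) fun _ _ =>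
    IsSystem.dW₁_nonneg H hs hE hζδ hq

lemma IsSystem.monotoneOn_W₀ (hE : 0 < E) (hζδ : ζ < δ) :
    MonotoneOn (H.W₀ E k₀ k₁ ζ β α) (Ioi 0) :=
  (IsSystem.isC1_W₀ H hs
    (hζδ.trans (hs.inner.x_lt.trans (hs.g_lt.trans hs.switch.b_lt)))).monotoneOn
    (convex_Ioi 0) (fun _ hx => hx) fun _ _ => IsSystem.dW₀_nonneg H hs hE hζδ

lemma IsSystem.le_W₁ (hE : 0 < E) (hζδ : ζ < δ) (hq : H.q (-E) δ < 0) {x : ℝ} (hx : 0 < x) :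
    E * (1 / μ + 1 / n) ≤ H.W₁ E k₀ ζ δ γ β x := by
  have hy0 : 0 < min x δ := lt_min hx hs.inner.x_pos
  rw [← H.piece_zero E hy0, ← H.W₁_left (k₀ := k₀) (ζ := ζ) (γ := γ) (β := β) (min_le_right x δ)]
  exact IsSystem.monotoneOn_W₁ H hs hE hζδ hq hy0 hx (min_le_left _ _)

lemma IsSystem.le_W₀ (hE : 0 < E) (hζδ : ζ < δ) {x : ℝ} (hx : 0 < x) :
    E * (1 / μ + 1 / n) ≤ H.W₀ E k₀ k₁ ζ β α x := by
  have hy0 : 0 < min x ζ := lt_min hx hs.z_pos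
  rw [← H.piece_zero E hy0,
    ← H.W₀_left (k₀ := k₀) (k₁ := k₁) (β := β) (α := α) (min_le_right x ζ)]
  exact IsSystem.monotoneOn_W₀ H hs hE hζδ hy0 hx (min_le_left _ _)

/-- The variational inequality of the open mode. -/
lemma IsSystem.euler_W₁ (hk : 0 < k₀ + k₁) (hζδ : ζ < δ) (hδE : h δ < E) {x : ℝ}
    (hx : 0 < x) (hc : ContinuousAt h x) (h1 : x ≠ δ) (h2 : x ≠ γ) (h3 : x ≠ β) :
    ∃ ε c, H.Euler ε c (H.W₁ E k₀ ζ δ γ β) (H.dW₁ E k₀ ζ δ γ β) x ∧ h x - (ε * h x + c) ≤ 0 ∧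
      (h x - (ε * h x + c) = 0 ∨
        H.W₀ E k₀ k₁ ζ β α x - H.W₁ E k₀ ζ δ γ β x = k₀ * (1 / μ + 1 / n) ∨
        H.W₁ E k₀ ζ δ γ β x = E * (1 / μ + 1 / n)) := by
  obtain ⟨hδ, hγ, hβ, hα⟩ := IsSystem.pos H hs
  have hδγ := hs.inner.x_lt
  have hγβ := hs.g_lt
  have hh := IsSwitch.h_lt H hs.switch hk
  have eu : ∀ ε a b c, H.Euler ε c (H.piece ε a b c) (H.pieceDeriv ε a b) x := fun ε a b c =>
    H.exists_hasDerivAt_pieceDeriv ε a b c hx hc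
  rcases lt_or_gt_of_ne h1 with h1 | h1
  · refine ⟨0, E, Euler.glue_left H (eu _ _ _ _) h1, ?_, Or.inr (Or.inr ?_)⟩
    · linarith [H.mono' hx h1.le]
    · rw [H.W₁_left h1.le, H.piece_zero E hx]
  rcases lt_or_gt_of_ne h2 with h2 | h2
  · exact ⟨1, 0, Euler.glue_right H (Euler.glue_left H (eu _ _ _ _) h2) h1, by linarith,
      Or.inl (by ring)⟩
  rcases lt_or_gt_of_ne h3 with h3 | h3
  · refine ⟨0, -k₀, Euler.glue_right H (Euler.glue_right H
      (Euler.glue_left H (eu _ _ _ _) h3) h2) h1, ?_, Or.inr (Or.inl ?_)⟩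
    · linarith [H.mono' hx h3.le]
    · exact IsSystem.W_sub_middle H hs hζδ h2.le h3.le
  · exact ⟨1, 0, Euler.glue_right H (Euler.glue_right H (Euler.glue_right H (eu _ _ _ _) h3) h2) h1,
      by linarith, Or.inl (by ring)⟩

/-- The variational inequality of the closed mode. -/
lemma IsSystem.euler_W₀ (hE : 0 < E) (hk : 0 < k₀ + k₁) (hζδ : ζ < δ) {x : ℝ}
    (hx : 0 < x) (hc : ContinuousAt h x) (h1 : x ≠ ζ) (h2 : x ≠ α) :
    ∃ ε c, H.Euler ε c (H.W₀ E k₀ k₁ ζ β α) (H.dW₀ E k₀ ζ β α) x ∧ -(ε * h x + c) ≤ 0 ∧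
      (-(ε * h x + c) = 0 ∨
        H.W₀ E k₀ k₁ ζ β α x - H.W₁ E k₀ ζ δ γ β x = -k₁ * (1 / μ + 1 / n) ∨
        H.W₀ E k₀ k₁ ζ β α x = E * (1 / μ + 1 / n)) := by
  obtain ⟨hδ, hγ, hβ, hα⟩ := IsSystem.pos H hs
  obtain ⟨t, hta, ht⟩ := IsSwitch.exists_lt_h H hs.switch hk
  have eu : ∀ ε a b c, H.Euler ε c (H.piece ε a b c) (H.pieceDeriv ε a b) x := fun ε a b c =>
    H.exists_hasDerivAt_pieceDeriv ε a b c hx hc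
  rcases lt_or_gt_of_ne h1 with h1 | h1
  · refine ⟨0, E, Euler.glue_left H (eu _ _ _ _) h1, by linarith, Or.inr (Or.inr ?_)⟩
    rw [H.W₀_left h1.le, H.piece_zero E hx]
  rcases lt_or_gt_of_ne h2 with h2 | h2
  · exact ⟨0, 0, Euler.glue_right H (Euler.glue_left H (eu _ _ _ _) h2) h1, by linarith,
      Or.inl (by ring)⟩
  · refine ⟨1, -k₁, Euler.glue_right H (Euler.glue_right H (eu _ _ _ _) h2) h1, ?_,
      Or.inr (Or.inl ?_)⟩
    · linarith [ht x (hta.trans h2)]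
    · exact IsSystem.W_sub_right H hs hζδ h2.le

end values

end Payoff

/-! ### From the integrability assumption to the moments of h. -/

/-- A process with almost surely continuous paths and a.e.-measurable marginals agrees almost surely,
at all times simultaneously, with a jointly measurable process. -/
lemma exists_measurable_version {Ω : Type*} [MeasurableSpace Ω] {P : Measure Ω} {W : ℝ≥0 → Ω → ℝ}
    (hm : ∀ t, AEMeasurable (W t) P) (hc : ∀ᵐ ω ∂P, Continuous (W · ω)) :
    ∃ Y : Ω × ℝ≥0 → ℝ, Measurable Y ∧ ∀ᵐ ω ∂P, ∀ t, Y (ω, t) = W t ω := by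
  set q : ℕ → ℕ → ℝ≥0 := fun j k => ((j : ℝ) / (k : ℝ)).toNNReal with hq
  have hae : ∀ᵐ ω ∂P, Continuous (W · ω) ∧ ∀ j k : ℕ, W (q j k) ω = (hm (q j k)).mk _ ω :=
    hc.and (ae_all_iff.2 fun j => ae_all_iff.2 fun k => (hm (q j k)).ae_eq_mk)
  obtain ⟨G, hG, hGm, hGp⟩ := hae.exists_measurable_mem
  -- S k samples the path at the grid point ⌊tk⌋/k, where W is replaced by a measurable
  -- modification, and is 0 off a measurable set of full measure; continuity of paths gives
  -- convergence everywhere.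
  set S : ℕ → Ω × ℝ≥0 → ℝ := fun k x =>
    G.indicator ((hm (q ⌊(x.2 : ℝ) * k⌋₊ k)).mk _) x.1 with hS
  have hSm : ∀ k, Measurable (S k) := by
    intro k
    have h1 : Measurable fun y : Ω × ℕ => G.indicator ((hm (q y.2 k)).mk _) y.1 :=
      measurable_from_prod_countable_left fun j => (hm (q j k)).measurable_mk.indicator hGm
    exact h1.comp (measurable_fst.prodMk
      (Nat.measurable_floor.comp (measurable_snd.coe_nnreal_real.mul_const _)))
  have hlim : ∀ x : Ω × ℝ≥0, Tendsto (fun k => S k x) atTop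
      (𝓝 (G.indicator (fun ω => W x.2 ω) x.1)) := by
    rintro ⟨ω, t⟩
    by_cases hω : ω ∈ G
    · obtain ⟨h1, h2⟩ := hGp ω hω
      simp only [hS, indicator_of_mem hω, ← h2]
      have h3 : Tendsto (fun k : ℕ => q ⌊(t : ℝ) * k⌋₊ k) atTop (𝓝 t) := by
        have h4 := (tendsto_nat_floor_mul_div_atTop (R := ℝ) t.2).comp
          tendsto_natCast_atTop_atTop
        have h5 := (continuous_real_toNNReal.tendsto (t : ℝ)).comp h4
        rwa [Real.toNNReal_coe] at h5
      exact (h1.tendsto t).comp h3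
    · simp only [hS, indicator_of_notMem hω]
      exact tendsto_const_nhds
  refine ⟨_, measurable_of_tendsto_metrizable hSm (tendsto_pi_nhds.2 hlim), ?_⟩
  filter_upwards [hG] with ω hω t
  exact indicator_of_mem hω _

/-- The discounted density at `z` of `ν t + √2 σ W_t`. -/
noncomputable def resolventIntegrand (ν σ r t z : ℝ) : ℝ :=
  Real.exp (-r * t) * ((Real.sqrt (2 * Real.pi * (2 * σ ^ 2 * t)))⁻¹ *
    Real.exp (-(z - ν * t) ^ 2 / (2 * (2 * σ ^ 2 * t))))

lemma measurable_resolventIntegrand (ν σ r : ℝ) :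
    Measurable fun x : ℝ × ℝ => resolventIntegrand ν σ r x.1 x.2 := by
  unfold resolventIntegrand
  fun_prop

lemma IsBrownianReal.lintegral_affine {Ω : Type*} [MeasurableSpace Ω] {P : Measure Ω}
    {W : ℝ≥0 → Ω → ℝ} (hW : IsBrownianReal W P) {ν σ r t : ℝ} (hσ : σ ≠ 0) (ht : 0 < t)
    {φ : ℝ → ℝ≥0∞} (hφ : Measurable φ) :
    ∫⁻ ω, ENNReal.ofReal (Real.exp (-r * t)) * φ (ν * t + Real.sqrt 2 * σ * W t.toNNReal ω) ∂P =
      ∫⁻ z, ENNReal.ofReal (resolventIntegrand ν σ r t z) * φ z := by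
  have h1 := gaussianReal_const_add (gaussianReal_const_mul (hW.hasLaw_eval t.toNNReal)
    (Real.sqrt 2 * σ)) (ν * t)
  have h2 := h1.lintegral_comp (f := fun z => ENNReal.ofReal (Real.exp (-r * t)) * φ z)
    (hφ.const_mul _).aemeasurable
  rw [h2]
  -- The variance arises as a product in `ℝ≥0`; only its real value 2σ²t matters.
  have hv : ∀ v : ℝ≥0, (v : ℝ) = 2 * σ ^ 2 * t →
      ∫⁻ z, ENNReal.ofReal (Real.exp (-r * t)) * φ z ∂gaussianReal (Real.sqrt 2 * σ * 0 + ν * t) v =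
      ∫⁻ z, ENNReal.ofReal (resolventIntegrand ν σ r t z) * φ z := by
    intro v hv
    have hv0 : v ≠ 0 := by
      intro h0
      rw [h0] at hv
      have : 0 < 2 * σ ^ 2 * t := by positivity
      simp only [NNReal.coe_zero] at hv
      linarith
    rw [gaussianReal_of_var_ne_zero _ hv0,
      lintegral_withDensity_eq_lintegral_mul _ (measurable_gaussianPDF _ _) (hφ.const_mul _)]
    refine lintegral_congr fun z => ?_
    simp only [Pi.mul_apply, gaussianPDF, gaussianPDFReal, resolventIntegrand, hv]
    rw [ENNReal.ofReal_mul (Real.exp_nonneg _), mul_zero, zero_add]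
    ring
  refine hv _ ?_
  simp only [NNReal.coe_mul, NNReal.coe_mk, Real.coe_toNNReal _ ht.le, mul_pow,
    Real.sq_sqrt zero_le_two]

/-- Tonelli's theorem is applied to a jointly measurable version of W, and the Gaussian density is
then integrated over time at each fixed position. -/
lemma IsBrownianReal.lintegral_discounted {Ω : Type*} [MeasurableSpace Ω] {P : Measure Ω}
    [SFinite P] {W : ℝ≥0 → Ω → ℝ} (hW : IsBrownianReal W P) {ν σ r : ℝ} (hσ : σ ≠ 0)
    {φ : ℝ → ℝ≥0∞} (hφ : Measurable φ) :
    ∫⁻ ω, (∫⁻ t in Ioi (0 : ℝ), ENNReal.ofReal (Real.exp (-r * t)) *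
        φ (ν * t + Real.sqrt 2 * σ * W t.toNNReal ω)) ∂P =
      ∫⁻ z, (∫⁻ t in Ioi (0 : ℝ), ENNReal.ofReal (resolventIntegrand ν σ r t z)) * φ z := by
  obtain ⟨Y, hY, hYW⟩ := exists_measurable_version (fun t => hW.aemeasurable t) hW.cont
  have h1 : ∫⁻ ω, (∫⁻ t in Ioi (0 : ℝ), ENNReal.ofReal (Real.exp (-r * t)) *
        φ (ν * t + Real.sqrt 2 * σ * W t.toNNReal ω)) ∂P =
      ∫⁻ ω, (∫⁻ t in Ioi (0 : ℝ), ENNReal.ofReal (Real.exp (-r * t)) *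
        φ (ν * t + Real.sqrt 2 * σ * Y (ω, t.toNNReal))) ∂P := by
    refine lintegral_congr_ae ?_
    filter_upwards [hYW] with ω hω
    simp only [hω]
  rw [h1, lintegral_lintegral_swap (Measurable.aemeasurable (by fun_prop))]
  have h2 : ∀ t ∈ Ioi (0 : ℝ), ∫⁻ ω, ENNReal.ofReal (Real.exp (-r * t)) *
        φ (ν * t + Real.sqrt 2 * σ * Y (ω, t.toNNReal)) ∂P =
      ∫⁻ z, ENNReal.ofReal (resolventIntegrand ν σ r t z) * φ z := by
    intro t ht
    rw [← IsBrownianReal.lintegral_affine hW hσ ht hφ]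
    refine lintegral_congr_ae ?_
    filter_upwards [hYW] with ω hω
    rw [hω]
  have hm := measurable_resolventIntegrand ν σ r
  rw [setLIntegral_congr_fun measurableSet_Ioi h2,
    lintegral_lintegral_swap (Measurable.aemeasurable (by fun_prop))]
  refine lintegral_congr fun z => ?_
  rw [lintegral_mul_const]
  exact (hm.comp (measurable_id.prodMk measurable_const)).ennreal_ofReal

/-- Lower bound of the resolvent density away from the starting point. -/
lemma exists_le_lintegral_resolventIntegrand {ν σ r : ℝ} (hσ : σ ≠ 0) (hr : 0 < r) :
    ∃ C : ℝ, 0 < C ∧ ∀ z : ℝ, 1 ≤ |z| →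
      ENNReal.ofReal (C * Real.exp ((ν * z - |z| * Real.sqrt (ν ^ 2 + 4 * σ ^ 2 * r)) /
        (2 * σ ^ 2))) ≤
      ∫⁻ t in Ioi (0 : ℝ), ENNReal.ofReal (resolventIntegrand ν σ r t z) := by
  have hσ2 : 0 < σ ^ 2 := by positivity
  set θ := Real.sqrt (ν ^ 2 + 4 * σ ^ 2 * r) with hθ
  have hθ2 : θ ^ 2 = ν ^ 2 + 4 * σ ^ 2 * r := Real.sq_sqrt (by positivity)
  have hθ0 : 0 < θ := Real.sqrt_pos.2 (by positivity)
  have hpi := Real.pi_pos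
  set D := 2 * Real.pi * (2 * σ ^ 2 * (1 / θ + 1)) with hD
  have hD0 : 0 < D := by positivity
  refine ⟨(Real.sqrt D)⁻¹ * Real.exp (-(θ ^ 3 / (4 * σ ^ 2))), by positivity, fun z hz => ?_⟩
  set a := |z| with ha
  have ha0 : 0 < a := by linarith
  have hl1 : 1 ≤ Real.sqrt a := Real.one_le_sqrt.2 hz
  have hla : Real.sqrt a * Real.sqrt a = a := Real.mul_self_sqrt ha0.le
  set c := (Real.sqrt D * Real.sqrt a)⁻¹ * Real.exp (-(θ ^ 3 / (4 * σ ^ 2))) *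
    Real.exp ((ν * z - a * θ) / (2 * σ ^ 2)) with hc
  have hsub : Icc (a / θ) (a / θ + Real.sqrt a) ⊆ Ioi (0 : ℝ) := fun t ht =>
    lt_of_lt_of_le (by positivity) ht.1
  -- The exponent is maximal at t = a/θ. On a window of length √a to the right of it the exponent
  -- loses only a bounded amount and the prefactor is of order 1/√a, so the integral over the window
  -- is of the order of the maximal exponential.
  have hle : ∀ t ∈ Icc (a / θ) (a / θ + Real.sqrt a), c ≤ resolventIntegrand ν σ r t z := by
    intro t ht
    have ht0 : 0 < t := hsub ht
    have hat : a ≤ θ * t := by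
      have := ht.1
      rwa [div_le_iff₀' hθ0] at this
    have hat2 : θ * t - a ≤ θ * Real.sqrt a := by
      have h3 : t - a / θ ≤ Real.sqrt a := by linarith [ht.2]
      have h4 : θ * (t - a / θ) ≤ θ * Real.sqrt a := mul_le_mul_of_nonneg_left h3 hθ0.le
      rwa [mul_sub, mul_div_cancel₀ _ hθ0.ne'] at h4
    have e1 : -r * t + -(z - ν * t) ^ 2 / (2 * (2 * σ ^ 2 * t)) =
        (ν * z - a * θ) / (2 * σ ^ 2) - (θ * t - a) ^ 2 / (4 * σ ^ 2 * t) := by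
      have hz2 : a ^ 2 = z ^ 2 := sq_abs z
      field_simp
      linear_combination (4 * t ^ 2) * hθ2 + 4 * hz2
    have e2 : (θ * t - a) ^ 2 / (4 * σ ^ 2 * t) ≤ θ ^ 3 / (4 * σ ^ 2) := by
      rw [div_le_div_iff₀ (by positivity) (by positivity)]
      have h5 : (θ * t - a) ^ 2 ≤ (θ * Real.sqrt a) ^ 2 :=
        pow_le_pow_left₀ (by linarith) hat2 2
      have h6 : (θ * Real.sqrt a) ^ 2 = θ ^ 2 * a := by rw [mul_pow, sq (Real.sqrt a), hla]
      have h7 : (θ * t - a) ^ 2 ≤ θ ^ 3 * t := by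
        calc (θ * t - a) ^ 2 ≤ θ ^ 2 * a := by rw [← h6]; exact h5
          _ ≤ θ ^ 2 * (θ * t) := mul_le_mul_of_nonneg_left hat (by positivity)
          _ = θ ^ 3 * t := by ring
      calc (θ * t - a) ^ 2 * (4 * σ ^ 2) ≤ (θ ^ 3 * t) * (4 * σ ^ 2) :=
            mul_le_mul_of_nonneg_right h7 (by positivity)
        _ = θ ^ 3 * (4 * σ ^ 2 * t) := by ring
    have e3 : Real.sqrt (2 * Real.pi * (2 * σ ^ 2 * t)) ≤ Real.sqrt D * Real.sqrt a := by
      rw [← Real.sqrt_mul hD0.le]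
      refine Real.sqrt_le_sqrt ?_
      have h8 : t ≤ (1 / θ + 1) * a := by
        have h9 : Real.sqrt a ≤ a := by nlinarith
        have h10 : (1 / θ + 1) * a = a / θ + a := by ring
        linarith [ht.2]
      calc 2 * Real.pi * (2 * σ ^ 2 * t) ≤ 2 * Real.pi * (2 * σ ^ 2 * ((1 / θ + 1) * a)) := by
            gcongr
        _ = D * a := by rw [hD]; ring
    have e4 : resolventIntegrand ν σ r t z = (Real.sqrt (2 * Real.pi * (2 * σ ^ 2 * t)))⁻¹ *
        (Real.exp (-((θ * t - a) ^ 2 / (4 * σ ^ 2 * t))) *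
          Real.exp ((ν * z - a * θ) / (2 * σ ^ 2))) := by
      rw [← Real.exp_add, neg_add_eq_sub, ← e1, Real.exp_add, resolventIntegrand]
      ring
    rw [e4, hc, mul_assoc]
    gcongr
  have hvol : ENNReal.ofReal (c * Real.sqrt a) ≤
      ∫⁻ t in Icc (a / θ) (a / θ + Real.sqrt a),
        ENNReal.ofReal (resolventIntegrand ν σ r t z) := by
    calc ENNReal.ofReal (c * Real.sqrt a)
        = ∫⁻ _ in Icc (a / θ) (a / θ + Real.sqrt a), ENNReal.ofReal c := by
          rw [setLIntegral_const, Real.volume_Icc, add_sub_cancel_left,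
            ENNReal.ofReal_mul (by positivity)]
      _ ≤ _ := setLIntegral_mono' measurableSet_Icc fun t ht =>
          ENNReal.ofReal_le_ofReal (hle t ht)
  refine le_trans (le_of_eq ?_) (hvol.trans (lintegral_mono_set hsub))
  congr 1
  rw [hc]
  have : Real.sqrt a ≠ 0 := by positivity
  field_simp

lemma integrableOn_rpow_mul_of_monotoneOn {h : ℝ → ℝ} (hh : MonotoneOn h (Ioi 0)) (e : ℝ) {a b : ℝ}
    (ha : 0 < a) : IntegrableOn (fun s => s ^ e * h s) (Icc a b) := by
  have h1 : IntegrableOn h (Icc a b) :=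
    (hh.mono fun x hx => lt_of_lt_of_le ha hx.1).integrableOn_isCompact isCompact_Icc
  refine h1.continuousOn_mul (fun x hx => ?_) isCompact_Icc
  exact (Real.continuousAt_rpow_const x _ (Or.inl (lt_of_lt_of_le ha hx.1).ne')).continuousWithinAt

/-- The substitution s = e^z, with k the time-integrated density, bounded below on S. -/
lemma integrableOn_rpow_of_exp {h : ℝ → ℝ} (hh : Measurable fun z => h (Real.exp z)) {e C : ℝ}
    (hC : 0 < C) {S : Set ℝ} (hS : MeasurableSet S) {k : ℝ → ℝ≥0∞}
    (hk : ∀ z ∈ S, ENNReal.ofReal (C * Real.exp (e * z)) ≤ k z)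
    (hfin : ∫⁻ z, k z * ENNReal.ofReal |h (Real.exp z)| < ∞) :
    IntegrableOn (fun s => s ^ (e - 1) * h s) (Real.exp '' S) := by
  rw [integrableOn_image_iff_integrableOn_abs_deriv_smul hS
    (fun x _ => (Real.hasDerivAt_exp x).hasDerivWithinAt) Real.exp_injective.injOn]
  have e1 : ∀ z : ℝ, |Real.exp z| • (Real.exp z ^ (e - 1) * h (Real.exp z)) =
      C⁻¹ * ((C * Real.exp (e * z)) * h (Real.exp z)) := by
    intro z
    rw [abs_of_pos (Real.exp_pos z), smul_eq_mul, ← mul_assoc, ← Real.exp_mul, ← Real.exp_add,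
      show z + z * (e - 1) = e * z by ring]
    field_simp
  simp only [e1]
  refine Integrable.const_mul ⟨?_, ?_⟩ _
  · exact (Measurable.mul (by fun_prop) hh).aestronglyMeasurable
  · refine lt_of_le_of_lt ?_ hfin
    refine le_trans (setLIntegral_mono' hS fun z hz => ?_) (setLIntegral_le_lintegral S _)
    rw [enorm_mul, Real.enorm_eq_ofReal (by positivity), Real.enorm_eq_ofReal_abs]
    gcongr
    exact hk z hz

namespace SwitchingModel

variable {M : SwitchingModel}

/-- The last two identities are Vieta's formulas for the Euler equation. -/
lemma exponents {Ω : Type*} [MeasurableSpace Ω] {P : Measure Ω} {W : ℝ≥0 → Ω → ℝ}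
    (hM : M.Standing P W) : M.m < 0 ∧ 0 < M.n ∧ M.r = M.σ ^ 2 * (-M.m * M.n) ∧
      M.b = M.σ ^ 2 * (1 + -M.m - M.n) := by
  have hσ := hM.sigma_ne
  have hr := hM.r_pos
  have hσ2 : 0 < M.σ ^ 2 := by positivity
  have hθ2 : Real.sqrt ((M.b - M.σ ^ 2) ^ 2 + 4 * M.σ ^ 2 * M.r) ^ 2 =
    (M.b - M.σ ^ 2) ^ 2 + 4 * M.σ ^ 2 * M.r := Real.sq_sqrt (by positivity)
  have hθ : |M.b - M.σ ^ 2| < Real.sqrt ((M.b - M.σ ^ 2) ^ 2 + 4 * M.σ ^ 2 * M.r) := by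
    rw [← Real.sqrt_sq_eq_abs]
    exact Real.sqrt_lt_sqrt (by positivity) (by linarith [mul_pos hσ2 hr])
  unfold m n
  set θ := Real.sqrt ((M.b - M.σ ^ 2) ^ 2 + 4 * M.σ ^ 2 * M.r)
  have := abs_lt.1 hθ
  refine ⟨div_neg_of_neg_of_pos (by linarith) (by positivity),
    div_pos (by linarith) (by positivity), ?_, ?_⟩
  · field_simp
    linear_combination -hθ2
  · field_simp
    ring

/-- The standing assumptions imply that the moments of `h` that occur in `R_h` exist. -/
lemma payoff {Ω : Type*} [MeasurableSpace Ω] {P : Measure Ω} [SFinite P] {W : ℝ≥0 → Ω → ℝ}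
    (hW : IsBrownianReal W P) (hM : M.Standing P W) : Payoff (-M.m) M.n M.h := by
  obtain ⟨hm, hn, -, -⟩ := exponents hM
  have hσ2 : 0 < M.σ ^ 2 := by have := hM.sigma_ne; positivity
  have hmeas : Measurable fun z => M.h (Real.exp z) :=
    Monotone.measurable fun x y hxy =>
      hM.mono (Real.exp_pos x) (Real.exp_pos y) (Real.exp_le_exp.2 hxy)
  -- The starting point 1 suffices: the density bound handles h below e^{-1} and above e, and in
  -- between h is bounded by monotonicity.
  have hint := hM.integrable 1 one_pos
  simp only [X, one_mul, ENNReal.ofReal_mul (Real.exp_nonneg _)] at hint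
  rw [IsBrownianReal.lintegral_discounted hW hM.sigma_ne (ν := M.b - M.σ ^ 2) (r := M.r)
    (φ := fun z => ENNReal.ofReal |M.h (Real.exp z)|)
    (measurable_norm.comp hmeas).ennreal_ofReal] at hint
  obtain ⟨C, hC, hk⟩ := exists_le_lintegral_resolventIntegrand (ν := M.b - M.σ ^ 2)
    hM.sigma_ne hM.r_pos
  have h1 := integrableOn_rpow_of_exp (e := -M.n) hmeas hC (measurableSet_Ioi (a := (1 : ℝ)))
    (fun z (hz : 1 < z) => by
      have hz0 : 0 < z := by linarith
      refine le_trans (le_of_eq ?_) (hk z (by rw [abs_of_pos hz0]; exact hz.le))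
      rw [abs_of_pos hz0, n]
      congr 3
      field_simp
      ring) hint
  have h2 := integrableOn_rpow_of_exp (e := -M.m) hmeas hC (measurableSet_Iio (a := (-1 : ℝ)))
    (fun z (hz : z < -1) => by
      have hz0 : z < 0 := by linarith
      refine le_trans (le_of_eq ?_) (hk z (by rw [abs_of_neg hz0]; linarith))
      rw [abs_of_neg hz0, m]
      congr 3
      field_simp
      ring) hint
  refine ⟨by linarith, hn, hM.right_cont, hM.mono, hM.tendsto_top, fun x hx => ?_, fun x hx => ?_⟩
  · refine (h2.union (integrableOn_rpow_mul_of_monotoneOn hM.mono _ (b := x)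
      (Real.exp_pos (-1)))).mono_set fun s hs => ?_
    rcases lt_or_ge s (Real.exp (-1)) with h | h
    · exact Or.inl ⟨Real.log s, (Real.log_lt_iff_lt_exp hs.1).2 h, Real.exp_log hs.1⟩
    · exact Or.inr ⟨h, hs.2⟩
  · refine (h1.union (integrableOn_rpow_mul_of_monotoneOn hM.mono _ (b := Real.exp 1)
      hx)).mono_set fun s hs => ?_
    rcases lt_or_ge (Real.exp 1) s with h | h
    · exact Or.inl ⟨Real.log s, (Real.lt_log_iff_exp_lt (hx.trans hs)).2 h,
        Real.exp_log (hx.trans hs)⟩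
    · exact Or.inr ⟨le_of_lt hs, h⟩

end SwitchingModel

/-! ### Translation between the model and the moments. -/

namespace Payoff

variable {μ n : ℝ} {h : ℝ → ℝ} (H : Payoff μ n h)
include H

lemma integral_low (c : ℝ) {a b : ℝ} (ha : 0 ≤ a) (hb : 0 ≤ b) :
    ∫ s in a..b, s ^ (μ - 1) * (h s + c) = (H.p c b - H.p c a) / μ := by
  rw [H.p_sub c ha hb, eq_div_iff H.mu_pos.ne', mul_comm, ← intervalIntegral.integral_const_mul]
  simp only [mul_assoc]

lemma integral_up (c : ℝ) {a b : ℝ} (ha : 0 < a) (hb : 0 < b) :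
    ∫ s in a..b, s ^ (-n - 1) * (h s + c) = (H.q c a - H.q c b) / n := by
  rw [H.q_sub c ha hb, eq_div_iff H.n_pos.ne', mul_comm, ← intervalIntegral.integral_const_mul]
  simp only [mul_assoc]

lemma integral_top (c : ℝ) {x : ℝ} (hx : 0 < x) :
    ∫ s in Ioi x, s ^ (-n - 1) * (h s + c) = H.q c x / n := by
  rw [H.q_eq_integral c hx, eq_div_iff H.n_pos.ne', mul_comm, ← integral_const_mul]
  simp only [mul_assoc]

lemma integral_low' {a b : ℝ} (ha : 0 ≤ a) (hb : 0 ≤ b) :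
    ∫ s in a..b, s ^ (μ - 1) * h s = (H.p 0 b - H.p 0 a) / μ := by
  simpa using H.integral_low 0 ha hb

lemma integral_up' {a b : ℝ} (ha : 0 < a) (hb : 0 < b) :
    ∫ s in a..b, s ^ (-n - 1) * h s = (H.q 0 a - H.q 0 b) / n := by
  simpa using H.integral_up 0 ha hb

end Payoff

namespace SwitchingModel

variable {M : SwitchingModel} (H : Payoff (-M.m) M.n M.h)
include H

lemma isDeltaDagger_iff {d : ℝ} : M.IsDeltaDagger d ↔ 0 < d ∧ H.q (-(-(M.r * M.K))) d = 0 := by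
  refine and_congr_right fun hd => ?_
  rw [neg_neg, H.integral_top _ hd, div_eq_zero_iff]
  simp [H.n_pos.ne']

lemma isNoSwitchOutPair_iff {d K₁ ζ α : ℝ} (hd : 0 < d) (hq : H.q (-(-(M.r * M.K))) d = 0) :
    M.IsNoSwitchOutPair d K₁ ζ α ↔ H.IsPair (-(M.r * M.K)) (M.r * K₁) d ζ α := by
  have hm : M.m ≠ 0 := fun h => by have := H.mu_pos; rw [h] at this; simp at this
  have hn := H.n_pos.ne'
  have e1 := H.p_eq (-(-(M.r * M.K))) (-(M.r * K₁)) d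
  have e2 := H.q_eq (-(-(M.r * M.K))) (-(M.r * K₁)) d
  have i1 : 0 < α → M.m * (∫ s in d..α, s ^ (-M.m - 1) * (M.h s - M.r * K₁)) =
      H.p (-(M.r * K₁)) d - H.p (-(M.r * K₁)) α := fun hα => by
    simp only [sub_eq_add_neg (M.h _)]
    rw [H.integral_low _ hd.le hα.le]
    field_simp
    ring
  have i2 : 0 < α → M.n * (∫ s in d..α, s ^ (-M.n - 1) * (M.h s - M.r * K₁)) =
      H.q (-(M.r * K₁)) d - H.q (-(M.r * K₁)) α := fun hα => by
    simp only [sub_eq_add_neg (M.h _)]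
    rw [H.integral_up _ hd hα]
    field_simp
  constructor
  · rintro ⟨h1, h2, h3, h4, h5⟩
    have hα := hd.trans h3
    rw [i1 hα] at h4
    rw [neg_mul, i2 hα] at h5
    exact ⟨h1, h2, h3, by linarith, by linarith⟩
  · rintro ⟨h1, h2, h3, h4, h5⟩
    have hα := hd.trans h3
    refine ⟨h1, h2, h3, ?_, ?_⟩
    · rw [i1 hα]; linarith
    · rw [neg_mul, i2 hα]; linarith

lemma isSolution_iff {K₁ K₀ : ℝ} {p : FreeBoundary} :
    M.IsSolution K₁ K₀ p ↔
      H.IsSystem (-(M.r * M.K)) (M.r * K₀) (M.r * K₁) p.ζ p.δ p.γ p.β p.α := by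
  have hm : M.m ≠ 0 := fun h => by have := H.mu_pos; rw [h] at this; simp at this
  have hn := H.n_pos.ne'
  have p1 := H.p_eq (M.r * K₀) 0 p.β
  have p2 := H.p_eq (-(M.r * K₁)) 0 p.α
  have q1 := H.q_eq (M.r * K₀) 0 p.β
  have q2 := H.q_eq (-(M.r * K₁)) 0 p.α
  have i1 : 0 < p.β → 0 < p.α → M.m * (∫ s in p.β..p.α, s ^ (-M.m - 1) * M.h s) =
      H.p 0 p.β - H.p 0 p.α := fun hβ hα => by
    rw [H.integral_low' hβ.le hα.le]
    field_simp
    ring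
  have i2 : 0 < p.β → 0 < p.α → M.n * (∫ s in p.β..p.α, s ^ (-M.n - 1) * M.h s) =
      H.q 0 p.β - H.q 0 p.α := fun hβ hα => by
    rw [H.integral_up' hβ hα]
    field_simp
  have i3 : ∀ c x, 0 < x → M.n * (∫ s in Ioi x, s ^ (-M.n - 1) * (M.h s + c)) = H.q c x :=
    fun c x hx => by
      rw [H.integral_top c hx]
      field_simp
  have i4 : ∀ c a b, 0 < a → 0 < b → M.n * (∫ s in a..b, s ^ (-M.n - 1) * (M.h s + c)) =
      H.q c a - H.q c b := fun c a b ha hb => by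
    rw [H.integral_up c ha hb]
    field_simp
  have i5 : ∀ c x, 0 < x → M.m * (∫ s in (0 : ℝ)..x, s ^ (-M.m - 1) * (M.h s + c)) = -H.p c x :=
    fun c x hx => by
      rw [H.integral_low c le_rfl hx.le, H.p_zero]
      field_simp
      ring
  constructor
  · rintro ⟨hζ, hδ, hγ, hβ, hα, e1, e2, e3, e4, e5⟩
    have hγ0 := hδ.trans hγ
    have hβ0 := hγ0.trans hβ
    have hα0 := hβ0.trans hα
    rw [i1 hβ0 hα0] at e1
    rw [i2 hβ0 hα0] at e2
    rw [i3 _ _ hδ, i4 _ _ _ hγ0 hβ0] at e3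
    rw [i3 _ _ hβ0] at e4
    rw [i5 _ _ hγ0, i5 _ _ hδ] at e5
    refine ⟨hζ, ⟨hδ, hγ, ?_, ?_⟩, hβ, ⟨hβ0, hα, ?_, ?_⟩, ?_⟩ <;>
      first | linarith | (rw [neg_neg]; linarith)
  · rintro ⟨hζ, ⟨hδ, hγ, s1, s2⟩, hβ, ⟨hβ0, hα, s3, s4⟩, s5⟩
    have hγ0 := hδ.trans hγ
    have hα0 := hβ0.trans hα
    rw [neg_neg] at s1 s2
    refine ⟨hζ, hδ, hγ, hβ, hα, ?_, ?_, ?_, ?_, ?_⟩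
    · rw [i1 hβ0 hα0]; linarith
    · rw [i2 hβ0 hα0]; linarith
    · rw [i3 _ _ hδ, i4 _ _ _ hγ0 hβ0]; linarith
    · rw [i3 _ _ hβ0]; linarith
    · rw [i5 _ _ hγ0, i5 _ _ hδ]; linarith

/-- The sign change required of the derivative of w₀ - w₁ is that of the gap of the point
C_{-rK₁}(α), reversed. -/
lemma gapDeriv_eq {K₁ α x : ℝ} (hx : 0 < x) (hα : 0 < α) :
    M.gapDeriv K₁ α x = -(x ^ (M.m - 1) / (M.σ ^ 2 * (M.n - M.m)) *
      H.gap (H.p (-(M.r * K₁)) α) (H.q (-(M.r * K₁)) α) x) := by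
  have hm : M.m ≠ 0 := fun h => by have := H.mu_pos; rw [h] at this; simp at this
  have hn := H.n_pos.ne'
  have e : x ^ (M.n - 1) = x ^ (M.m - 1) * x ^ (M.n + -M.m) := by
    rw [← Real.rpow_add hx]; ring_nf
  rw [H.gap_eq (-(M.r * K₁)) _ _ hx, gapDeriv]
  simp only [sub_eq_add_neg (M.h _)]
  rw [H.integral_low _ hx.le hα.le, H.integral_up _ hx hα, e, mul_div_assoc', mul_div_assoc']
  field_simp
  ring

lemma gapDeriv_pos_iff (hσ : M.σ ≠ 0) {K₁ α x : ℝ} (hx : 0 < x) (hα : 0 < α) :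
    (0 < M.gapDeriv K₁ α x ↔ H.gap (H.p (-(M.r * K₁)) α) (H.q (-(M.r * K₁)) α) x < 0) ∧
    (M.gapDeriv K₁ α x < 0 ↔ 0 < H.gap (H.p (-(M.r * K₁)) α) (H.q (-(M.r * K₁)) α) x) := by
  have h1 : 0 < x ^ (M.m - 1) / (M.σ ^ 2 * (M.n - M.m)) :=
    div_pos (Real.rpow_pos_of_pos hx _)
      (mul_pos (by positivity) (by linarith [H.mu_pos, H.n_pos]))
  rw [gapDeriv_eq H hx hα]
  constructor
  · rw [← mul_neg, mul_pos_iff_of_pos_left h1, neg_pos]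
  · rw [neg_lt_zero, mul_pos_iff_of_pos_left h1]

/-- The pair is unique, and two sign-change points would give opposite strict signs in between;
hence K₀† is the single value k₀/r. -/
lemma exists_isK₀Dagger_iff (hσ : M.σ ≠ 0) (hr : 0 < M.r) {K₁ d ζ α : ℝ}
    (hp : H.IsPair (-(M.r * M.K)) (M.r * K₁) d ζ α) (hE : 0 < -(M.r * M.K)) (hk : 0 < M.r * K₁)
    (hd : 0 < d) (hqd : H.q (-(-(M.r * M.K))) d = 0) (hζ : ζ < d) :
    ∃ y k₀, d < y ∧
      (∀ x, d ≤ x → x < y → H.gap (H.p (-(M.r * K₁)) α) (H.q (-(M.r * K₁)) α) x < 0) ∧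
      H.p k₀ y = H.p (-(M.r * K₁)) α ∧ H.q k₀ y = H.q (-(M.r * K₁)) α ∧
      (∀ s, 0 < s → s < y → M.h s + k₀ ≤ 0) ∧ 0 < k₀ ∧
      ∀ k, M.IsK₀Dagger d K₁ k ↔ M.r * k = k₀ := by
  obtain ⟨y, k₀, hdy, hyα, hneg, hpos, hk₀, hpy, hqy, hle⟩ :=
    Payoff.IsPair.exists_signChange H hp hE hk hd hqd hζ
  have hn := H.n_pos.ne'
  have hy := hd.trans hdy
  have hα := hy.trans hyα
  have hchange : M.IsSignChange d K₁ α y :=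
    ⟨hdy, hyα, fun x h1 h2 => ((gapDeriv_pos_iff H hσ (hd.trans_le h1) hα).1).2 (hneg x h1 h2),
      fun x h1 h2 => ((gapDeriv_pos_iff H hσ (hy.trans h1) hα).2).2 (hpos x h1 h2)⟩
  have hval : ∀ k, (k = -K₁ - M.n * y ^ M.n / M.r *
      ∫ s in y..α, s ^ (-M.n - 1) * (M.h s - M.r * K₁)) ↔ M.r * k = k₀ := by
    intro k
    simp only [sub_eq_add_neg (M.h _)]
    rw [H.integral_up _ hy hα, ← hqy, H.q_eq k₀ (-(M.r * K₁)) y, Real.rpow_neg hy.le]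
    have hB : y ^ M.n ≠ 0 := (Real.rpow_pos_of_pos hy _).ne'
    field_simp
    constructor <;> intro h <;> linarith
  refine ⟨y, k₀, hdy, hneg, hpy, hqy, hle, hk₀, fun k => ?_⟩
  constructor
  · rintro ⟨ζ', α', y', hp', ⟨h1, h2, h3, h4⟩, hk'⟩
    obtain ⟨rfl, rfl⟩ := Payoff.IsPair.unique H hp ((isNoSwitchOutPair_iff H hd hqd).1 hp')
      hE hk hd hqd
    obtain rfl : y' = y := by
      obtain ⟨-, -, h3', h4'⟩ := hchange
      rcases lt_trichotomy y' y with h | h | h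
      · obtain ⟨x, hx1, hx2⟩ := exists_between h
        exact absurd (h3' x (h1.trans hx1).le hx2) (not_lt.2 (h4 x hx1 (hx2.trans hyα)).le)
      · exact h
      · obtain ⟨x, hx1, hx2⟩ := exists_between h
        exact absurd (h3 x (hdy.trans hx1).le hx2) (not_lt.2 (h4' x hx1 (hx2.trans h2)).le)
    exact (hval k).1 hk'
  · intro h
    exact ⟨ζ, α, y, (isNoSwitchOutPair_iff H hd hqd).2 hp, hchange, (hval k).2 h⟩

/-- Both components of the pair increase strictly with the cost, and ζ = d at the cost k of
`exists_isPair_self`. This makes K₁† = k/r. -/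
lemma exists_isK₁Dagger_iff (hr : 0 < M.r) {d : ℝ} (hE : 0 < -(M.r * M.K)) (hd : 0 < d)
    (hqd : H.q (-(-(M.r * M.K))) d = 0) (hhd : M.h d < 0) :
    ∃ k, 0 < k ∧ (∀ k₁, M.IsK₁Dagger d k₁ ↔ k₁ = k) ∧
      ∀ K₁ ζ α, 0 < K₁ → M.IsNoSwitchOutPair d K₁ ζ α → (K₁ < k ↔ ζ < d) := by
  obtain ⟨k, a, hk, hka⟩ := H.exists_isPair_self hE hd hqd hhd
  have hrk : M.r * (k / M.r) = k := by field_simp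
  have hlt : ∀ K₁ ζ α, 0 < K₁ → M.IsNoSwitchOutPair d K₁ ζ α →
      (K₁ < k / M.r → ζ < d) ∧ (k / M.r < K₁ → d < ζ) := by
    intro K₁ ζ α hK hp
    have hp' := (isNoSwitchOutPair_iff H hd hqd).1 hp
    constructor <;> intro h
    · exact (Payoff.IsPair.strictMono H hp' hka hE (mul_pos hr hK)
        ((lt_div_iff₀' hr).1 h) hd hqd).1
    · exact (Payoff.IsPair.strictMono H hka hp' hE hk ((div_lt_iff₀' hr).1 h) hd hqd).1
  refine ⟨k / M.r, by positivity, fun k₁ => ⟨?_, ?_⟩, fun K₁ ζ α hK hp =>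
    ⟨(hlt K₁ ζ α hK hp).1, fun h => ?_⟩⟩
  · rintro ⟨hk₁, hdag⟩
    by_contra hne
    -- Two candidates for K₁† would disagree about ζ at any cost strictly between them, where a pair
    -- exists.
    have key : ∀ a b, 0 < a → a < b → ∃ K₁ ζ α, a < K₁ ∧ K₁ < b ∧ 0 < K₁ ∧
        M.IsNoSwitchOutPair d K₁ ζ α := by
      intro a b ha hab
      obtain ⟨K₁, h1, h2⟩ := exists_between hab
      obtain ⟨ζ, α, hp, -⟩ := H.exists_isPair hE (mul_pos hr (ha.trans h1)) hd hqd
      exact ⟨K₁, ζ, α, h1, h2, ha.trans h1, (isNoSwitchOutPair_iff H hd hqd).2 hp⟩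
    rcases lt_or_gt_of_ne hne with h | h
    · obtain ⟨K₁, ζ, α, h1, h2, h3, hp⟩ := key _ _ hk₁ h
      exact lt_asymm ((hlt K₁ ζ α h3 hp).1 h2) ((hdag K₁ h3 ζ α hp).2 h1)
    · obtain ⟨K₁, ζ, α, h1, h2, h3, hp⟩ := key _ _ (by positivity) h
      exact lt_asymm ((hlt K₁ ζ α h3 hp).2 h1) ((hdag K₁ h3 ζ α hp).1 h2)
  · rintro rfl
    exact ⟨by positivity, fun K₁ hK ζ α hp => hlt K₁ ζ α hK hp⟩
  · rcases lt_trichotomy K₁ (k / M.r) with h' | h' | h'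
    · exact h'
    · rw [h'] at hp
      have hp' := (isNoSwitchOutPair_iff H hd hqd).1 hp
      rw [hrk] at hp'
      exact absurd (Payoff.IsPair.unique H hp' hka hE hk hd hqd).1 h.ne
    · exact absurd ((hlt K₁ ζ α hK hp).2 h') (not_lt.2 h.le)

end SwitchingModel

/-! ### Verification of the HJB equation in the original variables. -/

lemma IsC1.contDiffOn {f f' : ℝ → ℝ} (hf : IsC1 f f') : ContDiffOn ℝ 1 f (Ioi 0) := by
  rw [contDiffOn_one_iff_derivWithin (uniqueDiffOn_Ioi 0)]
  refine ⟨fun x hx => (hf.1 x hx).differentiableAt.differentiableWithinAt, hf.2.congr fun x hx => ?_⟩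
  rw [derivWithin_of_isOpen isOpen_Ioi hx, (hf.1 x hx).deriv]

lemma max_max_eq_zero {a b c : ℝ} (ha : a ≤ 0) (hb : b ≤ 0) (hc : c ≤ 0)
    (h : a = 0 ∨ b = 0 ∨ c = 0) : max a (max b c) = 0 := by
  refine le_antisymm (max_le ha (max_le hb hc)) ?_
  rcases h with h | h | h <;> simp [h]

namespace SwitchingModel

variable {M : SwitchingModel}

/-- By monotonicity the limit at 0 is the infimum of h, which reduces extended real values to real
ones. -/
lemma lt_hZero_iff (hm : MonotoneOn M.h (Ioi 0)) {c : ℝ} :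
    M.hZero < (c : EReal) ↔ ∃ x, 0 < x ∧ M.h x < c := by
  have ht := M.tendsto_hZero hm
  constructor
  · intro h
    obtain ⟨x, hx, hx0⟩ := ((ht.eventually (gt_mem_nhds h)).and self_mem_nhdsWithin).exists
    exact ⟨x, hx0, EReal.coe_lt_coe_iff.1 hx⟩
  · rintro ⟨x, hx, hxc⟩
    refine lt_of_le_of_lt (le_of_tendsto ht ?_) (EReal.coe_lt_coe_iff.2 hxc)
    filter_upwards [Ioo_mem_nhdsGT hx] with y hy
    exact EReal.coe_le_coe_iff.2 (hm hy.1 hx hy.2.le)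

/-- The scaling factor between the functions of this file and those of the model. -/
noncomputable def scale (M : SwitchingModel) : ℝ := 1 / (M.σ ^ 2 * (M.n - M.m))

variable (H : Payoff (-M.m) M.n M.h)
include H

lemma scale_pos (hσ : M.σ ≠ 0) : 0 < M.scale :=
  one_div_pos.2 (mul_pos (by positivity) (by linarith [H.mu_pos, H.n_pos]))

lemma scale_mul (hσ : M.σ ≠ 0) : M.σ ^ 2 * M.scale * (M.n + -M.m) = 1 := by
  have h1 : M.n - M.m ≠ 0 := by linarith [H.mu_pos, H.n_pos]
  rw [scale, ← sub_eq_add_neg]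
  field_simp

/-- Since r = σ²μn, the factor 1/μ + 1/n is cancelled by the scaling, and a piece with constant rc
becomes the constant c. -/
lemma scale_const (hσ : M.σ ≠ 0) (hr' : M.r = M.σ ^ 2 * (-M.m * M.n)) (c : ℝ) :
    M.scale * (M.r * c * (1 / -M.m + 1 / M.n)) = c := by
  have h1 : M.n - M.m ≠ 0 := by linarith [H.mu_pos, H.n_pos]
  have h2 := H.mu_pos.ne'
  have h2' : M.m ≠ 0 := fun h => h2 (by rw [h, neg_zero])
  have h3 := H.n_pos.ne'
  rw [scale, hr']
  field_simp
  ring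

lemma scale_mul_piece (ε a b c x : ℝ) (hx : 0 < x) :
    M.scale * H.piece ε a b c x = ε * M.R x + M.scale * a / -M.m * x ^ M.m +
      M.scale * b / M.n * x ^ M.n + M.scale * (c * (1 / -M.m + 1 / M.n)) := by
  have h2 := H.mu_pos.ne'
  have h2' : M.m ≠ 0 := fun h => h2 (by rw [h, neg_zero])
  have h3 := H.n_pos.ne'
  rw [H.piece_const ε a b c 0 hx, Payoff.piece, R, ← scale]
  simp only [Payoff.p, Payoff.q, neg_neg]
  field_simp
  ring

section solution

variable {K₁ K₀ : ℝ} {p : FreeBoundary}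
  (hs : H.IsSystem (-(M.r * M.K)) (M.r * K₀) (M.r * K₁) p.ζ p.δ p.γ p.β p.α)

include hs

lemma coefficients_eq :
    M.Gamma₁ p = M.scale * -H.p (-(-(M.r * M.K))) p.δ / -M.m ∧
    M.Gamma₂ p = M.scale * -H.q (-(-(M.r * M.K))) p.δ / M.n ∧
    M.Delta₁ p = M.scale * (-(M.r * M.K) * p.ζ ^ (-M.m)) / -M.m ∧
    M.Delta₂ p = M.scale * (-(M.r * M.K) * p.ζ ^ (-M.n)) / M.n ∧
    M.A K₁ p = M.scale * (-(M.r * M.K) * p.ζ ^ (-M.m) - H.p (M.r * K₀) p.β) / -M.m := by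
  obtain ⟨hδ, hγ, hβ, hα⟩ := Payoff.IsSystem.pos H hs
  have h1 : M.n - M.m ≠ 0 := by linarith [H.mu_pos, H.n_pos]
  have h2 := H.mu_pos.ne'
  have h2' : M.m ≠ 0 := fun h => h2 (by rw [h, neg_zero])
  have h3 := H.n_pos.ne'
  have hΔ : M.Delta₁ p = M.scale * (-(M.r * M.K) * p.ζ ^ (-M.m)) / -M.m := by
    rw [Delta₁, scale]
    field_simp
  refine ⟨?_, ?_, hΔ, ?_, ?_⟩
  · rw [Gamma₁, ← scale, H.integral_low _ le_rfl hδ.le, H.p_zero, neg_neg]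
    ring
  · rw [Gamma₂, ← scale, H.integral_top _ hδ, neg_neg]
    ring
  · rw [Delta₂, scale]
    field_simp
  · rw [A, ← scale]
    simp only [sub_eq_add_neg (M.h _)]
    -- The coefficient A, defined at α, is re-expressed at β by the first switching equation.
    rw [H.integral_low _ le_rfl hα.le, H.p_zero, ← hs.switch.p_eq, hΔ]
    ring

lemma w₁_eq (hσ : M.σ ≠ 0) (hr' : M.r = M.σ ^ 2 * (-M.m * M.n)) {x : ℝ}
    (hx : 0 < x) :
    M.w₁ K₁ K₀ p x = M.scale * H.W₁ (-(M.r * M.K)) (M.r * K₀) p.ζ p.δ p.γ p.β x := by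
  obtain ⟨c1, c2, c3, c4, c5⟩ := coefficients_eq H hs
  obtain ⟨-, mγ, -, -, -⟩ := Payoff.IsSystem.pieces_match H hs
  have hδγ := hs.inner.x_lt
  have hγβ := hs.g_lt
  have k₀ := scale_const H hσ hr' K₀
  have kE := scale_const H hσ hr' M.K
  rw [w₁]
  split_ifs with h1 h2 h3
  · rw [H.W₁_left h1, scale_mul_piece H _ _ _ _ x hx]
    simp only [mul_zero, zero_div, zero_mul]
    linarith
  · rw [H.W₁_inner (not_le.1 h1) h2.le, scale_mul_piece H _ _ _ _ x hx, c1, c2]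
    ring
  -- The model assigns x = γ to the middle piece and `W₁` assigns it to the inner one; smooth fit
  -- makes them agree.
  · have e : H.W₁ (-(M.r * M.K)) (M.r * K₀) p.ζ p.δ p.γ p.β x = H.piece 0
        (-(M.r * M.K) * p.ζ ^ (-M.m)) (-(M.r * M.K) * p.ζ ^ (-M.n)) (-(M.r * K₀)) x := by
      rcases (not_lt.1 h2).eq_or_lt with h | h
      · rw [H.W₁_inner (not_le.1 h1) h.ge, ← h]
        exact H.piece_congr mγ.1 mγ.2
      · exact H.W₁_middle hδγ h h3
    rw [e, scale_mul_piece H _ _ _ _ x hx, c3, c4]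
    linarith
  · rw [H.W₁_right hδγ hγβ (not_le.1 h3), scale_mul_piece H _ _ _ _ x hx, c5]
    ring

lemma w₀_eq (hσ : M.σ ≠ 0) (hr' : M.r = M.σ ^ 2 * (-M.m * M.n))
    (hζα : p.ζ < p.α) {x : ℝ} (hx : 0 < x) :
    M.w₀ K₁ p x = M.scale * H.W₀ (-(M.r * M.K)) (M.r * K₀) (M.r * K₁) p.ζ p.β p.α x := by
  obtain ⟨c1, c2, c3, c4, c5⟩ := coefficients_eq H hs
  obtain ⟨-, -, -, -, mα⟩ := Payoff.IsSystem.pieces_match H hs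
  have k₁ := scale_const H hσ hr' K₁
  have kE := scale_const H hσ hr' M.K
  rw [w₀]
  split_ifs with h1 h2
  · rw [H.W₀_left h1, scale_mul_piece H _ _ _ _ x hx]
    simp only [mul_zero, zero_div, zero_mul]
    linarith
  · rw [H.W₀_middle (not_le.1 h1) h2.le, scale_mul_piece H _ _ _ _ x hx, c3, c4]
    ring
  · have e : H.W₀ (-(M.r * M.K)) (M.r * K₀) (M.r * K₁) p.ζ p.β p.α x = H.piece 1
        (-(M.r * M.K) * p.ζ ^ (-M.m) - H.p (M.r * K₀) p.β) 0 (-(M.r * K₁)) x := by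
      rcases (not_lt.1 h2).eq_or_lt with h | h
      · rw [H.W₀_middle (not_le.1 h1) h.ge, ← h]
        exact H.piece_congr mα.1 mα.2
      · exact H.W₀_right hζα h
    rw [e, scale_mul_piece H _ _ _ _ x hx, c5]
    simp only [mul_zero, zero_div, zero_mul]
    linarith

/-- The functions associated with a solution of the system are increasing and satisfy the HJB equation. -/
lemma verification (hσ : M.σ ≠ 0) (hr : 0 < M.r) (hr' : M.r = M.σ ^ 2 * (-M.m * M.n))
    (hb' : M.b = M.σ ^ 2 * (1 + -M.m - M.n)) (hK₁ : 0 < K₁) (hK₀ : 0 < K₀)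
    (hE : 0 < -(M.r * M.K)) {d : ℝ} (hd : 0 < d) (hqd : H.q (-(-(M.r * M.K))) d = 0) :
    0 < M.Gamma₁ p ∧ 0 < M.Gamma₂ p ∧ 0 < M.A K₁ p ∧ 0 < M.Delta₁ p ∧ 0 < M.Delta₂ p ∧
      MonotoneOn (M.w₁ K₁ K₀ p) (Ioi 0) ∧ MonotoneOn (M.w₀ K₁ p) (Ioi 0) ∧
      M.SolvesHJB K₁ K₀ (M.w₁ K₁ K₀ p) (M.w₀ K₁ p) := by
  obtain ⟨c1, c2, c3, c4, c5⟩ := coefficients_eq H hs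
  obtain ⟨hδ, hγ, hβ, hα⟩ := Payoff.IsSystem.pos H hs
  have hC := scale_pos H hσ
  have hμ := H.mu_pos
  have hn := H.n_pos
  have hk₀ : 0 < M.r * K₀ := mul_pos hr hK₀
  have hk₁ : 0 < M.r * K₁ := mul_pos hr hK₁
  have hkk := add_pos hk₀ hk₁
  have hhβ := Payoff.IsSwitch.h_lt H hs.switch hkk
  have hζδ := Payoff.IsInner.z_lt H hs.inner hE hk₀ hhβ hs.g_lt.le
  have hδd := Payoff.IsInner.x_lt_d H hs.inner hd hqd hhβ hs.g_lt hs.q_b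
  have hζα : p.ζ < p.α := hζδ.trans (hs.inner.x_lt.trans (hs.g_lt.trans hs.switch.b_lt))
  have hqδ : H.q (-(-(M.r * M.K))) p.δ < 0 := (H.q_neg_iff hd hqd hδ).2 hδd
  have hhd := H.h_lt_of_q_eq_zero hd hqd
  -- p_{-E} is negative up to d since h < E there. At δ this gives Γ₁ > 0, and at d, together with
  -- the inner inequality `hpβ`, it gives A > 0.
  have hneg : ∀ x, 0 < x → x ≤ d → H.p (-(-(M.r * M.K))) x < 0 := fun x hx hxd => by
    rw [← H.p_zero (-(-(M.r * M.K)))]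
    exact H.p_lt_of_neg le_rfl hx fun s hs => by
      linarith [H.mono' hs.1 (hs.2.le.trans hxd)]
  have hpβ := (Payoff.IsInner.p_lt_and_unique H hs.inner hs.g_lt hE hk₀ hd hqd hs.z_pos hhβ hs.q_b).1
  have hpd := hneg d hd le_rfl
  have hpδ := hneg p.δ hδ hδd.le
  have hhδ : M.h p.δ < -(M.r * M.K) := (H.mono' hδ hδd.le).trans_lt hhd
  have hw₁ : EqOn (M.w₁ K₁ K₀ p)
      (fun x => M.scale * H.W₁ (-(M.r * M.K)) (M.r * K₀) p.ζ p.δ p.γ p.β x) (Ioi 0) :=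
    fun x hx => w₁_eq H hs hσ hr' hx
  have hw₀ : EqOn (M.w₀ K₁ p)
      (fun x => M.scale * H.W₀ (-(M.r * M.K)) (M.r * K₀) (M.r * K₁) p.ζ p.β p.α x) (Ioi 0) :=
    fun x hx => w₀_eq H hs hσ hr' hζα hx
  have d1 := Payoff.IsSystem.isC1_W₁ H hs
  have d0 := Payoff.IsSystem.isC1_W₀ H hs hζα
  have ev : ∀ {f g : ℝ → ℝ} {x : ℝ}, 0 < x → EqOn f g (Ioi 0) → f =ᶠ[𝓝 x] g :=
    fun hx hfg => hfg.eventuallyEq_of_mem (Ioi_mem_nhds hx)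
  have e1 : ∀ x, 0 < x → HasDerivAt (M.w₁ K₁ K₀ p)
      (M.scale * H.dW₁ (-(M.r * M.K)) (M.r * K₀) p.ζ p.δ p.γ p.β x) x := fun x hx =>
    ((d1.1 x hx).const_mul _).congr_of_eventuallyEq (ev hx hw₁)
  have e0 : ∀ x, 0 < x → HasDerivAt (M.w₀ K₁ p)
      (M.scale * H.dW₀ (-(M.r * M.K)) (M.r * K₀) p.ζ p.β p.α x) x := fun x hx =>
    ((d0.1 x hx).const_mul _).congr_of_eventuallyEq (ev hx hw₀)
  refine ⟨?_, ?_, ?_, ?_, ?_, ?_, ?_, ?_⟩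
  · rw [c1]; exact div_pos (mul_pos hC (by linarith)) hμ
  · rw [c2]; exact div_pos (mul_pos hC (by linarith)) hn
  · rw [c5]; exact div_pos (mul_pos hC (by linarith)) hμ
  · rw [c3]; exact div_pos (mul_pos hC (mul_pos hE (Real.rpow_pos_of_pos hs.z_pos _))) hμ
  · rw [c4]; exact div_pos (mul_pos hC (mul_pos hE (Real.rpow_pos_of_pos hs.z_pos _))) hn
  · intro x hx y hy hxy
    rw [hw₁ hx, hw₁ hy]
    exact mul_le_mul_of_nonneg_left
      (Payoff.IsSystem.monotoneOn_W₁ H hs hE hζδ hqδ hx hy hxy) hC.le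
  · intro x hx y hy hxy
    rw [hw₀ hx, hw₀ hy]
    exact mul_le_mul_of_nonneg_left
      (Payoff.IsSystem.monotoneOn_W₀ H hs hE hζδ hx hy hxy) hC.le
  refine ⟨IsC1.contDiffOn ⟨e1, continuousOn_const.mul d1.2⟩,
    IsC1.contDiffOn ⟨e0, continuousOn_const.mul d0.2⟩,
    {p.ζ, p.δ, p.γ, p.β, p.α}, by simp, fun x hx hxF hc => ?_⟩
  simp only [mem_insert_iff, mem_singleton_iff, not_or] at hxF
  obtain ⟨n1, n2, n3, n4, n5⟩ := hxF
  obtain ⟨ε₁, c₁, ⟨D₁, hD₁, E₁⟩, l₁, s₁⟩ :=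
    Payoff.IsSystem.euler_W₁ H hs hkk hζδ hhδ hx hc n2 n3 n4
  obtain ⟨ε₀, c₀, ⟨D₀, hD₀, E₀⟩, l₀, s₀⟩ :=
    Payoff.IsSystem.euler_W₀ H hs hE hkk hζδ hx hc n1 n5
  have hD₁' := (hD₁.const_mul M.scale).congr_of_eventuallyEq
    (ev hx fun y hy => (e1 y hy).deriv)
  have hD₀' := (hD₀.const_mul M.scale).congr_of_eventuallyEq
    (ev hx fun y hy => (e0 y hy).deriv)
  refine ⟨hD₁'.differentiableAt, hD₀'.differentiableAt, ?_, ?_⟩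
  all_goals
    have kE := scale_const H hσ hr' M.K
    have kk₀ := scale_const H hσ hr' K₀
    have kk₁ := scale_const H hσ hr' K₁
    have hone := scale_mul H hσ
    have b1 := mul_le_mul_of_nonneg_left (Payoff.IsSystem.le_W₁ H hs hE hζδ hqδ hx) hC.le
    have b0 := mul_le_mul_of_nonneg_left (Payoff.IsSystem.le_W₀ H hs hE hζδ hx) hC.le
    obtain ⟨g1, g2⟩ := Payoff.IsSystem.W_sub_le_and_ge H hs hE hk₀ hk₁ hζδ hx
    have g1' := mul_le_mul_of_nonneg_left g1 hC.le
    have g2' := mul_le_mul_of_nonneg_left g2 hC.le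
  · rw [hD₁'.deriv, (e1 x hx).deriv, hw₁ hx, hw₀ hx]
    -- Multiplying the normalised Euler identity by σ² times the scale recovers the model operator,
    -- by Vieta's formulas.
    have e : M.σ ^ 2 * x ^ 2 * (M.scale * D₁) +
        M.b * x * (M.scale * H.dW₁ (-(M.r * M.K)) (M.r * K₀) p.ζ p.δ p.γ p.β x) -
        M.r * (M.scale * H.W₁ (-(M.r * M.K)) (M.r * K₀) p.ζ p.δ p.γ p.β x) + M.h x =
        M.h x - (ε₁ * M.h x + c₁) := by
      rw [hb']
      nth_rewrite 3 [hr']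
      linear_combination (M.σ ^ 2 * M.scale) * E₁ - (ε₁ * M.h x + c₁) * hone
    rw [e]
    refine max_max_eq_zero l₁ (by linarith) (by linarith) (s₁.imp_right (Or.imp ?_ ?_))
    · intro h
      have := congrArg (M.scale * ·) h
      linarith
    · intro h
      have := congrArg (M.scale * ·) h
      linarith
  · rw [hD₀'.deriv, (e0 x hx).deriv, hw₁ hx, hw₀ hx]
    have e : M.σ ^ 2 * x ^ 2 * (M.scale * D₀) +
        M.b * x * (M.scale * H.dW₀ (-(M.r * M.K)) (M.r * K₀) p.ζ p.β p.α x) -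
        M.r * (M.scale * H.W₀ (-(M.r * M.K)) (M.r * K₀) (M.r * K₁) p.ζ p.β p.α x) =
        -(ε₀ * M.h x + c₀) := by
      rw [hb']
      linear_combination (M.σ ^ 2 * M.scale) * E₀ - (ε₀ * M.h x + c₀) * hone -
        (M.scale * H.W₀ (-(M.r * M.K)) (M.r * K₀) (M.r * K₁) p.ζ p.β p.α x) * hr'
    rw [e]
    refine max_max_eq_zero l₀ (by linarith) (by linarith) (s₀.imp_right (Or.imp ?_ ?_))
    · intro h
      have := congrArg (M.scale * ·) h
      linarith
    · intro h
      have := congrArg (M.scale * ·) h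
      linarith

end solution

end SwitchingModel

/-! ### The main theorem. -/

lemma Payoff.eq_of_q_eq_zero {μ n : ℝ} {h : ℝ → ℝ} (H : Payoff μ n h) {e d d' : ℝ} (hd : 0 < d)
    (hq : H.q (-e) d = 0) (hd' : 0 < d') (hq' : H.q (-e) d' = 0) : d' = d := by
  rcases lt_trichotomy d' d with h | h | h
  · exact absurd hq' ((H.q_neg_iff hd hq hd').2 h).ne
  · exact h
  · exact absurd hq' ((H.q_pos_iff hd hq hd').2 h).ne'

theorem mainTheorem9 {Ω : Type*} [MeasurableSpace Ω] (P : Measure Ω) [IsProbabilityMeasure P]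
    (W : ℝ≥0 → Ω → ℝ) (hW : IsBrownianReal W P) (M : SwitchingModel) (hM : M.Standing P W) :
    -- the critical values are well defined
    (M.hZero < ((-(M.r * M.K) : ℝ) : EReal) → ∃! d, M.IsDeltaDagger d) ∧
    (M.K < 0 → M.hZero < ((-(M.r * M.K) : ℝ) : EReal) → ∀ d, M.IsDeltaDagger d →
      (∀ K₁, 0 < K₁ → ∃! q : ℝ × ℝ, M.IsNoSwitchOutPair d K₁ q.1 q.2) ∧
      (M.h d < 0 →
        (∃! k₁, M.IsK₁Dagger d k₁) ∧
        ∀ k₁, M.IsK₁Dagger d k₁ → ∀ K₁, 0 < K₁ → K₁ < k₁ →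
          (∃! k₀, M.IsK₀Dagger d K₁ k₀) ∧ ∀ k₀, M.IsK₀Dagger d K₁ k₀ → 0 < k₀)) ∧
    -- the characterisation
    ∀ K₁ K₀ : ℝ, 0 < K₁ → 0 < K₀ →
      ((∃ p : FreeBoundary, M.IsSolution K₁ K₀ p ∧ (∀ q, M.IsSolution K₁ K₀ q → q = p) ∧
          0 < M.Gamma₁ p ∧ 0 < M.Gamma₂ p ∧ 0 < M.A K₁ p ∧ 0 < M.Delta₁ p ∧ 0 < M.Delta₂ p ∧
          MonotoneOn (M.w₁ K₁ K₀ p) (Ioi 0) ∧ MonotoneOn (M.w₀ K₁ p) (Ioi 0) ∧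
          M.SolvesHJB K₁ K₀ (M.w₁ K₁ K₀ p) (M.w₀ K₁ p)) ↔
        M.K < 0 ∧ M.hZero < ((-(M.r * K₀) : ℝ) : EReal) ∧
          ∃ d, M.IsDeltaDagger d ∧ M.h d < 0 ∧
            ∃ k₁, M.IsK₁Dagger d k₁ ∧ K₁ < k₁ ∧
              ∃ k₀, M.IsK₀Dagger d K₁ k₀ ∧ K₀ < k₀) := by
  have hσ := hM.sigma_ne
  have hr := hM.r_pos
  obtain ⟨-, -, hr', hb'⟩ := SwitchingModel.exponents hM
  have H := SwitchingModel.payoff hW hM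
  have hE_iff : 0 < -(M.r * M.K) ↔ M.K < 0 := by
    rw [neg_pos, ← neg_pos, ← mul_neg, mul_pos_iff_of_pos_left hr, neg_pos]
  refine ⟨fun h0 => ?_, fun hK _ d hd => ?_, fun K₁ K₀ hK₁ hK₀ => ⟨?_, ?_⟩⟩
  · obtain ⟨x, hx, hxE⟩ := (SwitchingModel.lt_hZero_iff hM.mono).1 h0
    obtain ⟨d, hd, hqd, -⟩ := H.exists_zero_q hx hxE
    refine ⟨d, (SwitchingModel.isDeltaDagger_iff H).2 ⟨hd, hqd⟩, fun d' hd' => ?_⟩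
    obtain ⟨h1, h2⟩ := (SwitchingModel.isDeltaDagger_iff H).1 hd'
    exact H.eq_of_q_eq_zero hd hqd h1 h2
  · obtain ⟨hd, hqd⟩ := (SwitchingModel.isDeltaDagger_iff H).1 hd
    have hE := hE_iff.2 hK
    refine ⟨fun K₁ hK₁ => ?_, fun hhd => ?_⟩
    · obtain ⟨ζ, α, hp, hu, -⟩ := H.exists_isPair hE (mul_pos hr hK₁) hd hqd
      refine ⟨(ζ, α), (SwitchingModel.isNoSwitchOutPair_iff H hd hqd).2 hp, fun q hq => ?_⟩
      obtain ⟨h1, h2⟩ := hu _ _ ((SwitchingModel.isNoSwitchOutPair_iff H hd hqd).1 hq)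
      exact Prod.ext h1 h2
    · obtain ⟨k, -, hdag, hlt⟩ := SwitchingModel.exists_isK₁Dagger_iff H hr hE hd hqd hhd
      refine ⟨⟨k, (hdag k).2 rfl, fun k' hk' => (hdag k').1 hk'⟩, fun k₁ hk₁ K₁ hK₁ hKk => ?_⟩
      rw [(hdag k₁).1 hk₁] at hKk
      obtain ⟨ζ, α, hp, -⟩ := H.exists_isPair hE (mul_pos hr hK₁) hd hqd
      have hζ := (hlt K₁ ζ α hK₁ ((SwitchingModel.isNoSwitchOutPair_iff H hd hqd).2 hp)).1 hKk
      obtain ⟨y, k₀, -, -, -, -, -, hk₀, hiff⟩ :=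
        SwitchingModel.exists_isK₀Dagger_iff H hσ hr hp hE (mul_pos hr hK₁) hd hqd hζ
      refine ⟨⟨k₀ / M.r, (hiff _).2 (by field_simp), fun k hk => ?_⟩, fun k hk => ?_⟩
      · rw [eq_div_iff hr.ne', mul_comm]
        exact (hiff k).1 hk
      · exact pos_of_mul_pos_right (((hiff k).1 hk).symm ▸ hk₀) hr.le
  · rintro ⟨p, hsol, -, -, -, -, hΔ₁, -⟩
    have hs := (SwitchingModel.isSolution_iff H).1 hsol
    have hk₀ := mul_pos hr hK₀
    have hk₁ := mul_pos hr hK₁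
    -- Positivity of Δ₁ is positivity of E ζ^μ, and so forces K < 0.
    have hE : 0 < -(M.r * M.K) := by
      rw [(SwitchingModel.coefficients_eq H hs).2.2.1, div_pos_iff_of_pos_right H.mu_pos,
        mul_pos_iff_of_pos_left (SwitchingModel.scale_pos H hσ)] at hΔ₁
      exact pos_of_mul_pos_left hΔ₁ (Real.rpow_nonneg hs.z_pos.le _)
    have hβ := hs.switch.b_pos
    have hhβ := Payoff.IsSwitch.h_lt H hs.switch (add_pos hk₀ hk₁)
    -- Since h(β) < -rK₀ < E, the level E is undercut and δ† exists; d < β then yields h(d) < 0.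
    obtain ⟨d, hd, hqd, -⟩ := H.exists_zero_q (e := -(M.r * M.K)) hβ (by linarith)
    obtain ⟨ζ, α, hp, -⟩ := H.exists_isPair hE hk₁ hd hqd
    obtain ⟨hdβ, -, hζd⟩ := Payoff.IsSystem.lt_of_isPair H hs hp hE hk₀ hk₁ hd hqd
    have hhd : M.h d < 0 := by linarith [H.mono' hd hdβ.le]
    obtain ⟨k, -, hdag, hlt⟩ := SwitchingModel.exists_isK₁Dagger_iff H hr hE hd hqd hhd
    obtain ⟨y, k₀, hdy, hneg, hpy, hqy, -, -, hiff⟩ :=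
      SwitchingModel.exists_isK₀Dagger_iff H hσ hr hp hE hk₁ hd hqd hζd
    refine ⟨hE_iff.1 hE, (SwitchingModel.lt_hZero_iff hM.mono).2 ⟨p.β, hβ, by linarith⟩, d,
      (SwitchingModel.isDeltaDagger_iff H).2 ⟨hd, hqd⟩, hhd, k, (hdag k).2 rfl,
      (hlt K₁ ζ α hK₁ ((SwitchingModel.isNoSwitchOutPair_iff H hd hqd).2 hp)).2 hζd,
      k₀ / M.r, (hiff _).2 (by field_simp), ?_⟩
    rw [lt_div_iff₀' hr]
    exact Payoff.IsSystem.k₀_lt H hs hp hE hk₀ hk₁ hd hqd hdy hneg hpy hqy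
  · rintro ⟨hK, -, d, hdd, hhd, k₁, hdag₁, hKk₁, k₀, hdag₀, hKk₀⟩
    obtain ⟨hd, hqd⟩ := (SwitchingModel.isDeltaDagger_iff H).1 hdd
    have hE := hE_iff.2 hK
    have hk₀ := mul_pos hr hK₀
    have hk₁ := mul_pos hr hK₁
    obtain ⟨ζ, α, hp, -⟩ := H.exists_isPair hE hk₁ hd hqd
    have hζd : ζ < d := (hdag₁.2 K₁ hK₁ ζ α
      ((SwitchingModel.isNoSwitchOutPair_iff H hd hqd).2 hp)).1 hKk₁
    obtain ⟨y, k, hdy, hneg, hpy, hqy, hle, -, hiff⟩ :=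
      SwitchingModel.exists_isK₀Dagger_iff H hσ hr hp hE hk₁ hd hqd hζd
    -- The given K₀† must be k/r, so K₀ < K₀† is the condition needed for lowering the switch-out
    -- cost from k to rK₀.
    have hkk : M.r * K₀ < k := by
      rw [← (hiff k₀).1 hdag₀]
      exact mul_lt_mul_of_pos_left hKk₀ hr
    obtain ⟨z, x, g, b, a, hs⟩ :=
      H.exists_isSystem hp hE hk₀ hk₁ hd hqd hdy hle hpy hqy hkk
    refine ⟨⟨z, x, g, b, a⟩, (SwitchingModel.isSolution_iff H).2 hs, fun q hq => ?_,
      SwitchingModel.verification H hs hσ hr hr' hb' hK₁ hK₀ hE hd hqd⟩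
    obtain ⟨h1, h2, h3, h4, h5⟩ := Payoff.IsSystem.unique H hs
      ((SwitchingModel.isSolution_iff H).1 hq) hE hk₀ hk₁ hd hqd
    exact FreeBoundary.ext h1 h2 h3 h4 h5
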